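/- For $\eta\in[0,1]$ and positive integers $n,m$, let $\mathrm{LPN}_{\eta,n,m}$ be the following search problem: a secret $s\in\mathbb F_2^n$ and a matrix $A\in\mathbb F_2^{m\times n}$ are drawn uniformly and independently, together with an independent noise vector $e\in\mathbb F_2^m$ with independent coordinates, each equal to $1$ with probability $\eta$ and to $0$ otherwise; given $(A,As+e)$, recover $s$. A randomized solver has success probability $\alpha$ if $\Pr[\text{output}=s]\ge\alpha$, over $s,A,e$ and its internal randomness. Let $H_2(\rho)=-\rho\log_2\rho-(1-\rho)\log_2(1-\rho)$, and let $\log$ be the natural logarithm. Theorem. There is a single randomized oracle algorithm $R$ for which the following holds. Let $m,n,k$ be positive integers and let $\varepsilon>0$, $\delta>0$ and $\eta\in(0,1/8)$ be real numbers such that $$m>\frac{2}{1-H_2(4\eta)}\cdot n,\qquad \frac{192}{\delta}\log\frac{8}{\varepsilon}<k<\frac{\varepsilon}{8}\cdot\min\left(2^n,e^{\eta m/3}\right).$$ Whenever $R$ is given a (possibly randomized) oracle that solves $\mathrm{LPN}_{\frac{1-(1-2\eta)^k}{2},\,nk,\,m}$ with success probability $\varepsilon$, it solves $\mathrm{LPN}_{\eta,n,m}$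 with success probability $1-\delta$. For every oracle, on every instance, and for every outcome of the randomness, $R$ runs in time polynomial in $n,m,k,1/\delta,1/\varepsilon$ (each oracle query counting as one step) and makes a number of oracle queries that is at most polynomial in $n,k,1/\delta,1/\varepsilon$; the polynomials do not depend on the parameters. Here $R$ is a program for a unit-cost random access machine with addition and truncated subtraction of natural numbers, fair coin tosses and oracle queries (the oracle uses fresh randomness for each query). Its input consists of $n$, $m$, $k$, $\lceil 1/\varepsilon\rceil$, $\lceil 1/\delta\rceil$, the binary expansion of $\eta$ (read digit by digit), and the instance. -/

import Mathlib

open scoped ENNReal Matrix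

noncomputable section

namespace LPN

/-! ### The problem Search-LPN over the two-element field -/

/-- The binary entropy function in bits,
`H₂(ρ) = -ρ log₂ ρ - (1 - ρ) log₂ (1 - ρ)`
(Mathlib's `Real.binEntropy` is measured in nats). -/
def entropyTwo (ρ : ℝ) : ℝ := Real.binEntropy ρ / Real.log 2

/-- The probability mass function of `Ber(p)` on `𝔽₂`: mass `p` at `1` and `1 - p` at `0`.
(A parameter outside `[0, 1]` is moved to the nearest end point, so that the definition is
total.) -/
def berMass (p : ℝ) (x : ZMod 2) : ℝ≥0∞ :=
  if x = 1 then ENNReal.ofReal (max 0 (min p 1)) else ENNReal.ofReal (1 - max 0 (min p 1))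

lemma sum_berMass (p : ℝ) : ∑ x : ZMod 2, berMass p x = 1 := by
  have h : ∑ x : ZMod 2, berMass p x = berMass p 0 + berMass p 1 := Fin.sum_univ_two _
  have h0 : (0 : ZMod 2) ≠ 1 := by decide
  have h1 : max 0 (min p 1) ≤ 1 := max_le zero_le_one (min_le_right _ _)
  rw [h, berMass, berMass, if_neg h0, if_pos rfl,
    ← ENNReal.ofReal_add (by linarith) (le_max_left _ _)]
  simp

/-- The noise distribution `Ber(p)^m` on `𝔽₂^m`: independent `Ber(p)` coordinates. -/
def noise (p : ℝ) (m : ℕ) : PMF (Fin m → ZMod 2) :=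
  PMF.ofFintype (fun e => ∏ i, berMass p (e i)) (by
    rw [← Fintype.piFinset_univ, Finset.sum_prod_piFinset Finset.univ (fun _ => berMass p)]
    simp [sum_berMass])

/-- An instance `(A, b)` with `m` samples in dimension `n`: the rows of `A` are the query
vectors, the entries of `b` are the responses. -/
abbrev Inst (n m : ℕ) : Type := Matrix (Fin m) (Fin n) (ZMod 2) × (Fin m → ZMod 2)

/-- The distribution `LPN_{η,n,m}` of an instance together with its secret, `((A, A s + e), s)`,
for independent uniform `s` and `A` and `e ∼ Ber(η)^m`. -/
def lpn (η : ℝ) (n m : ℕ) : PMF (Inst n m × (Fin n → ZMod 2)) :=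
  (PMF.uniformOfFintype (Fin n → ZMod 2)).bind fun s =>
    (PMF.uniformOfFintype (Matrix (Fin m) (Fin n) (ZMod 2))).bind fun A =>
      (noise η m).bind fun e => PMF.pure ((A, A *ᵥ s + e), s)

/-- A randomized map from instances to candidate secrets (no efficiency is implied). -/
abbrev Solver (n m : ℕ) : Type := Inst n m → PMF (Fin n → ZMod 2)

/-- The probability, over `LPN_{η,n,m}` and the internal randomness of `S`, that `S` outputs the
secret of the instance. -/
def successProb (η : ℝ) {n m : ℕ} (S : Solver n m) : ℝ :=
  (∑ x : Inst n m × (Fin n → ZMod 2), lpn η n m x * S x.1 x.2).toReal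

/-! ### Randomized random access machines with an oracle

The programs below are structured programs for a unit-cost random access machine whose only
arithmetic instructions are addition and truncated subtraction of natural numbers, whose only
source of randomness is a fair coin, and which may query an oracle. All loops are counting loops,
so every program halts; the time spent is counted along the way. -/

/-- The state: registers, a family of unbounded two-dimensional arrays of natural numbers, the
number of steps made so far, and the number of oracle queries made so far. -/
structure State where
  reg : ℕ → ℕ
  arr : ℕ → ℕ → ℕ → ℕ
  time : ℕ
  queries : ℕ

/-- Let one unit of time pass. -/
def State.tick (s : State) : State := { s with time := s.time + 1 }

/-- `reg x := a`. -/
def State.setReg (s : State) (x a : ℕ) : State := { s with reg := Function.update s.reg x a }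

/-- `arr v i j := a`. -/
def State.setArr (s : State) (v i j a : ℕ) : State :=
  { s with arr := fun v' i' j' => if v' = v ∧ i' = i ∧ j' = j then a else s.arr v' i' j' }

/-- The programs. A program is a finite object that mentions no instance and no parameter. -/
inductive Prog : Type where
  | skip : Prog
  /-- `reg x := c` -/
  | const (x c : ℕ) : Prog
  /-- `reg x := reg y + reg z` -/
  | plus (x y z : ℕ) : Prog
  /-- `reg x := reg y - reg z`, truncated at `0` -/
  | minus (x y z : ℕ) : Prog
  /-- `reg x := arr v (reg y) (reg z)` -/
  | load (x v y z : ℕ) : Prog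
  /-- `arr v (reg y) (reg z) := reg x` -/
  | store (v y z x : ℕ) : Prog
  /-- `reg x :=` the result (`0` or `1`) of a fresh fair coin toss -/
  | coin (x : ℕ) : Prog
  /-- query the oracle on the instance in arrays `3` and `4`; the answer is put in array `5` -/
  | query : Prog
  /-- first `p`, then `r` -/
  | seq (p r : Prog) : Prog
  /-- `p` if `0 < reg x`, otherwise `r` -/
  | ifPos (x : ℕ) (p r : Prog) : Prog
  /-- `p`, repeated as many times as the value of `reg x` at the start of the loop -/
  | loop (x : ℕ) (p : Prog) : Prog

/-- The oracle query written in a state: the matrix is in array `3`, the vector is column `0` of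
array `4`, everything modulo `2`. -/
def State.oracleInput (N m : ℕ) (s : State) : Inst N m :=
  (Matrix.of fun i j => (s.arr 3 i j : ZMod 2), fun i => (s.arr 4 i 0 : ZMod 2))

/-- Array `5` is overwritten by the answer `z` of the oracle, in column `0`; one query is
counted. -/
def State.putAnswer {N : ℕ} (s : State) (z : Fin N → ZMod 2) : State :=
  { s with
    arr := Function.update s.arr 5 fun i j =>
      if h : i < N ∧ j = 0 then (z ⟨i, h.1⟩).val else 0
    queries := s.queries + 1 }

/-- The distribution of the final state of a program that runs with a (randomized) oracle `O`,
which uses fresh randomness for each query. Every elementary instruction, every oracle query,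
every test and every start of a loop and of one of its rounds takes one unit of time. -/
def Prog.run {N m : ℕ} (O : Solver N m) : Prog → State → PMF State
  | .skip, s => PMF.pure s.tick
  | .const x c, s => PMF.pure (s.setReg x c).tick
  | .plus x y z, s => PMF.pure (s.setReg x (s.reg y + s.reg z)).tick
  | .minus x y z, s => PMF.pure (s.setReg x (s.reg y - s.reg z)).tick
  | .load x v y z, s => PMF.pure (s.setReg x (s.arr v (s.reg y) (s.reg z))).tick
  | .store v y z x, s => PMF.pure (s.setArr v (s.reg y) (s.reg z) (s.reg x)).tick
  | .coin x, s => (PMF.uniformOfFintype (Fin 2)).bind fun c => PMF.pure (s.setReg x c).tick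
  | .query, s => (O (s.oracleInput N m)).bind fun z => PMF.pure (s.putAnswer z).tick
  | .seq p r, s => (Prog.run O p s).bind fun t => Prog.run O r t
  | .ifPos x p r, s => if 0 < s.reg x then Prog.run O p s.tick else Prog.run O r s.tick
  | .loop x p, s =>
      (fun μ : PMF State => μ.bind fun t => Prog.run O p t.tick)^[s.reg x] (PMF.pure s.tick)

/-- The initial state of a reduction. Registers `0, …, 4` hold `n`, `m`, `k`, `⌈1/ε⌉`, `⌈1/δ⌉`.
Array `0` holds `A`, column `0` of array `1` holds `b`, and column `0` of array `2` holds the binary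
expansion of `η`: its `i`-th entry is the digit of weight `2^{-(i+1)}`. All other cells are `0`. -/
def initState (n m k : ℕ) (ε δ η : ℝ) (x : Inst n m) : State where
  reg := fun r =>
    if r = 0 then n else if r = 1 then m else if r = 2 then k
    else if r = 3 then ⌈1 / ε⌉₊ else if r = 4 then ⌈1 / δ⌉₊ else 0
  arr := fun v i j =>
    if v = 0 then (if h : i < m ∧ j < n then (x.1 ⟨i, h.1⟩ ⟨j, h.2⟩).val else 0)
    else if v = 1 then (if h : i < m ∧ j = 0 then (x.2 ⟨i, h.1⟩).val else 0)
    else if v = 2 then (if j = 0 then ⌊(2 : ℝ) ^ (i + 1) * η⌋₊ % 2 else 0)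
    else 0
  time := 0
  queries := 0

/-- The output in a final state: the vector in column `0` of array `6`, modulo `2`. -/
def State.output (n : ℕ) (s : State) : Fin n → ZMod 2 := fun j => (s.arr 6 j 0 : ZMod 2)

/-- The distribution of the final state of the program `R` on the instance `x` of dimension `n`
with `m` samples, the oracle `O` being for dimension `n * k` with `m` samples. -/
def finalState (R : Prog) (n m k : ℕ) (ε δ η : ℝ) (O : Solver (n * k) m) (x : Inst n m) :
    PMF State :=
  R.run O (initState n m k ε δ η x)

/-- The solver computed by the program `R` with the oracle `O`. -/
def reduction (R : Prog) (n m k : ℕ) (ε δ η : ℝ) (O : Solver (n * k) m) : Solver n m :=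
  fun x => (finalState R n m k ε δ η O x).map (State.output n)

end LPN

end

/-! Put `k` independent instances side by side: the matrix `[A_1 … A_k]` with response `Σ_j (A_j s_j
+ e_j)` is an instance of dimension `n * k`. Its noise `Σ_j e_j` has rate `(1 - (1 - 2η)^k) / 2`,
because `1 - 2·rate` is multiplicative under independent sums (`noiseSum_eq_noise`,
`ex_joinedSuccess`). So the oracle finds all `k` secrets at once with probability at least `ε`. The
reduction plants the given instance in block `j`, makes up the other `k - 1` blocks, and reads block
`j` of the answer. By linearity only the response `A s + e` is needed for this, not `s` or `e`.

That most instances profit is a direct product argument. Call a sample exceptional if its success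
probabilities, summed over the positions `j`, are at most `ε/2`. Suppose the exceptional samples had
mass `b ≥ δ/2`. Either no block is exceptional, which has probability `(1 - b)^k ≤ ε/8`, or the
oracle succeeds with an exceptional block present, which contributes at most `b·ε/2`. Together this
is less than `ε` (`ex_iid_le`, `exceptional_lt`). For any other sample, one sweep over `j` misses
the secret with probability at most `exp(-ε/4)`, and `k⌈1/ε⌉` sweeps bring this down to `exp(-k/4)`.

The right candidate is recognised by violating the fewest samples. For `d ≠ 0` the vector `A d` is
uniform, so `A d + e` rarely lies in a ball of radius `4ηm`, while `e` rarely has weight `2ηm` or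
more (`ex_not_decodable_le`).

With fair coins only a dyadic noise rate can be sampled in bounded time. The program uses `4m`
digits of `η`; comparing probability masses pointwise shows that this loses at most a factor `2` in
each success probability (`half_ex_joinedSuccess_le`).

The program is tied to these distributions by couplings (`Sim`), composed instruction by instruction
up to `sim_attempt`, `ex_search_le` and `one_sub_le_reduction`. Since no loop counter changes while
loops governed by it may still run, a static cost function bounds the time (`Prog.run_bounds`,
`solve_bounds`). -/

noncomputable section

namespace LPN

/-! ### Expectations and couplings -/

/-- Expectation of a nonnegative function. -/
def ex {β : Type*} (ν : PMF β) (f : β → ℝ≥0∞) : ℝ≥0∞ := ∑' t, ν t * f t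

section Coupling

variable {α β γ δ : Type*}

lemma ex_pure (a : β) (f : β → ℝ≥0∞) : ex (PMF.pure a) f = f a := by
  classical
  simp [ex, PMF.pure_apply]

lemma ex_bind (ν : PMF α) (F : α → PMF β) (f : β → ℝ≥0∞) :
    ex (ν.bind F) f = ex ν fun a => ex (F a) f := by
  simp only [ex, PMF.bind_apply, ← ENNReal.tsum_mul_right, ← ENNReal.tsum_mul_left]
  rw [ENNReal.tsum_comm]
  simp only [mul_assoc]

lemma ex_map (ν : PMF α) (g : α → β) (f : β → ℝ≥0∞) :
    ex (ν.map g) f = ex ν fun a => f (g a) := by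
  rw [PMF.map, ex_bind]
  simp [ex_pure]

lemma ex_mono {ν : PMF α} {f g : α → ℝ≥0∞} (h : ∀ a ∈ ν.support, f a ≤ g a) :
    ex ν f ≤ ex ν g := by
  refine ENNReal.tsum_le_tsum fun a => ?_
  by_cases ha : ν a = 0
  · simp [ha]
  · exact mul_le_mul_right (h a ha) _

lemma ex_const (ν : PMF α) (c : ℝ≥0∞) : ex ν (fun _ => c) = c := by
  simp [ex, ENNReal.tsum_mul_right, PMF.tsum_coe]

lemma ex_const_mul (ν : PMF α) (c : ℝ≥0∞) (f : α → ℝ≥0∞) :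
    ex ν (fun a => c * f a) = c * ex ν f := by
  simp only [ex, ← ENNReal.tsum_mul_left]
  exact tsum_congr fun a => mul_left_comm _ _ _

lemma ex_add (ν : PMF α) (f g : α → ℝ≥0∞) :
    ex ν (fun a => f a + g a) = ex ν f + ex ν g := by
  simp only [ex, mul_add, ENNReal.tsum_add]

lemma ex_eq_sum [Fintype α] (ν : PMF α) (f : α → ℝ≥0∞) : ex ν f = ∑ a, ν a * f a :=
  tsum_fintype _

lemma ex_single [DecidableEq α] (ν : PMF α) (a : α) :
    ex ν (fun x => if x = a then 1 else 0) = ν a := by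
  simp [ex]

/-- All outcomes of positive probability satisfy `P`. -/
def Alw (ν : PMF β) (P : β → Prop) : Prop := ∀ t ∈ ν.support, P t

lemma Alw.mono {ν : PMF β} {P Q : β → Prop} (h : Alw ν P) (hPQ : ∀ t, P t → Q t) : Alw ν Q :=
  fun t ht => hPQ t (h t ht)

lemma Alw.and {ν : PMF β} {P Q : β → Prop} (h : Alw ν P) (h' : Alw ν Q) :
    Alw ν fun t => P t ∧ Q t := fun t ht => ⟨h t ht, h' t ht⟩

lemma alw_pure {a : β} {P : β → Prop} : Alw (PMF.pure a) P ↔ P a := by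
  simp [Alw]

lemma Alw.bind {ν : PMF α} {F : α → PMF β} {P : α → Prop} {Q : β → Prop} (h : Alw ν P)
    (h' : ∀ a, P a → Alw (F a) Q) : Alw (ν.bind F) Q := by
  intro t ht
  obtain ⟨a, ha, hat⟩ := (PMF.mem_support_bind_iff _ _ _).1 ht
  exact h' a (h a ha) t hat

lemma alw_map {ν : PMF α} {g : α → β} {P : β → Prop} :
    Alw (ν.map g) P ↔ Alw ν fun a => P (g a) := by
  simp only [Alw, PMF.mem_support_map_iff]
  exact ⟨fun h a ha => h _ ⟨a, ha, rfl⟩, fun h t ⟨a, ha, e⟩ => e ▸ h a ha⟩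

/-- There is a coupling of `ν` and `μ` that is supported on the relation `Rel`. -/
def Sim (ν : PMF β) (μ : PMF α) (Rel : β → α → Prop) : Prop :=
  ∃ κ : PMF (β × α), κ.map Prod.fst = ν ∧ κ.map Prod.snd = μ ∧ ∀ x ∈ κ.support, Rel x.1 x.2

lemma Sim.mono {ν : PMF β} {μ : PMF α} {P Q : β → α → Prop} (h : Sim ν μ P)
    (hPQ : ∀ t a, P t a → Q t a) : Sim ν μ Q := by
  obtain ⟨κ, h1, h2, h3⟩ := h
  exact ⟨κ, h1, h2, fun x hx => hPQ _ _ (h3 x hx)⟩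

/-- The product distribution serves. It fills in the kernel of `Sim.bind` at pairs outside the
relation. -/
lemma exists_coupling (ν : PMF β) (μ : PMF α) :
    ∃ κ : PMF (β × α), κ.map Prod.fst = ν ∧ κ.map Prod.snd = μ := by
  refine ⟨ν.bind fun t => μ.map fun a => (t, a), ?_, ?_⟩
  · rw [PMF.map_bind]
    simp only [PMF.map_comp]
    conv_rhs => rw [← PMF.bind_pure ν]
    congr 1
    funext t
    exact PMF.map_const _ _
  · rw [PMF.map_bind]
    simp only [PMF.map_comp]
    have : ∀ t : β, PMF.map (Prod.snd ∘ fun a => (t, a)) μ = μ := fun t => PMF.map_id μ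
    simp only [this, PMF.bind_const]

/-- Couplings are glued along a coupling of the starting points. Pairs outside `P` have mass zero,
so an arbitrary coupling may be chosen there. -/
lemma Sim.bind {ν : PMF β} {μ : PMF α} {P : β → α → Prop} {f : β → PMF δ} {g : α → PMF γ}
    {Q : δ → γ → Prop} (h : Sim ν μ P) (h' : ∀ t a, P t a → Sim (f t) (g a) Q) :
    Sim (ν.bind f) (μ.bind g) Q := by
  obtain ⟨κ, h1, h2, h3⟩ := h
  have key : ∀ x : β × α, ∃ κ' : PMF (δ × γ), κ'.map Prod.fst = f x.1 ∧
      κ'.map Prod.snd = g x.2 ∧ (P x.1 x.2 → ∀ y ∈ κ'.support, Q y.1 y.2) := by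
    intro x
    by_cases hx : P x.1 x.2
    · obtain ⟨κ', a, b, c⟩ := h' _ _ hx
      exact ⟨κ', a, b, fun _ => c⟩
    · obtain ⟨κ', a, b⟩ := exists_coupling (f x.1) (g x.2)
      exact ⟨κ', a, b, fun h => absurd h hx⟩
  choose K k1 k2 k3 using key
  refine ⟨κ.bind K, ?_, ?_, ?_⟩
  · rw [PMF.map_bind, ← h1, PMF.bind_map]
    simp only [k1]
    rfl
  · rw [PMF.map_bind, ← h2, PMF.bind_map]
    simp only [k2]
    rfl
  · intro y hy
    obtain ⟨x, hx, hxy⟩ := (PMF.mem_support_bind_iff _ _ _).1 hy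
    exact k3 x (h3 x hx) y hxy

/-- A coupling with a point mass is unique. This makes one-sided statements a special case of
relational ones, so that deterministic and random program parts can be chained. -/
lemma sim_pure {ν : PMF β} {a : α} {P : β → α → Prop} :
    Sim ν (PMF.pure a) P ↔ Alw ν fun t => P t a := by
  constructor
  · rintro ⟨κ, h1, h2, h3⟩
    rw [← h1, alw_map]
    intro x hx
    have : x.2 ∈ (κ.map Prod.snd).support := (PMF.mem_support_map_iff _ _ _).2 ⟨x, hx, rfl⟩
    rw [h2, PMF.support_pure] at this
    have h4 := h3 x hx
    rwa [Set.mem_singleton_iff.1 this] at h4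
  · intro h
    refine ⟨ν.map fun t => (t, a), ?_, ?_, ?_⟩
    · rw [PMF.map_comp]
      exact PMF.map_id ν
    · rw [PMF.map_comp]
      exact PMF.map_const _ _
    · intro x hx
      obtain ⟨t, ht, rfl⟩ := (PMF.mem_support_map_iff _ _ _).1 hx
      exact h t ht

lemma Sim.and_alw {ν : PMF β} {μ : PMF α} {P : β → α → Prop} {Q : β → Prop} (h : Sim ν μ P)
    (h' : Alw ν Q) : Sim ν μ fun t a => P t a ∧ Q t := by
  obtain ⟨κ, h1, h2, h3⟩ := h
  refine ⟨κ, h1, h2, fun x hx => ⟨h3 x hx, h' _ ?_⟩⟩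
  rw [← h1]
  exact (PMF.mem_support_map_iff _ _ _).2 ⟨x, hx, rfl⟩

lemma Sim.bind_alw {ν : PMF β} {μ : PMF α} {P : β → α → Prop} {f : β → PMF δ}
    {Q : δ → α → Prop} (h : Sim ν μ P) (h' : ∀ t a, P t a → Alw (f t) fun u => Q u a) :
    Sim (ν.bind f) μ Q := by
  rw [← PMF.bind_pure μ]
  exact h.bind fun t a ht => sim_pure.2 (h' t a ht)

lemma Alw.bind_sim {ν : PMF β} {μ : PMF α} {P : β → Prop} {f : β → PMF δ}
    {Q : δ → α → Prop} (h : Alw ν P) (h' : ∀ t, P t → Sim (f t) μ Q) :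
    Sim (ν.bind f) μ Q := by
  have h1 : Sim ν (PMF.pure ()) fun t _ => P t := sim_pure.2 h
  have h2 := h1.bind (g := fun _ => μ) fun t _ ht => h' t ht
  rwa [PMF.pure_bind] at h2

lemma sim_map (ν : PMF α) (g : α → β) : Sim (ν.map g) ν fun t a => t = g a := by
  refine ⟨ν.map fun a => (g a, a), ?_, ?_, ?_⟩
  · rw [PMF.map_comp]
    rfl
  · rw [PMF.map_comp]
    exact PMF.map_id ν
  · intro x hx
    obtain ⟨t, ht, rfl⟩ := (PMF.mem_support_map_iff _ _ _).1 hx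
    rfl

lemma Sim.map {ν : PMF β} {μ : PMF α} {P : β → α → Prop} (h : Sim ν μ P) (g : α → γ)
    {Q : β → γ → Prop} (h' : ∀ t a, P t a → Q t (g a)) : Sim ν (μ.map g) Q := by
  have := h.bind (f := PMF.pure) (g := PMF.pure ∘ g) (Q := Q)
    fun t a ht => sim_pure.2 (alw_pure.2 (h' t a ht))
  rwa [PMF.bind_pure] at this

lemma Sim.ex_le {ν : PMF β} {μ : PMF α} {P : β → α → Prop} (h : Sim ν μ P)
    {f : β → ℝ≥0∞} {g : α → ℝ≥0∞} (hfg : ∀ t a, P t a → f t ≤ g a) : ex ν f ≤ ex μ g := by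
  obtain ⟨κ, h1, h2, h3⟩ := h
  rw [← h1, ← h2, ex_map, ex_map]
  exact ex_mono fun x hx => hfg _ _ (h3 x hx)

/-- Iteration of a kernel that depends on the round. -/
def iterM (g : ℕ → α → PMF α) : ℕ → α → PMF α
  | 0, a => PMF.pure a
  | i + 1, a => (iterM g i a).bind (g i)

end Coupling

/-! ### Execution without a clock -/

/-- Registers and arrays. -/
structure Mem where
  reg : ℕ → ℕ
  arr : ℕ → ℕ → ℕ → ℕ

def Mem.setReg (s : Mem) (x a : ℕ) : Mem := { s with reg := Function.update s.reg x a }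

def Mem.setArr (s : Mem) (v i j a : ℕ) : Mem :=
  { s with arr := fun v' i' j' => if v' = v ∧ i' = i ∧ j' = j then a else s.arr v' i' j' }

def Mem.oracleInput (N m : ℕ) (s : Mem) : Inst N m :=
  (Matrix.of fun i j => (s.arr 3 i j : ZMod 2), fun i => (s.arr 4 i 0 : ZMod 2))

def Mem.putAnswer {N : ℕ} (s : Mem) (z : Fin N → ZMod 2) : Mem :=
  { s with
    arr := Function.update s.arr 5 fun i j =>
      if h : i < N ∧ j = 0 then (z ⟨i, h.1⟩).val else 0 }

def State.mem (s : State) : Mem := ⟨s.reg, s.arr⟩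

@[simp] lemma setReg_reg (s : Mem) (x a r : ℕ) :
    (s.setReg x a).reg r = if r = x then a else s.reg r := by
  simp [Mem.setReg, Function.update_apply]

@[simp] lemma setReg_arr (s : Mem) (x a : ℕ) : (s.setReg x a).arr = s.arr := rfl

@[simp] lemma setArr_reg (s : Mem) (v i j a : ℕ) : (s.setArr v i j a).reg = s.reg := rfl

lemma setArr_arr (s : Mem) (v i j a v' i' j' : ℕ) : (s.setArr v i j a).arr v' i' j' =
    if v' = v ∧ i' = i ∧ j' = j then a else s.arr v' i' j' := rfl

variable {N m : ℕ}

/-- The distribution of the final memory. -/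
def Prog.exec (O : Solver N m) : Prog → Mem → PMF Mem
  | .skip, s => PMF.pure s
  | .const x c, s => PMF.pure (s.setReg x c)
  | .plus x y z, s => PMF.pure (s.setReg x (s.reg y + s.reg z))
  | .minus x y z, s => PMF.pure (s.setReg x (s.reg y - s.reg z))
  | .load x v y z, s => PMF.pure (s.setReg x (s.arr v (s.reg y) (s.reg z)))
  | .store v y z x, s => PMF.pure (s.setArr v (s.reg y) (s.reg z) (s.reg x))
  | .coin x, s => (PMF.uniformOfFintype (Fin 2)).bind fun c => PMF.pure (s.setReg x c)
  | .query, s => (O (s.oracleInput N m)).bind fun z => PMF.pure (s.putAnswer z)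
  | .seq p r, s => (Prog.exec O p s).bind fun t => Prog.exec O r t
  | .ifPos x p r, s => if 0 < s.reg x then Prog.exec O p s else Prog.exec O r s
  | .loop x p, s => (fun μ : PMF Mem => μ.bind fun t => Prog.exec O p t)^[s.reg x] (PMF.pure s)

/-- No instruction reads the clock or the query counter. Correctness can therefore be proved for
`exec`, leaving `run` to the cost analysis. -/
lemma map_mem_run (O : Solver N m) (p : Prog) (s : State) :
    (p.run O s).map State.mem = p.exec O s.mem := by
  induction p generalizing s with
  | skip => simp [Prog.run, Prog.exec, PMF.pure_map]; rfl
  | const x c => simp [Prog.run, Prog.exec, PMF.pure_map]; rfl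
  | plus x y z => simp [Prog.run, Prog.exec, PMF.pure_map]; rfl
  | minus x y z => simp [Prog.run, Prog.exec, PMF.pure_map]; rfl
  | load x v y z => simp [Prog.run, Prog.exec, PMF.pure_map]; rfl
  | store v y z x => simp [Prog.run, Prog.exec, PMF.pure_map]; rfl
  | coin x =>
    simp only [Prog.run, Prog.exec, PMF.map_bind, PMF.pure_map]; rfl
  | query =>
    simp only [Prog.run, Prog.exec, PMF.map_bind, PMF.pure_map]; rfl
  | seq p r hp hr =>
    simp only [Prog.run, Prog.exec, PMF.map_bind, hr]
    rw [← hp, PMF.bind_map]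
    rfl
  | ifPos x p r hp hr =>
    simp only [Prog.run, Prog.exec]
    have h : s.mem.reg x = s.reg x := rfl
    rw [h]
    split_ifs
    · rw [hp]; rfl
    · rw [hr]; rfl
  | loop x p hp =>
    simp only [Prog.run, Prog.exec]
    have h : s.mem.reg x = s.reg x := rfl
    rw [h]
    generalize s.reg x = a
    induction a with
    | zero => simp [PMF.pure_map]; rfl
    | succ a ih =>
      rw [Function.iterate_succ_apply', Function.iterate_succ_apply', ← ih, PMF.map_bind,
        PMF.bind_map]
      congr 1
      funext t
      exact hp _

section exec

variable (O : Solver N m) (s : Mem)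

@[simp] lemma exec_skip : Prog.skip.exec O s = PMF.pure s := rfl
@[simp] lemma exec_const (x c : ℕ) : (Prog.const x c).exec O s = PMF.pure (s.setReg x c) := rfl
@[simp] lemma exec_plus (x y z : ℕ) :
    (Prog.plus x y z).exec O s = PMF.pure (s.setReg x (s.reg y + s.reg z)) := rfl
@[simp] lemma exec_minus (x y z : ℕ) :
    (Prog.minus x y z).exec O s = PMF.pure (s.setReg x (s.reg y - s.reg z)) := rfl
@[simp] lemma exec_load (x v y z : ℕ) :
    (Prog.load x v y z).exec O s = PMF.pure (s.setReg x (s.arr v (s.reg y) (s.reg z))) := rfl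
@[simp] lemma exec_store (v y z x : ℕ) :
    (Prog.store v y z x).exec O s =
      PMF.pure (s.setArr v (s.reg y) (s.reg z) (s.reg x)) := rfl
@[simp] lemma exec_seq (p r : Prog) :
    (Prog.seq p r).exec O s = (p.exec O s).bind fun t => r.exec O t := rfl
@[simp] lemma exec_ifPos (x : ℕ) (p r : Prog) :
    (Prog.ifPos x p r).exec O s = if 0 < s.reg x then p.exec O s else r.exec O s := rfl

end exec

/-! ### What a program leaves unchanged -/

/-- Whether the program may write the register `r`. -/
def Prog.modReg : Prog → ℕ → Bool
  | .skip, _ => false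
  | .const x _, r => r == x
  | .plus x _ _, r => r == x
  | .minus x _ _, r => r == x
  | .load x _ _ _, r => r == x
  | .store _ _ _ _, _ => false
  | .coin x, r => r == x
  | .query, _ => false
  | .seq p q, r => p.modReg r || q.modReg r
  | .ifPos _ p q, r => p.modReg r || q.modReg r
  | .loop _ p, r => p.modReg r

/-- Whether the program may write the array `v`. -/
def Prog.modArr : Prog → ℕ → Bool
  | .skip, _ => false
  | .const _ _, _ => false
  | .plus _ _ _, _ => false
  | .minus _ _ _, _ => false
  | .load _ _ _ _, _ => false
  | .store w _ _ _, v => v == w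
  | .coin _, _ => false
  | .query, v => v == 5
  | .seq p q, v => p.modArr v || q.modArr v
  | .ifPos _ p q, v => p.modArr v || q.modArr v
  | .loop _ p, v => p.modArr v

/-- `t` agrees with `s` outside of what `p` may write. -/
def Frame (p : Prog) (s t : Mem) : Prop :=
  (∀ r, p.modReg r = false → t.reg r = s.reg r) ∧ ∀ v, p.modArr v = false → t.arr v = s.arr v

lemma Frame.refl (p : Prog) (s : Mem) : Frame p s s := ⟨fun _ _ => rfl, fun _ _ => rfl⟩

lemma Frame.trans {p : Prog} {s t u : Mem} (h : Frame p s t) (h' : Frame p t u) : Frame p s u :=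
  ⟨fun r hr => (h'.1 r hr).trans (h.1 r hr), fun v hv => (h'.2 v hv).trans (h.2 v hv)⟩

lemma Frame.mono {p q : Prog} {s t : Mem} (h : Frame p s t)
    (h1 : ∀ r, q.modReg r = false → p.modReg r = false)
    (h2 : ∀ v, q.modArr v = false → p.modArr v = false) : Frame q s t :=
  ⟨fun r hr => h.1 r (h1 r hr), fun v hv => h.2 v (h2 v hv)⟩

lemma alw_iterate {F : Mem → PMF Mem} {Inv : ℕ → Mem → Prop} {s : Mem} (n : ℕ) (h0 : Inv 0 s)
    (hs : ∀ i < n, ∀ t, Inv i t → Alw (F t) (Inv (i + 1))) :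
    Alw ((fun μ : PMF Mem => μ.bind fun t => F t)^[n] (PMF.pure s)) (Inv n) := by
  induction n with
  | zero => exact alw_pure.2 h0
  | succ n ih =>
    rw [Function.iterate_succ_apply']
    exact (ih fun i hi => hs i (by omega)).bind fun t ht => hs n (by omega) t ht

/-- The write sets are computed syntactically, so a specification need only mention what a program
produces; everything else is carried over by evaluating `modReg` and `modArr`. -/
lemma alw_frame (O : Solver N m) (p : Prog) (s : Mem) : Alw (p.exec O s) (Frame p s) := by
  induction p generalizing s with
  | skip => exact alw_pure.2 (Frame.refl _ _)
  | const x c => exact alw_pure.2 ⟨fun r hr => by simp_all [Prog.modReg], fun _ _ => rfl⟩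
  | plus x y z => exact alw_pure.2 ⟨fun r hr => by simp_all [Prog.modReg], fun _ _ => rfl⟩
  | minus x y z => exact alw_pure.2 ⟨fun r hr => by simp_all [Prog.modReg], fun _ _ => rfl⟩
  | load x v y z => exact alw_pure.2 ⟨fun r hr => by simp_all [Prog.modReg], fun _ _ => rfl⟩
  | store v y z x =>
    refine alw_pure.2 ⟨fun r hr => rfl, fun w hw => ?_⟩
    funext i j
    have : w ≠ v := by simpa [Prog.modArr] using hw
    simp [setArr_arr, this]
  | coin x =>
    refine Alw.bind (P := fun _ => True) (fun _ _ => trivial) fun c _ => ?_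
    exact alw_pure.2 ⟨fun r hr => by simp_all [Prog.modReg], fun _ _ => rfl⟩
  | query =>
    refine Alw.bind (P := fun _ => True) (fun _ _ => trivial) fun c _ => ?_
    refine alw_pure.2 ⟨fun r hr => rfl, fun w hw => ?_⟩
    have : w ≠ 5 := by simpa [Prog.modArr] using hw
    simp [Mem.putAnswer, this]
  | seq p q hp hq =>
    refine (hp s).bind fun t ht => (hq t).mono fun u hu => ?_
    refine Frame.trans (t := t) (ht.mono ?_ ?_) (hu.mono ?_ ?_) <;>
      · intro r hr
        simp only [Prog.modReg, Prog.modArr, Bool.or_eq_false_iff] at hr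
        first | exact hr.1 | exact hr.2
  | ifPos x p q hp hq =>
    rw [exec_ifPos]
    split_ifs
    · refine (hp s).mono fun u hu => hu.mono ?_ ?_ <;>
      · intro r hr
        simp only [Prog.modReg, Prog.modArr, Bool.or_eq_false_iff] at hr
        exact hr.1
    · refine (hq s).mono fun u hu => hu.mono ?_ ?_ <;>
      · intro r hr
        simp only [Prog.modReg, Prog.modArr, Bool.or_eq_false_iff] at hr
        exact hr.2
  | loop x p hp =>
    refine alw_iterate (Inv := fun _ t => Frame (.loop x p) s t) _ (Frame.refl _ _) ?_
    intro i _ t ht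
    refine (hp t).mono fun u hu => ht.trans (hu.mono ?_ ?_) <;> exact fun r hr => hr

/-- Invariant rule for loops. -/
lemma alw_loop {O : Solver N m} {x : ℕ} {p : Prog} {s : Mem} {n : ℕ} (hn : s.reg x = n)
    (Inv : ℕ → Mem → Prop) (h0 : Inv 0 s)
    (hs : ∀ i < n, ∀ t, Frame p s t → Inv i t → Alw (p.exec O t) (Inv (i + 1))) :
    Alw ((Prog.loop x p).exec O s) fun t => Frame p s t ∧ Inv n t := by
  subst hn
  refine alw_iterate (Inv := fun i t => Frame p s t ∧ Inv i t) _ ⟨Frame.refl _ _, h0⟩ ?_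
  intro i hi t ht
  exact ((alw_frame O p t).mono fun u hu => ht.1.trans hu).and (hs i hi t ht.1 ht.2)

/-- Relational invariant rule for loops. -/
lemma sim_loop {α : Type*} {O : Solver N m} {x : ℕ} {p : Prog} {s : Mem} {n : ℕ}
    (hn : s.reg x = n) (g : ℕ → α → PMF α) (a : α) (Inv : ℕ → Mem → α → Prop) (h0 : Inv 0 s a)
    (hs : ∀ i < n, ∀ t a, Frame p s t → Inv i t a → Sim (p.exec O t) (g i a) (Inv (i + 1))) :
    Sim ((Prog.loop x p).exec O s) (iterM g n a) fun t a => Frame p s t ∧ Inv n t a := by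
  subst hn
  rw [Prog.exec]
  generalize s.reg x = n at *
  induction n with
  | zero => exact sim_pure.2 (alw_pure.2 ⟨Frame.refl _ _, h0⟩)
  | succ n ih =>
    rw [Function.iterate_succ_apply', iterM]
    refine (ih fun i hi => hs i (by omega)).bind fun t a ht => ?_
    refine ((hs n (by omega) t a ht.1 ht.2).and_alw (alw_frame O p t)).mono fun u b hu => ?_
    exact ⟨ht.1.trans hu.2, hu.1⟩

/-- A loop each round of which multiplies an expected loss by a factor. -/
lemma ex_loop_le {O : Solver N m} {x : ℕ} {p : Prog} {s : Mem} {n : ℕ} (hn : s.reg x = n)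
    (Inv : ℕ → Mem → Prop) (h0 : Inv 0 s) (f : Mem → ℝ≥0∞) (c : ℕ → ℝ≥0∞)
    (hs : ∀ i < n, ∀ t, Inv i t → Alw (p.exec O t) (Inv (i + 1)))
    (hf : ∀ i < n, ∀ t, Inv i t → ex (p.exec O t) f ≤ c i * f t) :
    ex ((Prog.loop x p).exec O s) f ≤ (∏ i ∈ Finset.range n, c i) * f s := by
  subst hn
  rw [Prog.exec]
  generalize s.reg x = n at *
  induction n with
  | zero => simp [ex_pure]
  | succ n ih =>
    rw [Function.iterate_succ_apply', ex_bind, Finset.prod_range_succ]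
    calc _ ≤ ex _ fun t => c n * f t := ex_mono fun t ht =>
            hf n (by omega) t (alw_iterate n h0 (fun i hi => hs i (by omega)) t ht)
      _ ≤ c n * ((∏ i ∈ Finset.range n, c i) * f s) := by
            rw [ex_const_mul]
            exact mul_le_mul_right
              (ih (fun i hi => hs i (by omega)) fun i hi => hf i (by omega)) _
      _ = _ := by ring

end LPN

namespace LPN

/-! ### Running times -/

/-- Every loop counter is a register below `b`, and no register below `b` is written. -/
def Prog.fixedCounters (b : ℕ) : Prog → Prop
  | .skip => True
  | .const x _ => b ≤ x
  | .plus x _ _ => b ≤ x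
  | .minus x _ _ => b ≤ x
  | .load x _ _ _ => b ≤ x
  | .store _ _ _ _ => True
  | .coin x => b ≤ x
  | .query => True
  | .seq p q => p.fixedCounters b ∧ q.fixedCounters b
  | .ifPos _ p q => p.fixedCounters b ∧ q.fixedCounters b
  | .loop x p => x < b ∧ p.fixedCounters b

/-- A bound for the running time, given the values of the loop counters. -/
def Prog.cost : Prog → (ℕ → ℕ) → ℕ
  | .seq p q, ρ => p.cost ρ + q.cost ρ
  | .ifPos _ p q, ρ => 1 + p.cost ρ + q.cost ρ
  | .loop x p, ρ => 1 + ρ x * (p.cost ρ + 1)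
  | _, _ => 1

/-- A bound for the number of queries, given the values of the loop counters. -/
def Prog.queryCost : Prog → (ℕ → ℕ) → ℕ
  | .query, _ => 1
  | .seq p q, ρ => p.queryCost ρ + q.queryCost ρ
  | .ifPos _ p q, ρ => p.queryCost ρ + q.queryCost ρ
  | .loop x p, ρ => ρ x * p.queryCost ρ
  | _, _ => 0

/-- The length of a program. -/
def Prog.size : Prog → ℕ
  | .seq p q => p.size + q.size
  | .ifPos _ p q => 1 + p.size + q.size
  | .loop _ p => p.size + 2
  | _ => 1

/-- The nesting depth of the loops. -/
def Prog.depth : Prog → ℕ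
  | .seq p q => max p.depth q.depth
  | .ifPos _ p q => max p.depth q.depth
  | .loop _ p => p.depth + 1
  | _ => 0

/-- Each level of nesting multiplies by at most `X`. The `2` that `size` charges for a loop absorbs
the start of the loop and the starts of its rounds. -/
lemma Prog.cost_le {b X : ℕ} {ρ : ℕ → ℕ} (hX : 1 ≤ X) (hρ : ∀ r < b, ρ r ≤ X) (p : Prog)
    (hp : p.fixedCounters b) : p.cost ρ ≤ p.size * X ^ p.depth := by
  induction p with
  | seq p q ihp ihq =>
    have h1 := ihp hp.1
    have h2 := ihq hp.2
    have h3 : X ^ p.depth ≤ X ^ max p.depth q.depth := Nat.pow_le_pow_right hX (le_max_left _ _)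
    have h4 : X ^ q.depth ≤ X ^ max p.depth q.depth := Nat.pow_le_pow_right hX (le_max_right _ _)
    have h5 := Nat.mul_le_mul_left p.size h3
    have h6 := Nat.mul_le_mul_left q.size h4
    simp only [cost, size, depth, add_mul]
    omega
  | ifPos x p q ihp ihq =>
    have h1 := ihp hp.1
    have h2 := ihq hp.2
    have h3 : X ^ p.depth ≤ X ^ max p.depth q.depth := Nat.pow_le_pow_right hX (le_max_left _ _)
    have h4 : X ^ q.depth ≤ X ^ max p.depth q.depth := Nat.pow_le_pow_right hX (le_max_right _ _)
    have h5 := Nat.mul_le_mul_left p.size h3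
    have h6 := Nat.mul_le_mul_left q.size h4
    have h7 : 1 ≤ X ^ max p.depth q.depth := Nat.one_le_pow _ _ hX
    simp only [cost, size, depth, add_mul]
    omega
  | loop x p ihp =>
    have h1 := ihp hp.2
    have h2 := hρ x hp.1
    have h7 : 1 ≤ X ^ p.depth := Nat.one_le_pow _ _ hX
    simp only [cost, size, depth, pow_succ]
    calc 1 + ρ x * (p.cost ρ + 1) ≤ 1 + X * (p.size * X ^ p.depth + 1 * X ^ p.depth) := by
          gcongr
          omega
      _ ≤ X ^ p.depth * X + X * (p.size * X ^ p.depth + 1 * X ^ p.depth) := by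
          gcongr
          exact Nat.mul_pos h7 hX
      _ = (p.size + 2) * (X ^ p.depth * X) := by ring
  | _ => simp [cost, size, depth]

variable {N m : ℕ}

/-- The counters keep the values `ρ` throughout, so the number of rounds of every loop is known in
advance, whatever the coins and the oracle answer. -/
lemma Prog.run_bounds (O : Solver N m) {b : ℕ} (ρ : ℕ → ℕ) (p : Prog) (hp : p.fixedCounters b)
    (s : State) (hs : ∀ r < b, s.reg r = ρ r) :
    Alw (p.run O s) fun t => (∀ r < b, t.reg r = ρ r) ∧ t.time ≤ s.time + p.cost ρ ∧
      t.queries ≤ s.queries + p.queryCost ρ := by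
  have hset : ∀ (s : State) (x a : ℕ), (∀ r < b, s.reg r = ρ r) → b ≤ x →
      ∀ r < b, (s.setReg x a).tick.reg r = ρ r := by
    intro s x a hs hx r hr
    have : r ≠ x := by omega
    simp [State.setReg, State.tick, this, hs r hr]
  induction p generalizing s with
  | skip => exact alw_pure.2 ⟨hs, le_rfl, le_rfl⟩
  | const x c => exact alw_pure.2 ⟨hset _ _ _ hs hp, le_rfl, le_rfl⟩
  | plus x y z => exact alw_pure.2 ⟨hset _ _ _ hs hp, le_rfl, le_rfl⟩
  | minus x y z => exact alw_pure.2 ⟨hset _ _ _ hs hp, le_rfl, le_rfl⟩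
  | load x v y z => exact alw_pure.2 ⟨hset _ _ _ hs hp, le_rfl, le_rfl⟩
  | store v y z x => exact alw_pure.2 ⟨hs, le_rfl, le_rfl⟩
  | coin x =>
    refine Alw.bind (P := fun _ => True) (fun _ _ => trivial) fun c _ => ?_
    exact alw_pure.2 ⟨hset _ _ _ hs hp, le_rfl, le_rfl⟩
  | query =>
    refine Alw.bind (P := fun _ => True) (fun _ _ => trivial) fun c _ => ?_
    exact alw_pure.2 ⟨hs, le_rfl, le_rfl⟩
  | seq p q ihp ihq =>
    refine (ihp hp.1 s hs).bind fun t ht => (ihq hp.2 t ht.1).mono fun u hu => ⟨hu.1, ?_, ?_⟩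
    · simp only [cost]
      omega
    · simp only [queryCost]
      omega
  | ifPos x p q ihp ihq =>
    rw [Prog.run]
    split_ifs
    · refine (ihp hp.1 s.tick hs).mono fun u hu => ⟨hu.1, ?_, ?_⟩
      · have := hu.2.1
        simp only [cost, State.tick] at this ⊢
        omega
      · have := hu.2.2
        simp only [queryCost, State.tick] at this ⊢
        omega
    · refine (ihq hp.2 s.tick hs).mono fun u hu => ⟨hu.1, ?_, ?_⟩
      · have := hu.2.1
        simp only [cost, State.tick] at this ⊢
        omega
      · have := hu.2.2
        simp only [queryCost, State.tick] at this ⊢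
        omega
  | loop x p ihp =>
    rw [Prog.run, hs x hp.1]
    simp only [cost, queryCost]
    generalize ρ x = a
    induction a with
    | zero => exact alw_pure.2 ⟨hs, by simp [State.tick], by simp [State.tick]⟩
    | succ a ih =>
      rw [Function.iterate_succ_apply']
      refine ih.bind fun t ht => (ihp hp.2 t.tick ht.1).mono fun u hu => ⟨hu.1, ?_, ?_⟩
      · have h1 := hu.2.1
        have h2 := ht.2.1
        simp only [State.tick, add_mul] at h1 h2 ⊢
        omega
      · have h1 := hu.2.2
        have h2 := ht.2.2
        simp only [State.tick, add_mul] at h1 h2 ⊢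
        omega

end LPN

namespace LPN

/-! ### Sampling -/

/-- `Ber(p)` on `𝔽₂`. -/
def bern (p : ℝ) : PMF (ZMod 2) := PMF.ofFintype (berMass p) (sum_berMass p)

/-- Fill the first `n` values of a function independently. -/
def fillM {β : Type*} (μ : PMF β) (n : ℕ) (f : ℕ → β) : PMF (ℕ → β) :=
  iterM (fun i f => μ.map (Function.update f i)) n f

/-- Round `n` changes only the value at `n`, so the new restriction is the `Fin.snoc` of the old one
with a fresh sample, and `g` has only one decomposition of this kind. -/
lemma map_fillM_apply {β : Type*} (μ : PMF β) (n : ℕ) (f : ℕ → β) (g : Fin n → β) :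
    ((fillM μ n f).map fun h (i : Fin n) => h i) g = ∏ i, μ (g i) := by
  classical
  induction n with
  | zero =>
    rw [fillM, iterM, PMF.pure_map, PMF.pure_apply, if_pos (Subsingleton.elim _ _)]
    simp
  | succ n ih =>
    have h1 : ((fillM μ (n + 1) f).map fun h (i : Fin (n + 1)) => h i) =
        ((fillM μ n f).map fun h (i : Fin n) => h i).bind fun h =>
          μ.map fun b => (Fin.snoc h b : Fin (n + 1) → β) := by
      rw [fillM, iterM, PMF.map_bind, PMF.bind_map]
      congr 1
      funext h
      rw [PMF.map_comp, Function.comp_apply]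
      congr 1
      funext b
      funext i
      refine Fin.lastCases ?_ (fun i => ?_) i
      · simp
      · simp [i.2.ne]
    rw [h1, PMF.bind_apply, tsum_eq_single (Fin.init g)]
    · rw [ih, PMF.map_apply, tsum_eq_single (g (Fin.last n)), Fin.prod_univ_castSucc]
      · rw [if_pos (Fin.snoc_init_self g).symm]
        rfl
      · intro b hb
        rw [if_neg]
        intro e
        exact hb (by rw [e, Fin.snoc_last])
    · intro h hh
      rw [PMF.map_apply (fun b => (Fin.snoc h b : Fin (n + 1) → β)), ENNReal.tsum_eq_zero.2,
        mul_zero]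
      intro b
      rw [if_neg]
      intro e
      exact hh (by rw [e, Fin.init_snoc])

lemma map_fillM_bern (p : ℝ) (n : ℕ) (f : ℕ → ZMod 2) :
    ((fillM (bern p) n f).map fun h (i : Fin n) => h i) = noise p n := by
  ext g
  rw [map_fillM_apply]
  rfl

lemma map_fillM_uniform {β : Type*} [Fintype β] [Nonempty β] (n : ℕ) (f : ℕ → β) :
    ((fillM (PMF.uniformOfFintype β) n f).map fun h (i : Fin n) => h i) =
      PMF.uniformOfFintype (Fin n → β) := by
  ext g
  rw [map_fillM_apply]
  simp [PMF.uniformOfFintype_apply, ENNReal.inv_pow]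

/-- The distribution of a sum of `l` independent noise vectors. -/
def noiseSum (p : ℝ) (m l : ℕ) : PMF (Fin m → ZMod 2) :=
  iterM (fun _ v => (noise p m).map (v + ·)) l 0

/-- The number `η` cut off after `T` binary digits. -/
def truncate (T : ℕ) (η : ℝ) : ℝ := ⌊(2 : ℝ) ^ T * η⌋₊ / 2 ^ T

/-- The `i`-th binary digit of `η`. -/
def digit (η : ℝ) (i : ℕ) : ℕ := ⌊(2 : ℝ) ^ (i + 1) * η⌋₊ % 2

lemma floor_two_mul (η : ℝ) (i : ℕ) :
    ⌊(2 : ℝ) ^ (i + 1) * η⌋₊ = 2 * ⌊(2 : ℝ) ^ i * η⌋₊ + digit η i := by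
  have : ⌊(2 : ℝ) ^ i * η⌋₊ = ⌊(2 : ℝ) ^ (i + 1) * η⌋₊ / 2 := by
    rw [← Nat.floor_div_natCast]
    congr 1
    rw [pow_succ]
    push_cast
    ring
  rw [this, digit]
  omega

lemma bern_one (p : ℝ) (h0 : 0 ≤ p) (h1 : p ≤ 1) : bern p 1 = ENNReal.ofReal p := by
  simp [bern, PMF.ofFintype_apply, berMass, h0, h1]

lemma bern_zero (p : ℝ) (h0 : 0 ≤ p) (h1 : p ≤ 1) : bern p 0 = ENNReal.ofReal (1 - p) := by
  simp [bern, PMF.ofFintype_apply, berMass, h0, h1]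

lemma sum_zmod_two {M : Type*} [AddCommMonoid M] (f : ZMod 2 → M) : ∑ x, f x = f 0 + f 1 :=
  Fin.sum_univ_two f

lemma pmf_zmod_two_ext {μ ν : PMF (ZMod 2)} (h : μ 1 = ν 1) : μ = ν := by
  have key : ∀ ρ : PMF (ZMod 2), ρ 0 = 1 - ρ 1 := by
    intro ρ
    have h2 : ρ 0 + ρ 1 = 1 := by
      have := ρ.tsum_coe
      rw [tsum_fintype] at this
      rw [← this]
      exact (Fin.sum_univ_two _).symm
    exact ENNReal.eq_sub_of_add_eq (PMF.apply_ne_top _ _) h2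
  ext x
  have : x = 0 ∨ x = 1 := by revert x; decide
  rcases this with rfl | rfl
  · rw [key, key, h]
  · exact h

/-- With probability `1/2`, replace `b` by `d`. -/
def mixDigit (d : ℕ) (b : ZMod 2) : PMF (ZMod 2) :=
  (PMF.uniformOfFintype (ZMod 2)).map fun c => if 0 < c.val then (d : ZMod 2) else b

/-- This is one step of Horner's scheme in base `1/2`: the digit `d` is put in front of the binary
expansion of the bias. -/
lemma bern_bind_mixDigit (p : ℝ) (h0 : 0 ≤ p) (h1 : p ≤ 1) (d : ℕ) (hd : d < 2) :
    (bern p).bind (mixDigit d) = bern ((d + p) / 2) := by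
  have hd' : (d : ℝ) ≤ 1 := by exact_mod_cast Nat.lt_succ_iff.1 hd
  have e01 : (0 : ZMod 2) ≠ 1 := by decide
  have v1 : (1 : ZMod 2).val = 1 := rfl
  have hm : ∀ b : ZMod 2, mixDigit d b 1 =
      (if b = 1 then ENNReal.ofReal (1/2) else 0) + ENNReal.ofReal (d / 2) := by
    intro b
    rw [mixDigit, PMF.map_apply, tsum_fintype]
    rw [sum_zmod_two]
    simp only [PMF.uniformOfFintype_apply, ZMod.card, ZMod.val_zero, v1, lt_irrefl, if_false]
    interval_cases d
    · simp [e01.symm, eq_comm]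
    · simp [eq_comm]
  apply pmf_zmod_two_ext
  rw [PMF.bind_apply, tsum_fintype, bern_one _ (by positivity) (by linarith)]
  rw [sum_zmod_two, bern_one p h0 h1, bern_zero p h0 h1, hm, hm, if_neg e01, if_pos rfl,
    zero_add, ← ENNReal.ofReal_add (by positivity) (by positivity),
    ← ENNReal.ofReal_mul (by linarith), ← ENNReal.ofReal_mul h0,
    ← ENNReal.ofReal_add (mul_nonneg (by linarith) (by positivity)) (by positivity)]
  congr 1
  ring

lemma iterM_mixDigit (η : ℝ) (h0 : 0 ≤ η) (h1 : η < 1) (T : ℕ) :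
    iterM (fun i => mixDigit (digit η (T - 1 - i))) T 0 = bern (truncate T η) := by
  -- The digits are consumed from the least significant one. After `a` rounds the bias is the number
  -- `0.d…d` formed by the last `a` of the `T` digits.
  have key : ∀ a ≤ T, iterM (fun i => mixDigit (digit η (T - 1 - i))) a 0 =
      bern ((⌊(2 : ℝ) ^ T * η⌋₊ : ℝ) / 2 ^ a - ⌊(2 : ℝ) ^ (T - a) * η⌋₊) := by
    intro a
    induction a with
    | zero =>
      intro _
      rw [iterM]
      apply pmf_zmod_two_ext
      have e01 : (1 : ZMod 2) ≠ 0 := by decide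
      simp only [pow_zero, div_one, Nat.sub_zero, sub_self]
      rw [bern_one _ le_rfl zero_le_one, PMF.pure_apply, if_neg e01]
      simp
    | succ a ih =>
      intro ha
      obtain ⟨c, rfl⟩ : ∃ c, T = a + 1 + c := ⟨T - (a + 1), by omega⟩
      -- `hlow` and `hhigh` put the bias into `[0, 1]`, where `bern` does not clamp its parameter.
      have hlow : (⌊(2 : ℝ) ^ (c + 1) * η⌋₊ : ℝ) ≤ ⌊(2 : ℝ) ^ (a + 1 + c) * η⌋₊ / 2 ^ a := by
        rw [le_div_iff₀ (by positivity)]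
        have h3 : (⌊(2 : ℝ) ^ (c + 1) * η⌋₊ : ℝ) ≤ 2 ^ (c + 1) * η := Nat.floor_le (by positivity)
        have : ((⌊(2 : ℝ) ^ (c + 1) * η⌋₊ * 2 ^ a : ℕ) : ℝ) ≤ ⌊(2 : ℝ) ^ (a + 1 + c) * η⌋₊ := by
          apply Nat.cast_le.2
          apply Nat.le_floor
          push_cast
          calc _ ≤ 2 ^ (c + 1) * η * 2 ^ a := by gcongr
            _ = _ := by ring
        push_cast at this
        exact this
      have hhigh : (⌊(2 : ℝ) ^ (a + 1 + c) * η⌋₊ : ℝ) / 2 ^ a ≤ ⌊(2 : ℝ) ^ (c + 1) * η⌋₊ + 1 := by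
        rw [div_le_iff₀ (by positivity)]
        have h3 : (2 : ℝ) ^ (c + 1) * η < ⌊(2 : ℝ) ^ (c + 1) * η⌋₊ + 1 := Nat.lt_floor_add_one _
        have h4 : (⌊(2 : ℝ) ^ (a + 1 + c) * η⌋₊ : ℝ) ≤ 2 ^ (a + 1 + c) * η :=
          Nat.floor_le (by positivity)
        calc _ ≤ (2 : ℝ) ^ (a + 1 + c) * η := h4
          _ = 2 ^ (c + 1) * η * 2 ^ a := by ring
          _ ≤ _ := by gcongr
      have e1 : a + 1 + c - a = c + 1 := by omega
      have e2 : a + 1 + c - 1 - a = c := by omega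
      have e3 : a + 1 + c - (a + 1) = c := by omega
      have ih := ih (by omega)
      rw [e1] at ih
      have hd : digit η c < 2 := Nat.mod_lt _ (by norm_num)
      rw [iterM, ih, e2, e3, bern_bind_mixDigit _ (by linarith) (by linarith) _ hd]
      congr 1
      have h5 := floor_two_mul η c
      have h6 : (⌊(2 : ℝ) ^ (c + 1) * η⌋₊ : ℝ) = 2 * ⌊(2 : ℝ) ^ c * η⌋₊ + digit η c := by
        exact_mod_cast h5
      rw [h6, pow_succ (2 : ℝ) a]
      field_simp
      ring
  rw [key T le_rfl, truncate]
  -- After all `T` rounds the subtracted term is the integer part of `η`.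
  have : ⌊(2 : ℝ) ^ (T - T) * η⌋₊ = 0 := by
    rw [Nat.sub_self, pow_zero, one_mul]
    exact Nat.floor_eq_zero.2 h1
  rw [this]
  simp

end LPN

namespace LPN

/-! ### The programs -/

/-- Count register `i` from `0` up to the value of register `x`; register `6` has to hold `1`. -/
def Prog.count (i x : ℕ) (body : Prog) : Prog :=
  .seq (.const i 0) (.loop x (.seq body (.plus i i 6)))

/-- Array `3` becomes a uniform matrix. -/
def sampleMatrix : Prog := .count 12 1 (.count 13 8 (.seq (.coin 18) (.store 3 12 13 18)))

/-- Array `7` becomes a uniform vector. -/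
def sampleSecret : Prog := .count 13 8 (.seq (.coin 18) (.store 7 13 7 18))

/-- Array `4` becomes the response vector of the instance. -/
def copyVector : Prog := .count 12 1 (.seq (.load 18 1 12 7) (.store 4 12 7 18))

/-- Register `15` becomes a noise bit. -/
def sampleBit : Prog :=
  .seq (.const 15 0) (.seq (.plus 16 5 7) (.loop 5 (.seq (.minus 16 16 6) (.seq (.load 17 2 16 7)
    (.seq (.coin 18) (.ifPos 18 (.plus 15 17 7) .skip))))))

/-- A noise vector is added to array `4`. -/
def addNoise : Prog :=
  .count 12 1 (.seq sampleBit (.seq (.load 19 4 12 7) (.seq (.plus 19 19 15) (.store 4 12 7 19))))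

/-- The matrix of the instance is put into block number `reg 11` of array `3`, and `0` into that
block of array `7`. -/
def embed : Prog :=
  .seq (.plus 13 11 7) (.count 14 0 (.seq (.store 7 13 7 7)
    (.seq (.count 12 1 (.seq (.load 18 0 12 14) (.store 3 12 13 18))) (.plus 13 13 2))))

/-- The product of arrays `3` and `7` is added to array `4`. -/
def multiply : Prog :=
  .count 12 1 (.count 13 8 (.seq (.load 18 7 13 7) (.ifPos 18 (.seq (.load 19 3 12 13)
    (.seq (.load 20 4 12 7) (.seq (.plus 20 20 19) (.store 4 12 7 20)))) .skip)))

/-- Array `8` becomes block number `reg 11` of array `5`. -/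
def extract : Prog :=
  .seq (.plus 13 11 7) (.count 14 0 (.seq (.load 18 5 13 7)
    (.seq (.store 8 14 7 18) (.plus 13 13 2))))

/-- Register `20` becomes the weight of the noise that belongs to the candidate in array `8`. -/
def weigh : Prog :=
  .seq (.const 20 0) (.count 12 1 (.seq (.load 19 1 12 7) (.seq
    (.count 14 0 (.seq (.load 18 8 14 7) (.ifPos 18 (.seq (.load 18 0 12 14)
      (.seq (.minus 21 19 18) (.seq (.minus 22 18 19) (.plus 19 21 22)))) .skip)))
    (.plus 20 20 19))))

/-- The candidate is kept if it is better than the best one so far. -/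
def keepBest : Prog :=
  .seq (.minus 18 10 20) (.ifPos 18 (.seq (.plus 10 20 7)
    (.count 14 0 (.seq (.load 18 8 14 7) (.store 6 14 7 18)))) .skip)

/-- One query, with the instance in block number `reg 11`. -/
def attempt : Prog :=
  .seq sampleMatrix (.seq sampleSecret (.seq copyVector (.seq (.loop 9 addNoise) (.seq embed
    (.seq multiply (.seq .query (.seq extract (.seq weigh keepBest))))))))

/-- The attempts. -/
def search : Prog :=
  .loop 3 (.loop 2 (.seq (.const 11 0) (.loop 2 (.seq attempt (.plus 11 11 6)))))

/-- The constants. -/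
def setup : Prog :=
  .seq (.plus 5 1 1) (.seq (.plus 5 5 5) (.seq (.const 6 1) (.seq (.const 7 0) (.seq (.const 8 0)
    (.seq (.loop 0 (.plus 8 8 2)) (.seq (.minus 9 2 6) (.plus 10 1 6)))))))

def solve : Prog := .seq setup search

/-! ### Their meaning -/

/-- The contents of the registers and arrays that stay fixed after the setup. -/
structure Base (n m k E T : ℕ) (η : ℝ) (x : Inst n m) (s : Mem) : Prop where
  r0 : s.reg 0 = n
  r1 : s.reg 1 = m
  r2 : s.reg 2 = k
  r3 : s.reg 3 = E
  r5 : s.reg 5 = T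
  r6 : s.reg 6 = 1
  r7 : s.reg 7 = 0
  r8 : s.reg 8 = n * k
  r9 : s.reg 9 = k - 1
  a0 : ∀ (i : Fin m) (l : Fin n), s.arr 0 i l = (x.1 i l).val
  a1 : ∀ i : Fin m, s.arr 1 i 0 = (x.2 i).val
  a2 : ∀ i, s.arr 2 i 0 = digit η i

/-- The program leaves the fixed registers and arrays alone. -/
def Prog.keepsBase (p : Prog) : Prop :=
  (∀ r < 10, p.modReg r = false) ∧ ∀ v < 3, p.modArr v = false

instance (p : Prog) : Decidable p.keepsBase := by
  unfold Prog.keepsBase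
  infer_instance

section Specs

variable {n m k E T : ℕ} {η : ℝ} {x : Inst n m} {s t : Mem} {N' m' : ℕ} {O : Solver N' m'}

lemma Base.frame (h : Base n m k E T η x s) {p : Prog} (hF : Frame p s t) (hp : p.keepsBase) :
    Base n m k E T η x t := by
  obtain ⟨h1, h2⟩ := hF
  have hr : ∀ r < 10, t.reg r = s.reg r := fun r hr => h1 r (hp.1 r hr)
  have ha : ∀ v < 3, t.arr v = s.arr v := fun v hv => h2 v (hp.2 v hv)
  constructor
  · rw [hr 0 (by norm_num), h.r0]
  · rw [hr 1 (by norm_num), h.r1]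
  · rw [hr 2 (by norm_num), h.r2]
  · rw [hr 3 (by norm_num), h.r3]
  · rw [hr 5 (by norm_num), h.r5]
  · rw [hr 6 (by norm_num), h.r6]
  · rw [hr 7 (by norm_num), h.r7]
  · rw [hr 8 (by norm_num), h.r8]
  · rw [hr 9 (by norm_num), h.r9]
  · rw [ha 0 (by norm_num)]; exact h.a0
  · rw [ha 1 (by norm_num)]; exact h.a1
  · rw [ha 2 (by norm_num)]; exact h.a2

/-- The initialisation and the increment of register `i` happen outside of `body`; `hI` says that
the invariant does not notice them. -/
lemma sim_count {α : Type*} {i y : ℕ} {body : Prog} {s : Mem} {c : ℕ} (hn : s.reg y = c)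
    (h6 : s.reg 6 = 1) (hy : y ≠ i) (hi : 6 ≠ i) (hb : body.modReg i = false)
    (hb6 : body.modReg 6 = false) (g : ℕ → α → PMF α) (a : α) (Inv : ℕ → Mem → α → Prop)
    (h0 : Inv 0 s a) (hI : ∀ d t a v, Inv d t a → Inv d (t.setReg i v) a)
    (hs : ∀ d < c, ∀ t a, Frame (.count i y body) s t → t.reg i = d → Inv d t a →
      Sim (body.exec O t) (g d a) (Inv (d + 1))) :
    Sim ((Prog.count i y body).exec O s) (iterM g c a) (Inv c) := by
  have h7 : Frame (.count i y body) s (s.setReg i 0) := by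
    refine ⟨fun r hr => ?_, fun _ _ => rfl⟩
    have : r ≠ i := by
      rintro rfl
      simp [Prog.count, Prog.modReg] at hr
    simp [this]
  rw [Prog.count, exec_seq, exec_const, PMF.pure_bind]
  refine (sim_loop (n := c) (by simpa [hy] using hn) g a
    (fun d t a => Inv d t a ∧ t.reg i = d) ⟨hI _ _ _ _ h0, by simp⟩ ?_).mono fun t a h => h.2.1
  intro d hd t a hF hInv
  have hF' : Frame (.count i y body) s t := by
    refine h7.trans (hF.mono ?_ ?_)
    · intro r hr
      simp only [Prog.count, Prog.modReg, Bool.or_eq_false_iff] at hr ⊢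
      exact hr.2
    · intro v hv
      simp only [Prog.count, Prog.modArr, Bool.or_eq_false_iff] at hv ⊢
      exact hv.2
  have ht6 : t.reg 6 = 1 := by
    rw [hF.1 6 (by simp [Prog.modReg, hb6, hi]), setReg_reg, if_neg hi, h6]
  rw [exec_seq]
  refine ((hs d hd t a hF' hInv.2 hInv.1).and_alw (alw_frame O body t)).bind_alw ?_
  intro u b hu
  refine alw_pure.2 ⟨hI _ _ _ _ hu.1, ?_⟩
  have h8 := hu.2.1 i hb
  have h9 := hu.2.1 6 hb6
  simp [h8, h9, hInv.2, ht6]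

lemma iterM_pure {α : Type*} (c : ℕ) (a : α) : iterM (fun _ => PMF.pure) c a = PMF.pure a := by
  induction c with
  | zero => rfl
  | succ c ih => rw [iterM, ih, PMF.pure_bind]

/-- The relational rule, applied to the trivial process on `Unit`. -/
lemma alw_count {i y : ℕ} {body : Prog} {s : Mem} {c : ℕ} (hn : s.reg y = c)
    (h6 : s.reg 6 = 1) (hy : y ≠ i) (hi : 6 ≠ i) (hb : body.modReg i = false)
    (hb6 : body.modReg 6 = false) (Inv : ℕ → Mem → Prop)
    (h0 : Inv 0 s) (hI : ∀ d t v, Inv d t → Inv d (t.setReg i v))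
    (hs : ∀ d < c, ∀ t, Frame (.count i y body) s t → t.reg i = d → Inv d t →
      Alw (body.exec O t) (Inv (d + 1))) :
    Alw ((Prog.count i y body).exec O s) (Inv c) := by
  have := sim_count (O := O) hn h6 hy hi hb hb6 (fun _ => PMF.pure) () (fun d t _ => Inv d t) h0
    (fun d t _ v => hI d t v) (fun d hd t a h1 h2 h3 => sim_pure.2 (hs d hd t h1 h2 h3))
  rw [iterM_pure] at this
  exact sim_pure.1 this

lemma sim_coin (x : ℕ) (s : Mem) : Sim ((Prog.coin x).exec O s)
    (PMF.uniformOfFintype (ZMod 2)) fun t b => t = s.setReg x b.val :=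
  sim_map (PMF.uniformOfFintype (Fin 2)) fun c => s.setReg x c

lemma sim_sampleRow {c i : ℕ} (hc : s.reg 8 = c) (h6 : s.reg 6 = 1) (hi : s.reg 12 = i) :
    Sim ((Prog.count 13 8 (.seq (.coin 18) (.store 3 12 13 18))).exec O s)
      (PMF.uniformOfFintype (Fin c → ZMod 2)) fun t r =>
        (∀ l : Fin c, t.arr 3 i l = (r l).val) ∧ ∀ i' ≠ i, t.arr 3 i' = s.arr 3 i' := by
  rw [← map_fillM_uniform c (fun _ => (0 : ZMod 2))]
  refine (sim_count hc h6 (by decide) (by decide) rfl rfl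
    (fun i f => (PMF.uniformOfFintype (ZMod 2)).map (Function.update f i)) (fun _ => 0)
    (fun d t f => (∀ l < d, t.arr 3 i l = (f l).val) ∧ ∀ i' ≠ i, t.arr 3 i' = s.arr 3 i')
    (by simp) (fun _ _ _ _ h => h) ?_).map _ (fun t f h => ⟨fun l => h.1 l l.2, h.2⟩)
  intro d hd t f hF ht hInv
  rw [exec_seq]
  refine ((sim_coin 18 t).bind_alw
    (Q := fun t b => (∀ l < d + 1, t.arr 3 i l = (Function.update f d b l).val) ∧
      ∀ i' ≠ i, t.arr 3 i' = s.arr 3 i') ?_).map _ (fun t b h => h)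
  rintro u b rfl
  have h12 : t.reg 12 = i := by rw [hF.1 12 rfl, hi]
  rw [exec_store, alw_pure]
  refine ⟨fun l hl => ?_, fun i' hi' => ?_⟩
  · rcases Nat.lt_succ_iff_lt_or_eq.1 hl with h | rfl
    · simp [setArr_arr, h12, ht, h.ne, hInv.1 l h]
    · simp [setArr_arr, h12, ht]
  · funext l
    simp [setArr_arr, h12, hi', hInv.2 i' hi']

lemma sim_sampleMatrix (h : Base n m k E T η x s) : Sim (sampleMatrix.exec O s)
    (PMF.uniformOfFintype (Matrix (Fin m) (Fin (n * k)) (ZMod 2))) fun t M =>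
      ∀ (i : Fin m) (c : Fin (n * k)), t.arr 3 i c = (M i c).val := by
  have := map_fillM_uniform m (fun _ => (0 : Fin (n * k) → ZMod 2))
  rw [show PMF.uniformOfFintype (Matrix (Fin m) (Fin (n * k)) (ZMod 2)) =
    PMF.uniformOfFintype (Fin m → Fin (n * k) → ZMod 2) from rfl, ← this]
  refine (sim_count h.r1 h.r6 (by decide) (by decide) rfl rfl
    (fun i f => (PMF.uniformOfFintype (Fin (n * k) → ZMod 2)).map (Function.update f i))
    (fun _ => 0)
    (fun d t (f : ℕ → Fin (n * k) → ZMod 2) =>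
      ∀ i < d, ∀ c : Fin (n * k), t.arr 3 i c = (f i c).val)
    (by simp) (fun _ _ _ _ h => h) ?_).map _ (fun t f h => fun i => h i i.2)
  intro d hd t f hF ht hInv
  have hB := h.frame hF (by decide)
  refine (sim_sampleRow hB.r8 hB.r6 ht).map _ fun u r hu => ?_
  intro i hi c
  rcases Nat.lt_succ_iff_lt_or_eq.1 hi with h | rfl
  · rw [hu.2 i h.ne, Function.update_of_ne h.ne, hInv i h]
  · rw [hu.1 c, Function.update_self]

lemma sim_sampleSecret (h : Base n m k E T η x s) : Sim (sampleSecret.exec O s)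
    (PMF.uniformOfFintype (Fin (n * k) → ZMod 2)) fun t S =>
      ∀ c : Fin (n * k), t.arr 7 c 0 = (S c).val := by
  rw [← map_fillM_uniform (n * k) (fun _ => (0 : ZMod 2))]
  refine (sim_count h.r8 h.r6 (by decide) (by decide) rfl rfl
    (fun i f => (PMF.uniformOfFintype (ZMod 2)).map (Function.update f i)) (fun _ => 0)
    (fun d t f => ∀ l < d, t.arr 7 l 0 = (f l).val)
    (by simp) (fun _ _ _ _ h => h) ?_).map _ (fun t f h => fun l => h l l.2)
  intro d hd t f hF ht hInv
  have hB := h.frame hF (by decide)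
  rw [exec_seq]
  refine ((sim_coin 18 t).bind_alw
    (Q := fun t b => ∀ l < d + 1, t.arr 7 l 0 = (Function.update f d b l).val) ?_).map _
      (fun t b h => h)
  rintro u b rfl
  rw [exec_store, alw_pure]
  intro l hl
  rcases Nat.lt_succ_iff_lt_or_eq.1 hl with h | rfl
  · simp [setArr_arr, hB.r7, ht, h.ne, hInv l h]
  · simp [setArr_arr, hB.r7, ht]

lemma alw_copyVector (h : Base n m k E T η x s) : Alw (copyVector.exec O s) fun t =>
    ∀ i : Fin m, (t.arr 4 i 0 : ZMod 2) = x.2 i := by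
  refine (alw_count h.r1 h.r6 (by decide) (by decide) rfl rfl
    (fun d t => ∀ i : Fin m, i < d → (t.arr 4 i 0 : ZMod 2) = x.2 i)
    (by simp) (fun _ _ _ h => h) ?_).mono fun t h i => h i i.2
  intro d hd t hF ht hInv
  have hB := h.frame hF (by decide)
  simp only [exec_seq, exec_load, exec_store, PMF.pure_bind, alw_pure]
  intro i hi
  rcases Nat.lt_succ_iff_lt_or_eq.1 hi with h | h
  · simp [setArr_arr, hB.r7, ht, h.ne, hInv i h]
  · have := hB.a1 i
    rw [h] at this
    simp [setArr_arr, hB.r7, ht, h, this]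

/-- Register `16` runs down from `T`, and its decrement precedes the load, so the digits arrive in
the order that `iterM_mixDigit` requires. -/
lemma sim_sampleBit (hη0 : 0 ≤ η) (hη1 : η < 1) (h : Base n m k E T η x s) :
    Sim (sampleBit.exec O s) (bern (truncate T η)) fun t b => t.reg 15 = b.val := by
  simp only [sampleBit, exec_seq, exec_const, exec_plus, PMF.pure_bind]
  rw [← iterM_mixDigit η hη0 hη1 T]
  refine (sim_loop (n := T) (by simp [h.r5]) _ 0
    (fun d t b => t.reg 15 = b.val ∧ t.reg 16 = T - d) (by simp [h.r5, h.r7]) ?_).mono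
      fun t a h => h.2.1
  intro d hd t b hF hInv
  have r6 : t.reg 6 = 1 := by rw [hF.1 6 rfl]; simp [h.r6]
  have r7 : t.reg 7 = 0 := by rw [hF.1 7 rfl]; simp [h.r7]
  have a2 : ∀ i, t.arr 2 i 0 = digit η i := by rw [hF.2 2 rfl]; exact h.a2
  simp only [exec_seq, exec_minus, exec_load, PMF.pure_bind]
  rw [mixDigit]
  refine ((sim_coin 18 _).bind_alw (Q := fun t c => t.reg 15 =
      (if 0 < c.val then (digit η (T - 1 - d) : ZMod 2) else b).val ∧ t.reg 16 = T - (d + 1))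
      ?_).map _ (fun t c h => h)
  rintro u c rfl
  have hdig : digit η (T - (d + 1)) % 2 = digit η (T - (d + 1)) := Nat.mod_mod _ _
  have e : T - d - 1 = T - 1 - d := by omega
  have e' : T - 1 - d = T - (d + 1) := by omega
  rw [exec_ifPos]
  by_cases hc : 0 < c.val
  · rw [if_pos (by simpa using hc), if_pos hc, exec_plus, alw_pure]
    simp [r6, r7, a2, hInv.2, e, ZMod.val_natCast, hdig, e']
  · rw [if_neg (by simpa using hc), if_neg hc, exec_skip, alw_pure]
    simp [r6, hInv, e, e']

lemma sim_addNoise (hη0 : 0 ≤ η) (hη1 : η < 1) (h : Base n m k E T η x s) :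
    Sim (addNoise.exec O s) (noise (truncate T η) m) fun t e =>
      ∀ i : Fin m, (t.arr 4 i 0 : ZMod 2) = s.arr 4 i 0 + e i := by
  rw [← map_fillM_bern (truncate T η) m (fun _ => 0)]
  refine (sim_count h.r1 h.r6 (by decide) (by decide) rfl rfl
    (fun i f => (bern (truncate T η)).map (Function.update f i)) (fun _ => 0)
    (fun d t f => ∀ i, (t.arr 4 i 0 : ZMod 2) = s.arr 4 i 0 + if i < d then f i else 0)
    (by simp) (fun _ _ _ _ h => h) ?_).map _ (fun t f h i => by rw [h i, if_pos i.2])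
  intro d hd t f hF ht hInv
  have hB := h.frame hF (by decide)
  rw [exec_seq]
  refine (((sim_sampleBit hη0 hη1 hB).and_alw (alw_frame O sampleBit t)).bind_alw
    (Q := fun t b => ∀ i, (t.arr 4 i 0 : ZMod 2) =
      s.arr 4 i 0 + if i < d + 1 then Function.update f d b i else 0) ?_).map _ (fun t b h => h)
  rintro u b ⟨hu, huF⟩
  have r7 : u.reg 7 = 0 := by rw [huF.1 7 rfl, hB.r7]
  have r12 : u.reg 12 = d := by rw [huF.1 12 rfl, ht]
  have a4 : u.arr 4 = t.arr 4 := huF.2 4 rfl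
  simp only [exec_seq, exec_load, exec_plus, exec_store, PMF.pure_bind, alw_pure]
  intro i
  rcases lt_trichotomy i d with h | rfl | h
  · simp [setArr_arr, r7, r12, a4, h.ne, hInv, h, h.trans (Nat.lt_succ_self d)]
  · simp [setArr_arr, r7, r12, a4, hInv, hu]
  · have h1 : ¬ i < d := by omega
    have h2 : ¬ i < d + 1 := by omega
    simp [setArr_arr, r7, r12, a4, hInv, h1, h2, h.ne']

lemma sim_addNoises (hη0 : 0 ≤ η) (hη1 : η < 1) (h : Base n m k E T η x s) :
    Sim ((Prog.loop 9 addNoise).exec O s) (noiseSum (truncate T η) m (k - 1)) fun t e =>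
      ∀ i : Fin m, (t.arr 4 i 0 : ZMod 2) = s.arr 4 i 0 + e i := by
  refine (sim_loop h.r9 _ 0 (fun _ t e => ∀ i : Fin m, (t.arr 4 i 0 : ZMod 2) = s.arr 4 i 0 + e i)
    (by simp) ?_).mono fun t e h => h.2
  intro d hd t e hF hInv
  have hB := h.frame hF (by decide)
  refine (sim_addNoise hη0 hη1 hB).map _ fun u e' hu i => ?_
  rw [hu, hInv, Pi.add_apply, add_assoc]

lemma alw_copyColumn {l c : ℕ} (h : Base n m k E T η x s) (hl : s.reg 14 = l)
    (hc : s.reg 13 = c) :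
    Alw ((Prog.count 12 1 (.seq (.load 18 0 12 14) (.store 3 12 13 18))).exec O s) fun t =>
      (∀ i < m, t.arr 3 i c = s.arr 0 i l) ∧ ∀ c' ≠ c, ∀ i, t.arr 3 i c' = s.arr 3 i c' := by
  refine alw_count h.r1 h.r6 (by decide) (by decide) rfl rfl
    (fun d t => (∀ i < d, t.arr 3 i c = s.arr 0 i l) ∧
      ∀ c' ≠ c, ∀ i, t.arr 3 i c' = s.arr 3 i c') (by simp) (fun _ _ _ h => h) ?_
  intro d hd t hF ht hInv
  have r13 : t.reg 13 = c := by rw [hF.1 13 rfl, hc]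
  have r14 : t.reg 14 = l := by rw [hF.1 14 rfl, hl]
  have a0 : t.arr 0 = s.arr 0 := hF.2 0 rfl
  simp only [exec_seq, exec_load, exec_store, PMF.pure_bind, alw_pure]
  refine ⟨fun i hi => ?_, fun c' hc' i => ?_⟩
  · rcases Nat.lt_succ_iff_lt_or_eq.1 hi with h | rfl
    · simp [setArr_arr, ht, h.ne, hInv.1 i h]
    · simp [setArr_arr, r13, r14, a0, ht]
  · simp [setArr_arr, r13, hc', hInv.2 c' hc']

/-- Blocks are interleaved: coordinate `c` is entry `c / k` of block `c % k`. A block can thus be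
traversed by adding `k` repeatedly, without multiplication, and the layout agrees with `Fin.modNat`
and `Fin.divNat`. -/
lemma eq_add_mul_iff {j k c a : ℕ} (hj : j < k) : c = j + k * a ↔ c % k = j ∧ c / k = a := by
  constructor
  · rintro rfl
    rw [Nat.add_mul_mod_self_left, Nat.mod_eq_of_lt hj, Nat.add_mul_div_left _ _ (by omega),
      Nat.div_eq_of_lt hj, zero_add]
    exact ⟨rfl, rfl⟩
  · rintro ⟨rfl, rfl⟩
    exact (Nat.mod_add_div c k).symm

/-- Block `j` of the long secret is set to `0` because the planted instance already brings its own
`A s` in the response vector. -/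
lemma alw_embed {j : ℕ} (hj : j < k) (h : Base n m k E T η x s) (h11 : s.reg 11 = j) :
    Alw (embed.exec O s) fun t =>
      (∀ i < m, ∀ c < n * k, t.arr 3 i c =
        if c % k = j then s.arr 0 i (c / k) else s.arr 3 i c) ∧
      ∀ c < n * k, t.arr 7 c 0 = if c % k = j then 0 else s.arr 7 c 0 := by
  rw [embed, exec_seq, exec_plus, PMF.pure_bind]
  have hk : 0 < k := by omega
  refine (alw_count (c := n) (by simp [h.r0]) (by simp [h.r6]) (by decide) (by decide) rfl rfl
    (fun d t => t.reg 13 = j + k * d ∧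
      (∀ i < m, ∀ c, t.arr 3 i c =
        if c % k = j ∧ c / k < d then s.arr 0 i (c / k) else s.arr 3 i c) ∧
      ∀ c, t.arr 7 c 0 = if c % k = j ∧ c / k < d then 0 else s.arr 7 c 0)
      (by simp [h11, h.r7]) (fun d t v h => by simpa using h) ?_).mono ?_
  · intro d hd t hF ht hInv
    have hB : Base n m k E T η x t :=
      (h.frame (p := embed) (t := t) ⟨fun r hr => ?_, fun v hv => ?_⟩ (by decide))
    · simp only [exec_seq, exec_store, PMF.pure_bind]
      set t' := t.setArr 7 (t.reg 13) (t.reg 7) (t.reg 7) with ht'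
      have hF' : Frame (.store 7 13 7 7) t t' := alw_pure.1 (alw_frame O (.store 7 13 7 7) t)
      have hB' := hB.frame hF' (by decide)
      refine ((alw_copyColumn (l := d) (c := j + k * d) hB' ?_ ?_).and (alw_frame O _ t')).bind ?_
      · exact ht
      · exact hInv.1
      rintro u ⟨⟨hu1, hu2⟩, huF⟩
      rw [exec_plus, alw_pure]
      have u13 : u.reg 13 = t.reg 13 := huF.1 13 rfl
      have u2 : u.reg 2 = k := by rw [huF.1 2 rfl, hB'.r2]
      have a0 : t'.arr 0 = s.arr 0 := by
        rw [hF'.2 0 rfl, hF.2 0 rfl]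
        rfl
      refine ⟨?_, ?_, ?_⟩
      · simp [u13, u2, hInv.1]
        ring
      · intro i hi c
        change u.arr 3 i c = _
        by_cases hc : c = j + k * d
        · have h2 := (eq_add_mul_iff hj).1 hc
          rw [if_pos ⟨h2.1, by omega⟩, hc, hu1 i hi, ← hc, a0, h2.2]
        · rw [hu2 c hc, ht', setArr_arr, if_neg (by simp), hInv.2.1 i hi]
          rw [eq_add_mul_iff hj] at hc
          refine if_congr ?_ rfl rfl
          constructor <;> intro h1 <;> refine ⟨h1.1, ?_⟩ <;> have := h1.2
          · omega
          · have : c / k ≠ d := fun e => hc ⟨h1.1, e⟩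
            omega
      · intro c
        change u.arr 7 c 0 = _
        rw [huF.2 7 rfl, ht', setArr_arr, hInv.1, hB.r7]
        by_cases hc : c = j + k * d
        · have h2 := (eq_add_mul_iff hj).1 hc
          rw [if_pos ⟨rfl, hc, rfl⟩, if_pos ⟨h2.1, by omega⟩]
        · rw [if_neg (by tauto), hInv.2.2]
          rw [eq_add_mul_iff hj] at hc
          refine if_congr ?_ rfl rfl
          constructor <;> intro h1 <;> refine ⟨h1.1, ?_⟩ <;> have := h1.2
          · omega
          · have : c / k ≠ d := fun e => hc ⟨h1.1, e⟩
            omega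
    · have h13 : r ≠ 13 := by rintro rfl; simp [embed, Prog.modReg] at hr
      have := hF.1 r (by
        rw [embed] at hr
        simp only [Prog.modReg, Bool.or_eq_false_iff] at hr ⊢
        exact hr.2)
      rw [this, setReg_reg, if_neg h13]
    · have := hF.2 v (by
        rw [embed] at hv
        simp only [Prog.modArr, Bool.or_eq_false_iff] at hv ⊢
        exact hv.2)
      rw [this]
      rfl
  · rintro t ⟨-, h1, h2⟩
    refine ⟨fun i hi c hc => ?_, fun c hc => ?_⟩
    · rw [h1 i hi]
      simp [Nat.div_lt_of_lt_mul (by rwa [mul_comm] : c < k * n)]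
    · rw [h2]
      simp [Nat.div_lt_of_lt_mul (by rwa [mul_comm] : c < k * n)]

end Specs

end LPN

/-! ### Blocks of a long instance, and the deterministic parts of a trial -/

namespace LPN

/-- The number of samples that the candidate `y` violates. -/
def weight {n m : ℕ} (x : Inst n m) (y : Fin n → ZMod 2) : ℕ :=
  ∑ i, ((x.1 *ᵥ y + x.2) i).val

section Blocks

variable {n m k : ℕ}

/-- Block number `j` of a vector. -/
def block (j : Fin k) (z : Fin (n * k) → ZMod 2) : Fin n → ZMod 2 :=
  fun l => z (finProdFinEquiv (l, j))

/-- Replace block number `j` of a vector. -/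
def setBlock (j : Fin k) (v : Fin n → ZMod 2) (S : Fin (n * k) → ZMod 2) :
    Fin (n * k) → ZMod 2 :=
  fun c => if c.modNat = j then v c.divNat else S c

/-- Replace block number `j` of a matrix. -/
def setBlockMatrix (j : Fin k) (A : Matrix (Fin m) (Fin n) (ZMod 2))
    (M : Matrix (Fin m) (Fin (n * k)) (ZMod 2)) : Matrix (Fin m) (Fin (n * k)) (ZMod 2) :=
  fun i => setBlock j (A i) (M i)

/-- The distribution of the candidates that an attempt produces. -/
def candidate (O : Solver (n * k) m) (x : Inst n m) (p : ℝ) (j : Fin k) :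
    PMF (Fin n → ZMod 2) :=
  (PMF.uniformOfFintype (Matrix (Fin m) (Fin (n * k)) (ZMod 2))).bind fun M =>
    (PMF.uniformOfFintype (Fin (n * k) → ZMod 2)).bind fun S =>
      (noiseSum p m (k - 1)).bind fun e =>
        (O (setBlockMatrix j x.1 M,
          setBlockMatrix j x.1 M *ᵥ setBlock j 0 S + e + x.2)).map (block j)

end Blocks

section Specs

variable {n m k E T : ℕ} {η : ℝ} {x : Inst n m} {s t : Mem} {N' m' : ℕ} {O : Solver N' m'}

/-- The machine cannot multiply. As the entries of array `7` are bits by `h7`, a conditional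
addition does the job; the sums grow in `ℕ` and matter only modulo `2`. -/
lemma alw_multiplyRow {c i : ℕ} (hc : s.reg 8 = c) (r6 : s.reg 6 = 1) (r7 : s.reg 7 = 0)
    (hi : s.reg 12 = i) (h7 : ∀ l < c, s.arr 7 l 0 < 2) :
    Alw ((Prog.count 13 8 (.seq (.load 18 7 13 7) (.ifPos 18 (.seq (.load 19 3 12 13)
      (.seq (.load 20 4 12 7) (.seq (.plus 20 20 19) (.store 4 12 7 20)))) .skip))).exec O s)
      fun t => (t.arr 4 i 0 : ZMod 2) =
        s.arr 4 i 0 + ∑ l ∈ Finset.range c, (s.arr 3 i l : ZMod 2) * s.arr 7 l 0 ∧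
        ∀ i' ≠ i, t.arr 4 i' 0 = s.arr 4 i' 0 := by
  refine alw_count hc r6 (by decide) (by decide) rfl rfl (fun d t => (t.arr 4 i 0 : ZMod 2) =
      s.arr 4 i 0 + ∑ l ∈ Finset.range d, (s.arr 3 i l : ZMod 2) * s.arr 7 l 0 ∧
      ∀ i' ≠ i, t.arr 4 i' 0 = s.arr 4 i' 0) (by simp) (fun _ _ _ h => h) ?_
  intro d hd t hF ht hInv
  have q7 : t.reg 7 = 0 := by rw [hF.1 7 rfl, r7]
  have q12 : t.reg 12 = i := by rw [hF.1 12 rfl, hi]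
  have a7 : t.arr 7 = s.arr 7 := hF.2 7 rfl
  have a3 : t.arr 3 = s.arr 3 := hF.2 3 rfl
  have hd2 := h7 d hd
  simp only [exec_seq, exec_load, exec_ifPos, PMF.pure_bind, setReg_reg, if_true]
  rw [ht, q7, a7, Finset.sum_range_succ]
  by_cases hz : 0 < s.arr 7 d 0
  · have hz1 : s.arr 7 d 0 = 1 := by omega
    rw [if_pos hz]
    simp only [exec_plus, exec_store, PMF.pure_bind, alw_pure]
    refine ⟨?_, fun i' hi' => ?_⟩
    · simp [setArr_arr, q12, q7, a3, hz1, hInv.1, add_assoc]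
    · simp [setArr_arr, q12, hi', hInv.2 i' hi']
  · have hz1 : s.arr 7 d 0 = 0 := by omega
    rw [if_neg hz, exec_skip, alw_pure]
    refine ⟨?_, fun i' hi' => hInv.2 i' hi'⟩
    simp [hz1, hInv.1]

lemma alw_multiply (h : Base n m k E T η x s) (h7 : ∀ l < n * k, s.arr 7 l 0 < 2) :
    Alw (multiply.exec O s) fun t => ∀ i < m, (t.arr 4 i 0 : ZMod 2) =
      s.arr 4 i 0 + ∑ l ∈ Finset.range (n * k), (s.arr 3 i l : ZMod 2) * s.arr 7 l 0 := by
  refine (alw_count h.r1 h.r6 (by decide) (by decide) rfl rfl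
    (fun d t => ∀ i, (t.arr 4 i 0 : ZMod 2) = s.arr 4 i 0 +
      if i < d then ∑ l ∈ Finset.range (n * k), (s.arr 3 i l : ZMod 2) * s.arr 7 l 0 else 0)
    (by simp) (fun _ _ _ h => h) ?_).mono fun t h i hi => by rw [h i, if_pos hi]
  intro d hd t hF ht hInv
  have hB := h.frame hF (by decide)
  have a7 : t.arr 7 = s.arr 7 := hF.2 7 rfl
  have a3 : t.arr 3 = s.arr 3 := hF.2 3 rfl
  refine (alw_multiplyRow hB.r8 hB.r6 hB.r7 ht (by rwa [a7])).mono ?_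
  rintro u ⟨hu1, hu2⟩ i
  by_cases hi : i = d
  · subst hi
    rw [hu1, hInv, a7, a3]
    simp
  · rw [hu2 i hi, hInv]
    congr 1
    exact if_congr (by omega) rfl rfl

lemma sim_query : Sim (Prog.query.exec O s) (O (s.oracleInput N' m')) fun t z =>
    ∀ c : Fin N', t.arr 5 c 0 = (z c).val := by
  refine (sim_map (O (s.oracleInput N' m')) fun z => s.putAnswer z).mono ?_
  rintro t z rfl c
  simp [Mem.putAnswer]

lemma alw_extract (h : Base n m k E T η x s) : Alw (extract.exec O s) fun t =>
    ∀ l < n, t.arr 8 l 0 = s.arr 5 (s.reg 11 + k * l) 0 := by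
  rw [extract, exec_seq, exec_plus, PMF.pure_bind]
  refine (alw_count (c := n) (by simp [h.r0]) (by simp [h.r6]) (by decide) (by decide) rfl rfl
    (fun d t => t.reg 13 = s.reg 11 + k * d ∧
      ∀ l < d, t.arr 8 l 0 = s.arr 5 (s.reg 11 + k * l) 0)
      (by simp [h.r7]) (fun d t v h => by simpa using h) ?_).mono fun t h => h.2
  intro d hd t hF ht hInv
  have q7 : t.reg 7 = 0 := by rw [hF.1 7 rfl]; simp [h.r7]
  have q2 : t.reg 2 = k := by rw [hF.1 2 rfl]; simp [h.r2]
  have a5 : t.arr 5 = s.arr 5 := hF.2 5 rfl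
  simp only [exec_seq, exec_load, exec_store, exec_plus, PMF.pure_bind, alw_pure]
  refine ⟨?_, fun l hl => ?_⟩
  · simp [hInv.1, q2]
    ring
  · rcases Nat.lt_succ_iff_lt_or_eq.1 hl with h | rfl
    · simp [setArr_arr, ht, h.ne, hInv.2 l h]
    · simp [setArr_arr, ht, q7, a5, hInv.1]

lemma sum_ite_lt_succ {M : Type*} [AddCommMonoid M] {n d : ℕ} (hd : d < n) (f : Fin n → M) :
    (∑ l : Fin n, if (l : ℕ) < d + 1 then f l else 0) =
      (∑ l : Fin n, if (l : ℕ) < d then f l else 0) + f ⟨d, hd⟩ := by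
  have : ∀ l : Fin n, (if (l : ℕ) < d + 1 then f l else 0) =
      (if (l : ℕ) < d then f l else 0) + if l = ⟨d, hd⟩ then f ⟨d, hd⟩ else 0 := by
    intro l
    rcases lt_trichotomy (l : ℕ) d with h | h | h
    · simp [h, h.trans (Nat.lt_succ_self d), Fin.ext_iff, h.ne]
    · obtain rfl : l = ⟨d, hd⟩ := Fin.ext h
      simp
    · simp [Fin.ext_iff, h.ne', show ¬ (l : ℕ) < d by omega, show ¬ (l : ℕ) < d + 1 by omega]
  rw [Finset.sum_congr rfl fun l _ => this l, Finset.sum_add_distrib]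
  simp

/-- On bits, exclusive or is `|a - b|`. Here reduction modulo `2` must really be carried out, since
the resulting bits are then counted in `ℕ`. -/
lemma val_add_eq_sub_add_sub (a b : ZMod 2) :
    (a + b).val = (a.val - b.val) + (b.val - a.val) := by
  revert a b
  decide

lemma alw_weighRow {i : Fin m} {y : Fin n → ZMod 2} (h : Base n m k E T η x s)
    (hi : s.reg 12 = i) (hy : ∀ l : Fin n, s.arr 8 l 0 = (y l).val)
    (h19 : s.reg 19 = (x.2 i).val) :
    Alw ((Prog.count 14 0 (.seq (.load 18 8 14 7) (.ifPos 18 (.seq (.load 18 0 12 14)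
      (.seq (.minus 21 19 18) (.seq (.minus 22 18 19) (.plus 19 21 22)))) .skip))).exec O s)
      fun t => t.reg 19 = ((x.1 *ᵥ y + x.2) i).val := by
  refine (alw_count h.r0 h.r6 (by decide) (by decide) rfl rfl (fun d t => t.reg 19 =
      (x.2 i + ∑ l : Fin n, if (l : ℕ) < d then x.1 i l * y l else 0).val)
      (by simp [h19]) (fun _ _ _ h => by simpa using h) ?_).mono fun t ht => ?_
  · intro d hd t hF ht hInv
    have hB := h.frame hF (by decide)
    have q12 : t.reg 12 = i := by rw [hF.1 12 rfl, hi]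
    have a8 : t.arr 8 d 0 = (y ⟨d, hd⟩).val := by rw [hF.2 8 rfl, ← hy]
    have a0 : t.arr 0 i d = (x.1 i ⟨d, hd⟩).val := hB.a0 i ⟨d, hd⟩
    have hsum : (x.2 i + ∑ l : Fin n, if (l : ℕ) < d + 1 then x.1 i l * y l else 0) =
        (x.2 i + ∑ l : Fin n, if (l : ℕ) < d then x.1 i l * y l else 0) +
          x.1 i ⟨d, hd⟩ * y ⟨d, hd⟩ := by
      rw [sum_ite_lt_succ hd, add_assoc]
    simp only [exec_seq, exec_load, exec_ifPos, PMF.pure_bind, setReg_reg, if_true]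
    rw [ht, hB.r7, a8, hsum]
    have hcase : y ⟨d, hd⟩ = 0 ∨ y ⟨d, hd⟩ = 1 := by
      generalize y ⟨d, hd⟩ = b
      revert b
      decide
    rcases hcase with hz | hz
    · rw [hz, ZMod.val_zero, if_neg (lt_irrefl 0), exec_skip, alw_pure]
      simp [hInv]
    · rw [hz, show (1 : ZMod 2).val = 1 from rfl, if_pos zero_lt_one]
      simp only [exec_minus, exec_plus, PMF.pure_bind, alw_pure]
      rw [mul_one, val_add_eq_sub_add_sub]
      simp [hInv, q12, a0]
  · rw [ht]
    simp [Matrix.mulVec, dotProduct, add_comm]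

lemma alw_weigh {y : Fin n → ZMod 2} (h : Base n m k E T η x s)
    (hy : ∀ l : Fin n, s.arr 8 l 0 = (y l).val) :
    Alw (weigh.exec O s) fun t => t.reg 20 = weight x y := by
  rw [weigh, exec_seq, exec_const, PMF.pure_bind]
  refine (alw_count (c := m) (by simp [h.r1]) (by simp [h.r6]) (by decide) (by decide) rfl rfl
    (fun d t => t.reg 20 = ∑ i : Fin m, if (i : ℕ) < d then ((x.1 *ᵥ y + x.2) i).val else 0)
      (by simp) (fun d t v h => by simpa using h) ?_).mono fun t h => ?_
  · intro d hd t hF ht hInv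
    have hB : Base n m k E T η x t := by
      refine Base.frame (s := s.setReg 20 0) ?_ hF (by decide)
      exact h.frame (alw_pure.1 (alw_frame O (.const 20 0) s)) (by decide)
    have a8 : t.arr 8 = s.arr 8 := hF.2 8 rfl
    rw [exec_seq, exec_load, PMF.pure_bind, exec_seq]
    set t' := t.setReg 19 (t.arr 1 (t.reg 12) (t.reg 7)) with ht'
    have hF' : Frame (.load 19 1 12 7) t t' := alw_pure.1 (alw_frame O (.load 19 1 12 7) t)
    refine ((alw_weighRow (i := ⟨d, hd⟩) (y := y) (hB.frame hF' (by decide)) ht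
      (by rw [ht', setReg_arr, a8]; exact hy) ?_).and (alw_frame O _ t')).bind ?_
    · rw [ht', setReg_reg, if_pos rfl, ht, hB.r7]
      exact hB.a1 ⟨d, hd⟩
    · rintro u ⟨hu, huF⟩
      rw [exec_plus, alw_pure, setReg_reg, if_pos rfl, hu, huF.1 20 rfl]
      have : t'.reg 20 = t.reg 20 := by rw [ht']; simp
      rw [this, hInv, sum_ite_lt_succ hd]
  · rw [h, weight]
    simp

/-- The truncated difference is positive exactly when the new weight is strictly smaller, so a tie
keeps the old candidate. -/
lemma alw_keepBest {y : Fin n → ZMod 2} {w : ℕ} (h : Base n m k E T η x s)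
    (hy : ∀ l : Fin n, s.arr 8 l 0 = (y l).val) (hw : s.reg 20 = w) :
    Alw (keepBest.exec O s) fun t =>
      (w < s.reg 10 → t.reg 10 = w ∧ ∀ l : Fin n, t.arr 6 l 0 = (y l).val) ∧
      (s.reg 10 ≤ w → t.reg 10 = s.reg 10 ∧ t.arr 6 = s.arr 6) := by
  rw [keepBest, exec_seq, exec_minus, PMF.pure_bind, exec_ifPos, setReg_reg, if_pos rfl, hw]
  by_cases hlt : w < s.reg 10
  · rw [if_pos (by omega), exec_seq, exec_plus, PMF.pure_bind]
    refine (alw_count (c := n) (by simp [h.r0]) (by simp [h.r6]) (by decide) (by decide) rfl rfl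
      (fun d t => t.reg 10 = w ∧ ∀ l : Fin n, l < d → t.arr 6 l 0 = (y l).val)
      (by simp [hw, h.r7]) (fun d t v h => by simpa using h) ?_).mono fun t h => ?_
    · intro d hd t hF ht hInv
      have q7 : t.reg 7 = 0 := by rw [hF.1 7 rfl]; simp [h.r7]
      have a8 : t.arr 8 = s.arr 8 := hF.2 8 rfl
      simp only [exec_seq, exec_load, exec_store, PMF.pure_bind, alw_pure]
      refine ⟨by simp [hInv.1], fun l hl => ?_⟩
      rcases Nat.lt_succ_iff_lt_or_eq.1 hl with h | h
      · simp [setArr_arr, ht, h.ne, hInv.2 l h]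
      · simp [setArr_arr, ht, q7, a8, ← h, hy]
    · exact ⟨fun _ => ⟨h.1, fun l => h.2 l l.2⟩, fun h' => absurd hlt (by omega)⟩
  · rw [if_neg (by omega), exec_skip, alw_pure]
    exact ⟨fun h' => absurd h' hlt, fun _ => ⟨by simp, rfl⟩⟩

end Specs

/-! ### One trial as a draw from `candidate` -/

section Attempt

variable {n m k E T : ℕ} {η : ℝ} {x : Inst n m} {s : Mem} {O : Solver (n * k) m}

/-- The program consumes randomness in the order in which `candidate` draws it: matrix, secret,
noise, oracle. The couplings are bound in that order, with the deterministic parts inserted between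
them. -/
lemma sim_attempt (hη0 : 0 ≤ η) (hη1 : η < 1) (h : Base n m k E T η x s) {j : Fin k}
    (hj : s.reg 11 = j) :
    Sim (attempt.exec O s) (candidate O x (truncate T η) j) fun t z =>
      (weight x z < s.reg 10 → t.reg 10 = weight x z ∧ ∀ l : Fin n, t.arr 6 l 0 = (z l).val) ∧
      (s.reg 10 ≤ weight x z → t.reg 10 = s.reg 10 ∧ t.arr 6 = s.arr 6) := by
  rw [attempt, exec_seq, candidate]
  refine ((sim_sampleMatrix h).and_alw (alw_frame O _ s)).bind ?_
  rintro t1 M ⟨hM, F1⟩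
  have B1 := h.frame F1 (by decide)
  rw [exec_seq]
  refine ((sim_sampleSecret B1).and_alw (alw_frame O _ t1)).bind ?_
  rintro t2 S ⟨hS, F2⟩
  have B2 := B1.frame F2 (by decide)
  rw [exec_seq]
  refine ((alw_copyVector B2).and (alw_frame O _ t2)).bind_sim ?_
  rintro t3 ⟨hv, F3⟩
  have B3 := B2.frame F3 (by decide)
  rw [exec_seq]
  refine ((sim_addNoises hη0 hη1 B3).and_alw (alw_frame O _ t3)).bind ?_
  rintro t4 e ⟨he, F4⟩
  have B4 := B3.frame F4 (by decide)
  have q11 : t4.reg 11 = j := by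
    rw [F4.1 11 rfl, F3.1 11 rfl, F2.1 11 rfl, F1.1 11 rfl, hj]
  rw [exec_seq]
  refine ((alw_embed j.2 B4 q11).and (alw_frame O _ t4)).bind_sim ?_
  rintro t5 ⟨hm, F5⟩
  have B5 := B4.frame F5 (by decide)
  have a3 : ∀ (i : Fin m) (c : Fin (n * k)),
      t5.arr 3 i c = (setBlockMatrix j x.1 M i c).val := by
    intro i c
    rw [hm.1 i i.2 c c.2, setBlockMatrix, setBlock]
    have e1 : ((c : ℕ) % k = j) ↔ c.modNat = j := by
      rw [Fin.ext_iff, Fin.coe_modNat]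
    by_cases hc : c.modNat = j
    · rw [if_pos hc, if_pos (e1.2 hc)]
      exact B4.a0 i c.divNat
    · rw [if_neg hc, if_neg (fun h => hc (e1.1 h)), F4.2 3 rfl, F3.2 3 rfl, F2.2 3 rfl, hM]
  have a7 : ∀ c : Fin (n * k), t5.arr 7 c 0 = (setBlock j 0 S c).val := by
    intro c
    rw [hm.2 c c.2, setBlock]
    have e1 : ((c : ℕ) % k = j) ↔ c.modNat = j := by
      rw [Fin.ext_iff, Fin.coe_modNat]
    by_cases hc : c.modNat = j
    · rw [if_pos hc, if_pos (e1.2 hc)]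
      rfl
    · rw [if_neg hc, if_neg (fun h => hc (e1.1 h)), F4.2 7 rfl, F3.2 7 rfl, hS]
  rw [exec_seq]
  refine ((alw_multiply B5 ?_).and (alw_frame O _ t5)).bind_sim ?_
  · intro l hl
    rw [a7 ⟨l, hl⟩]
    exact ZMod.val_lt _
  rintro t6 ⟨hp, F6⟩
  have B6 := B5.frame F6 (by decide)
  -- The coupled query and the actual one agree exactly, so the oracle can be run on both sides with
  -- the same randomness.
  have hinp : t6.oracleInput (n * k) m = (setBlockMatrix j x.1 M,
      setBlockMatrix j x.1 M *ᵥ setBlock j 0 S + e + x.2) := by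
    refine Prod.ext ?_ ?_
    · ext i c
      change ((t6.arr 3 i c : ℕ) : ZMod 2) = _
      rw [F6.2 3 rfl, a3, ZMod.natCast_zmod_val]
    · funext i
      change ((t6.arr 4 i 0 : ℕ) : ZMod 2) = _
      rw [hp i i.2, F5.2 4 rfl, he, hv, Finset.sum_range
        (fun l => (t5.arr 3 i l : ZMod 2) * t5.arr 7 l 0)]
      simp only [a3, a7, ZMod.natCast_zmod_val]
      simp only [Pi.add_apply, Matrix.mulVec, dotProduct]
      ring
  rw [exec_seq, ← hinp]
  have hq := (sim_query (O := O) (s := t6)).and_alw (alw_frame O _ t6)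
  refine (hq.bind_alw (Q := fun t z =>
      (weight x (block j z) < s.reg 10 →
        t.reg 10 = weight x (block j z) ∧ ∀ l : Fin n, t.arr 6 l 0 = (block j z l).val) ∧
      (s.reg 10 ≤ weight x (block j z) → t.reg 10 = s.reg 10 ∧ t.arr 6 = s.arr 6)) ?_).map _
    fun t z h => h
  rintro t7 z ⟨hz, F7⟩
  have B7 := B6.frame F7 (by decide)
  rw [exec_seq]
  refine ((alw_extract B7).and (alw_frame O _ t7)).bind ?_
  rintro t8 ⟨hb, F8⟩
  have B8 := B7.frame F8 (by decide)
  have q11' : t7.reg 11 = j := by rw [F7.1 11 rfl, F6.1 11 rfl, F5.1 11 rfl, q11]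
  have hb' : ∀ l : Fin n, t8.arr 8 l 0 = (block j z l).val := by
    intro l
    rw [hb l l.2, q11']
    exact hz (finProdFinEquiv (l, j))
  rw [exec_seq]
  refine ((alw_weigh B8 hb').and (alw_frame O _ t8)).bind ?_
  rintro t9 ⟨hw, F9⟩
  have B9 := B8.frame F9 (by decide)
  have q10 : t9.reg 10 = s.reg 10 := by
    rw [F9.1 10 rfl, F8.1 10 rfl, F7.1 10 rfl, F6.1 10 rfl, F5.1 10 rfl, F4.1 10 rfl,
      F3.1 10 rfl, F2.1 10 rfl, F1.1 10 rfl]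
  have q6 : t9.arr 6 = s.arr 6 := by
    rw [F9.2 6 rfl, F8.2 6 rfl, F7.2 6 rfl, F6.2 6 rfl, F5.2 6 rfl, F4.2 6 rfl,
      F3.2 6 rfl, F2.2 6 rfl, F1.2 6 rfl]
  have := alw_keepBest (O := O) B9 (y := block j z) (by rw [F9.2 8 rfl]; exact hb') hw
  rwa [q10, q6] at this

end Attempt

end LPN

/-! ### Correctness of the search -/

namespace LPN

variable {n m k E T : ℕ} {η : ℝ} {x : Inst n m} {O : Solver (n * k) m}

/-- The number `4 * m` of digits comes from doubling `m` twice. The initial record `m + 1` exceeds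
every weight. -/
lemma alw_setup (ε δ : ℝ) : Alw (setup.exec O (initState n m k ε δ η x).mem) fun t =>
    Base n m k ⌈1 / ε⌉₊ (4 * m) η x t ∧ t.reg 10 = m + 1 := by
  set s := (initState n m k ε δ η x).mem with hs
  simp only [setup, exec_seq, exec_plus, exec_const, PMF.pure_bind]
  set s' := (((((s.setReg 5 _).setReg 5 _).setReg 6 _).setReg 7 _).setReg 8 _) with hs'
  refine (alw_loop (n := n) (s := s') (by simp [hs', hs, initState, State.mem])
    (fun d t => t.reg 8 = d * k) (by simp [hs']) ?_).bind ?_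
  · intro d hd t hF hInv
    have q2 : t.reg 2 = k := by
      rw [hF.1 2 rfl]
      simp [hs', hs, initState, State.mem]
    rw [exec_plus, alw_pure]
    simp [hInv, q2]
    ring
  · rintro t ⟨hF, h8⟩
    have hr : ∀ r < 8, t.reg r = s'.reg r := by
      intro r hr
      refine hF.1 r ?_
      have : r ≠ 8 := by omega
      simpa [Prog.modReg] using this
    have hA : t.arr = s'.arr := funext fun v => hF.2 v rfl
    simp only [exec_minus, PMF.pure_bind, alw_pure]
    refine ⟨⟨?_, ?_, ?_, ?_, ?_, ?_, ?_, ?_, ?_, ?_, ?_, ?_⟩, ?_⟩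
    · simp [hr, hs', hs, initState, State.mem]
    · simp [hr, hs', hs, initState, State.mem]
    · simp [hr, hs', hs, initState, State.mem]
    · simp [hr, hs', hs, initState, State.mem]
    · simp [hr, hs', hs, initState, State.mem]
      ring
    · simp [hr, hs']
    · simp [hr, hs']
    · simp [h8]
    · simp [hr, hs', hs, initState, State.mem]
    · intro i l
      simp [hA, hs', hs, initState, State.mem]
    · intro i
      simp [hA, hs', hs, initState, State.mem]
    · intro i
      simp [hA, hs', hs, initState, State.mem, digit]
    · simp [hr, hs', hs, initState, State.mem]

/-- A candidate of weight `w` is the best one so far, if there is one. -/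
structure SearchInv (n m k E T : ℕ) (η : ℝ) (x : Inst n m) (s : Fin n → ZMod 2) (t : Mem) :
    Prop where
  base : Base n m k E T η x t
  le : weight x s ≤ t.reg 10
  out : t.reg 10 = weight x s → ∀ l : Fin n, t.arr 6 l 0 = (s l).val

/-- The indicator of the event that `s` has not been found yet. -/
def notFound (x : Inst n m) (s : Fin n → ZMod 2) (t : Mem) : ℝ≥0∞ :=
  if t.reg 10 = weight x s then 0 else 1

lemma SearchInv.const {s : Fin n → ZMod 2} {t u : Mem} (h : SearchInv n m k E T η x s t)
    (hB : Base n m k E T η x u) (h10 : u.reg 10 = t.reg 10) (h6 : u.arr 6 = t.arr 6) :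
    SearchInv n m k E T η x s u :=
  ⟨hB, h10 ▸ h.le, by rw [h10, h6]; exact h.out⟩

/-- As `s` is the strict minimizer, it replaces any other record when drawn and is never displaced
afterwards. Hence each trial multiplies the failure probability by the chance of not drawing `s`. -/
lemma attempt_spec (hη0 : 0 ≤ η) (hη1 : η < 1) {s : Fin n → ZMod 2}
    (hs : ∀ y, y ≠ s → weight x s < weight x y) {t : Mem} (h : SearchInv n m k E T η x s t)
    {j : Fin k} (hj : t.reg 11 = j) :
    Alw (attempt.exec O t) (SearchInv n m k E T η x s) ∧
    ex (attempt.exec O t) (notFound x s) ≤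
      (1 - candidate O x (truncate T η) j s) * notFound x s t := by
  have hle : ∀ y, weight x s ≤ weight x y := by
    intro y
    by_cases hy : y = s
    · rw [hy]
    · exact (hs y hy).le
  have hsim := (sim_attempt (O := O) hη0 hη1 h.base hj).and_alw (alw_frame O attempt t)
  constructor
  -- Forgetting the candidate turns the coupling into a one-sided statement.
  · refine (sim_pure (a := ()) (P := fun u _ => SearchInv n m k E T η x s u)).1 ?_
    rw [← PMF.map_const (candidate O x (truncate T η) j) ()]
    refine hsim.map _ ?_
    rintro u z ⟨⟨h1, h2⟩, hF⟩
    have hB := h.base.frame hF (by decide)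
    rcases lt_or_ge (weight x z) (t.reg 10) with hz | hz
    · obtain ⟨e1, e2⟩ := h1 hz
      refine ⟨hB, e1 ▸ hle z, fun e => ?_⟩
      by_cases hzs : z = s
      · exact hzs ▸ e2
      · have := hs z hzs
        omega
    · obtain ⟨e1, e2⟩ := h2 hz
      exact h.const hB e1 e2
  · by_cases hd : t.reg 10 = weight x s
    · have h0 : notFound x s t = 0 := if_pos hd
      rw [h0, mul_zero]
      refine (hsim.ex_le (g := fun _ => 0) ?_).trans (ex_const _ _).le
      rintro u z ⟨⟨-, h2⟩, -⟩
      obtain ⟨e1, -⟩ := h2 (hd ▸ hle z)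
      rw [notFound, if_pos (e1.trans hd)]
    · have h0 : notFound x s t = 1 := if_neg hd
      rw [h0, mul_one]
      have hlt : weight x s < t.reg 10 := lt_of_le_of_ne h.le (Ne.symm hd)
      refine (hsim.ex_le (g := fun z => if z = s then 0 else 1) ?_).trans ?_
      · rintro u z ⟨⟨h1, -⟩, -⟩
        by_cases hz : z = s
        · subst hz
          rw [notFound, if_pos (h1 hlt).1]
          exact zero_le
        · rw [if_neg hz, notFound]
          split_ifs <;> simp
      · refine ENNReal.le_sub_of_add_le_right (PMF.apply_ne_top _ _) ?_
        rw [← ex_single (candidate O x (truncate T η) j) s, ← ex_add]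
        refine (le_of_eq ?_).trans (ex_const (candidate O x (truncate T η) j) 1).le
        congr 1
        funext z
        by_cases hz : z = s <;> simp [hz]

/-- The probability that the search misses `s`. -/
lemma ex_search_le (hη0 : 0 ≤ η) (hη1 : η < 1) {s : Fin n → ZMod 2}
    (hs : ∀ y, y ≠ s → weight x s < weight x y) {t : Mem} (h : SearchInv n m k E T η x s t) :
    Alw (search.exec O t) (SearchInv n m k E T η x s) ∧
    ex (search.exec O t) (notFound x s) ≤
      ((∏ j : Fin k, (1 - candidate O x (truncate T η) j s)) ^ k) ^ E := by
  have hone : ∀ t, notFound x s t ≤ 1 := fun t => by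
    unfold notFound
    split_ifs <;> simp
  set c : ℕ → ℝ≥0∞ := fun j =>
    if hj : j < k then 1 - candidate O x (truncate T η) ⟨j, hj⟩ s else 1 with hc
  set P := ∏ j : Fin k, (1 - candidate O x (truncate T η) j s) with hP
  have hprod : ∏ j ∈ Finset.range k, c j = P := by
    rw [Finset.prod_range, hP]
    exact Finset.prod_congr rfl fun j _ => by simp [hc]
  have hround : ∀ d < k, ∀ t, (SearchInv n m k E T η x s t ∧ t.reg 11 = d) →
      Alw ((Prog.seq attempt (.plus 11 11 6)).exec O t)
        (fun u => SearchInv n m k E T η x s u ∧ u.reg 11 = d + 1) ∧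
      ex ((Prog.seq attempt (.plus 11 11 6)).exec O t) (notFound x s) ≤ c d * notFound x s t := by
    rintro d hd t ⟨ht, h11⟩
    obtain ⟨h1, h2⟩ := attempt_spec (O := O) hη0 hη1 hs ht (j := ⟨d, hd⟩) h11
    rw [exec_seq]
    constructor
    · refine (h1.and (alw_frame O attempt t)).bind ?_
      rintro u ⟨hu, hF⟩
      rw [exec_plus, alw_pure]
      refine ⟨hu.const ?_ (by simp) rfl, ?_⟩
      · exact hu.base.frame (alw_pure.1 (alw_frame O (.plus 11 11 6) u)) (by decide)
      · simp [hF.1 11 rfl, h11, hu.base.r6]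
    · rw [ex_bind]
      simp only [exec_plus, ex_pure]
      have e : ∀ u : Mem, notFound x s (u.setReg 11 (u.reg 11 + u.reg 6)) = notFound x s u := by
        intro u
        simp [notFound]
      simp only [e]
      refine h2.trans (le_of_eq ?_)
      simp [hc, hd]
  have hinner : ∀ t, SearchInv n m k E T η x s t →
      Alw ((Prog.seq (.const 11 0) (.loop 2 (.seq attempt (.plus 11 11 6)))).exec O t)
        (SearchInv n m k E T η x s) ∧
      ex ((Prog.seq (.const 11 0) (.loop 2 (.seq attempt (.plus 11 11 6)))).exec O t)
        (notFound x s) ≤ P * notFound x s t := by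
    intro t ht
    rw [exec_seq, exec_const, PMF.pure_bind]
    have ht' : SearchInv n m k E T η x s (t.setReg 11 0) :=
      ht.const (ht.base.frame (alw_pure.1 (alw_frame O (.const 11 0) t)) (by decide))
        (by simp) rfl
    constructor
    · exact (alw_loop ht'.base.r2 (fun d t => SearchInv n m k E T η x s t ∧ t.reg 11 = d)
        ⟨ht', by simp⟩ fun d hd t _ hI => (hround d hd t hI).1).mono fun u hu => hu.2.1
    · have := ex_loop_le ht'.base.r2 (fun d t => SearchInv n m k E T η x s t ∧ t.reg 11 = d)
        ⟨ht', by simp⟩ (notFound x s) c (fun d hd t hI => (hround d hd t hI).1)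
        fun d hd t hI => (hround d hd t hI).2
      rw [hprod] at this
      simpa [notFound] using this
  have hmid : ∀ t, SearchInv n m k E T η x s t →
      Alw ((Prog.loop 2 (.seq (.const 11 0) (.loop 2 (.seq attempt (.plus 11 11 6))))).exec O t)
        (SearchInv n m k E T η x s) ∧
      ex ((Prog.loop 2 (.seq (.const 11 0) (.loop 2 (.seq attempt (.plus 11 11 6))))).exec O t)
        (notFound x s) ≤ P ^ k * notFound x s t := by
    intro t ht
    constructor
    · exact (alw_loop ht.base.r2 (fun _ t => SearchInv n m k E T η x s t) ht
        fun d hd t _ hI => (hinner t hI).1).mono fun u hu => hu.2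
    · have := ex_loop_le ht.base.r2 (fun _ t => SearchInv n m k E T η x s t) ht (notFound x s)
        (fun _ => P) (fun d hd t hI => (hinner t hI).1) fun d hd t hI => (hinner t hI).2
      simpa using this
  constructor
  · exact (alw_loop h.base.r3 (fun _ t => SearchInv n m k E T η x s t) h
      fun d hd t _ hI => (hmid t hI).1).mono fun u hu => hu.2
  · have := ex_loop_le h.base.r3 (fun _ t => SearchInv n m k E T η x s t) h (notFound x s)
      (fun _ => P ^ k) (fun d hd t hI => (hmid t hI).1) fun d hd t hI => (hmid t hI).2
    rw [Finset.prod_const, Finset.card_range] at this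
    exact this.trans ((mul_le_mul_right (hone t) _).trans (mul_one _).le)

lemma weight_le (x : Inst n m) (y : Fin n → ZMod 2) : weight x y ≤ m := by
  have h : ∀ a : ZMod 2, a.val ≤ 1 := by decide
  calc weight x y ≤ ∑ _i : Fin m, 1 := Finset.sum_le_sum fun i _ => h _
    _ = m := by simp

/-- The success probability of the reduction on an instance. -/
lemma one_sub_le_reduction (hη0 : 0 ≤ η) (hη1 : η < 1) (ε δ : ℝ) {s : Fin n → ZMod 2}
    (hs : ∀ y, y ≠ s → weight x s < weight x y) :
    1 - ((∏ j : Fin k, (1 - candidate O x (truncate (4 * m) η) j s)) ^ k) ^ ⌈1 / ε⌉₊ ≤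
      reduction solve n m k ε δ η O x s := by
  set B := ((∏ j : Fin k, (1 - candidate O x (truncate (4 * m) η) j s)) ^ k) ^ ⌈1 / ε⌉₊ with hB
  set ν := solve.exec O (initState n m k ε δ η x).mem with hν
  have h1 : Alw ν (SearchInv n m k ⌈1 / ε⌉₊ (4 * m) η x s) ∧ ex ν (notFound x s) ≤ B := by
    rw [hν, solve, exec_seq]
    have hstart : ∀ t, (Base n m k ⌈1 / ε⌉₊ (4 * m) η x t ∧ t.reg 10 = m + 1) →
        SearchInv n m k ⌈1 / ε⌉₊ (4 * m) η x s t := by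
      rintro t ⟨hb, h10⟩
      have := weight_le x s
      -- The condition on the output is vacuous at the start, as no weight equals `m + 1`.
      exact ⟨hb, by omega, fun e => by omega⟩
    constructor
    · exact (alw_setup ε δ).bind fun t ht => (ex_search_le hη0 hη1 hs (hstart t ht)).1
    · rw [ex_bind]
      refine (ex_mono fun t ht => (ex_search_le hη0 hη1 hs
        (hstart t (alw_setup ε δ t ht))).2).trans ?_
      exact (ex_const _ _).le
  have h2 : reduction solve n m k ε δ η O x s =
      ex ν fun t => if (fun l : Fin n => (t.arr 6 l 0 : ZMod 2)) = s then 1 else 0 := by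
    rw [← ex_single (reduction solve n m k ε δ η O x) s, reduction, finalState, ex_map, hν,
      ← map_mem_run, ex_map]
    rfl
  rw [tsub_le_iff_right, h2]
  refine (ex_const ν 1).symm.le.trans (le_trans ?_ (add_le_add_right h1.2 _))
  rw [← ex_add]
  refine ex_mono fun t ht => ?_
  by_cases hd : t.reg 10 = weight x s
  · have : (fun l : Fin n => (t.arr 6 l 0 : ZMod 2)) = s := by
      funext l
      rw [(h1.1 t ht).out hd l, ZMod.natCast_zmod_val]
    simp [this]
  · simp [notFound, hd]

end LPN

namespace LPN

/-! ### Sums of noise vectors -/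

lemma noise_apply (p : ℝ) (m : ℕ) (e : Fin m → ZMod 2) : noise p m e = ∏ i, bern p (e i) := rfl

lemma noiseSum_succ (p : ℝ) (m l : ℕ) : noiseSum p m (l + 1) =
    (noiseSum p m l).bind fun v => (noise p m).map (v + ·) := rfl

lemma noise_zero (m : ℕ) : noise 0 m = PMF.pure 0 := by
  classical
  ext e
  rw [noise_apply, PMF.pure_apply]
  split_ifs with h
  · subst h
    simp [bern_zero]
  · obtain ⟨i, hi⟩ := Function.ne_iff.1 h
    refine Finset.prod_eq_zero (Finset.mem_univ i) ?_
    have : e i = 1 := by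
      have := hi
      simp only [Pi.zero_apply] at this
      generalize e i = a at this
      revert a
      decide
    rw [this, bern_one 0 le_rfl zero_le_one]
    simp

lemma map_add_apply {m : ℕ} (μ : PMF (Fin m → ZMod 2)) (v w : Fin m → ZMod 2) :
    (μ.map (v + ·)) w = μ (w - v) := by
  classical
  rw [PMF.map_apply, tsum_eq_single (w - v)]
  · simp
  · intro b hb
    rw [if_neg]
    rintro rfl
    simp at hb

/-- The convolution factors over the coordinates, and a sum of two bits is `1` when exactly one of
them is. -/
lemma noise_bind_noise {p q : ℝ} (hp0 : 0 ≤ p) (hp1 : p ≤ 1) (hq0 : 0 ≤ q) (hq1 : q ≤ 1)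
    (m : ℕ) : ((noise q m).bind fun v => (noise p m).map (v + ·)) =
      noise (q * (1 - p) + (1 - q) * p) m := by
  classical
  have hr0 : 0 ≤ q * (1 - p) + (1 - q) * p := by
    have : 0 ≤ 1 - p := by linarith
    have : 0 ≤ 1 - q := by linarith
    positivity
  have hr1 : q * (1 - p) + (1 - q) * p ≤ 1 := by nlinarith
  ext w
  rw [PMF.bind_apply, tsum_fintype]
  simp only [map_add_apply, noise_apply, ← Finset.prod_mul_distrib]
  have hbit : ∀ b : ZMod 2, bern (q * (1 - p) + (1 - q) * p) b =
      ∑ a, bern q a * bern p (b - a) := by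
    intro b
    have e1 : (0 : ZMod 2) - 1 = 1 := by decide
    rw [sum_zmod_two]
    have : b = 0 ∨ b = 1 := by revert b; decide
    rcases this with rfl | rfl
    · rw [sub_zero, e1, bern_one p hp0 hp1, bern_one q hq0 hq1, bern_zero p hp0 hp1,
        bern_zero q hq0 hq1, bern_zero _ hr0 hr1, ← ENNReal.ofReal_mul (by linarith),
        ← ENNReal.ofReal_mul hq0, ← ENNReal.ofReal_add (by nlinarith) (by positivity)]
      congr 1
      ring
    · rw [sub_zero, sub_self, bern_one p hp0 hp1, bern_one q hq0 hq1, bern_zero p hp0 hp1,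
        bern_zero q hq0 hq1, bern_one _ hr0 hr1, ← ENNReal.ofReal_mul (by linarith),
        ← ENNReal.ofReal_mul hq0, ← ENNReal.ofReal_add (by nlinarith) (by nlinarith)]
      congr 1
      ring
  simp only [hbit]
  rw [Finset.prod_univ_sum, Fintype.piFinset_univ]
  rfl

/-- Piling-up lemma: each further summand multiplies `1 - 2·rate` by `1 - 2 * p`. -/
lemma noiseSum_eq_noise {p : ℝ} (hp0 : 0 ≤ p) (hp1 : p ≤ 1 / 2) (m l : ℕ) :
    noiseSum p m l = noise ((1 - (1 - 2 * p) ^ l) / 2) m := by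
  induction l with
  | zero => simp [noiseSum, iterM, noise_zero]
  | succ l ih =>
    have h0 : 0 ≤ (1 - 2 * p) ^ l := pow_nonneg (by linarith) _
    have h1 : (1 - 2 * p) ^ l ≤ 1 := pow_le_one₀ (by linarith) (by linarith)
    rw [noiseSum_succ, ih,
      noise_bind_noise hp0 (by linarith) (by linarith) (by linarith)]
    congr 1
    ring

/-- The comparison holds bit by bit: at `1` it is `h`, and at `0` lowering the rate only increases
the mass. Being multiplicative, it applies to small success probabilities as well. -/
lemma noise_mono {p q θ : ℝ} (hθ0 : 0 ≤ θ) (hθ1 : θ ≤ 1) (hq : q ≤ 1) (hp0 : 0 ≤ p)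
    (hpq : p ≤ q) (h : θ * q ≤ p) (m : ℕ) (e : Fin m → ZMod 2) :
    ENNReal.ofReal θ ^ m * noise q m e ≤ noise p m e := by
  have hbit : ∀ b, ENNReal.ofReal θ * bern q b ≤ bern p b := by
    intro b
    have : b = 0 ∨ b = 1 := by revert b; decide
    rcases this with rfl | rfl
    · rw [bern_zero p hp0 (by linarith), bern_zero q (by linarith) hq, ← ENNReal.ofReal_mul hθ0]
      refine ENNReal.ofReal_le_ofReal ?_
      nlinarith
    · rw [bern_one p hp0 (by linarith), bern_one q (by linarith) hq, ← ENNReal.ofReal_mul hθ0]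
      exact ENNReal.ofReal_le_ofReal h
  have : ENNReal.ofReal θ ^ m = ∏ _i : Fin m, ENNReal.ofReal θ := by simp
  rw [noise_apply, noise_apply, this, ← Finset.prod_mul_distrib]
  exact Finset.prod_le_prod' fun i _ => hbit _

lemma noiseSum_mono {p q θ : ℝ} (hθ0 : 0 ≤ θ) (hθ1 : θ ≤ 1) (hq : q ≤ 1) (hp0 : 0 ≤ p)
    (hpq : p ≤ q) (h : θ * q ≤ p) (m l : ℕ) (e : Fin m → ZMod 2) :
    (ENNReal.ofReal θ ^ m) ^ l * noiseSum q m l e ≤ noiseSum p m l e := by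
  induction l generalizing e with
  | zero => rw [pow_zero, one_mul]; rfl
  | succ l ih =>
    rw [noiseSum_succ, noiseSum_succ, PMF.bind_apply, PMF.bind_apply,
      ← ENNReal.tsum_mul_left]
    refine ENNReal.tsum_le_tsum fun v => ?_
    rw [map_add_apply, map_add_apply]
    calc _ = ((ENNReal.ofReal θ ^ m) ^ l * noiseSum q m l v) *
          (ENNReal.ofReal θ ^ m * noise q m (e - v)) := by ring
      _ ≤ _ := mul_le_mul' (ih v) (noise_mono hθ0 hθ1 hq hp0 hpq h m _)

/-! ### Independent samples -/

section iid

variable {Ω : Type*} [Fintype Ω]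

/-- `k` independent samples. -/
def iid (μ : PMF Ω) (k : ℕ) : PMF (Fin k → Ω) :=
  PMF.ofFintype (fun ω => ∏ i, μ (ω i)) (by
    classical
    rw [← Fintype.piFinset_univ, Finset.sum_prod_piFinset Finset.univ (fun _ a => μ a)]
    have : ∑ a, μ a = 1 := by rw [← tsum_fintype (L := .unconditional Ω), μ.tsum_coe]
    simp [this])

lemma iid_apply (μ : PMF Ω) (k : ℕ) (ω : Fin k → Ω) : iid μ k ω = ∏ i, μ (ω i) := rfl

lemma ex_iid_insertNth (μ : PMF Ω) {k : ℕ} (j : Fin (k + 1)) (F : (Fin (k + 1) → Ω) → ℝ≥0∞) :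
    ex (iid μ (k + 1)) F =
      ex μ fun a => ex (iid μ k) fun ω => F (j.insertNth (α := fun _ => Ω) a ω) := by
  classical
  simp only [ex_eq_sum, Finset.mul_sum, ← Fintype.sum_prod_type']
  refine (Fintype.sum_equiv (Fin.insertNthEquiv (fun _ => Ω) j) _ _ ?_).symm
  rintro ⟨a, ω⟩
  rw [iid_apply, iid_apply, Fin.prod_univ_succAbove _ j]
  simp [Fin.insertNthEquiv, mul_assoc]

/-- Resampling one of the samples. -/
lemma ex_iid_update (μ : PMF Ω) {k : ℕ} (j : Fin k) (G : (Fin k → Ω) → ℝ≥0∞)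
    (h : Ω → ℝ≥0∞) :
    (ex μ fun a => h a * ex (iid μ k) fun ω => G (Function.update ω j a)) =
      ex (iid μ k) fun ω => G ω * h (ω j) := by
  obtain ⟨k, rfl⟩ : ∃ l, k = l + 1 := ⟨k - 1, by have := j.2; omega⟩
  simp only [ex_iid_insertNth μ j, Fin.update_insertNth, ex_const, Fin.insertNth_apply_same]
  congr 1
  funext a
  rw [← ex_const_mul]
  simp only [mul_comm]

/-- If no sample is both exceptional and useful, then `G` has small expectation. -/
lemma ex_iid_le (μ : PMF Ω) {k : ℕ} (G : (Fin k → Ω) → ℝ≥0∞) (hG : ∀ ω, G ω ≤ 1)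
    (B : Set Ω) [DecidablePred (· ∈ B)] (τ : ℝ≥0∞)
    (hB : ∀ a ∈ B, ∑ j, ex (iid μ k) (fun ω => G (Function.update ω j a)) ≤ τ) :
    ex (iid μ k) G ≤ (ex μ fun a => if a ∈ B then 0 else 1) ^ k +
      (ex μ fun a => if a ∈ B then 1 else 0) * τ := by
  classical
  -- Either no sample lies in `B` and the product is `1`, or some position `j` is hit and its
  -- summand is `G ω`.
  have hpt : ∀ ω, G ω ≤ (∏ i, if ω i ∈ B then 0 else 1) +
      ∑ j, G ω * if ω j ∈ B then 1 else 0 := by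
    intro ω
    by_cases h : ∃ j, ω j ∈ B
    · obtain ⟨j, hj⟩ := h
      calc G ω = G ω * if ω j ∈ B then 1 else 0 := by simp [hj]
        _ ≤ ∑ j, G ω * if ω j ∈ B then 1 else 0 :=
            Finset.single_le_sum (f := fun j => G ω * if ω j ∈ B then (1 : ℝ≥0∞) else 0)
              (fun _ _ => zero_le) (Finset.mem_univ j)
        _ ≤ _ := le_add_self
    · push Not at h
      refine le_trans ?_ le_self_add
      simpa [h] using hG ω
  refine (ex_mono fun ω _ => hpt ω).trans ?_
  rw [ex_add]
  refine add_le_add (le_of_eq ?_) ?_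
  · rw [ex_eq_sum, ex_eq_sum]
    simp only [iid_apply, ← Finset.prod_mul_distrib]
    have := Finset.prod_univ_sum (fun _ : Fin k => (Finset.univ : Finset Ω))
      fun _ a => μ a * if a ∈ B then (0 : ℝ≥0∞) else 1
    rw [Fintype.piFinset_univ] at this
    rw [← this]
    simp
  · have h1 : (ex (iid μ k) fun ω => ∑ j, G ω * if ω j ∈ B then 1 else 0) =
        ∑ j, ex (iid μ k) fun ω => G ω * if ω j ∈ B then 1 else 0 := by
      simp only [ex_eq_sum, Finset.mul_sum]
      exact Finset.sum_comm
    rw [h1]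
    -- Resampling position `j` conditions on its value `a`; summed over `j`, this is the quantity
    -- bounded by `hB`.
    simp only [← ex_iid_update μ _ G fun a => if a ∈ B then 1 else 0]
    have h2 : (∑ j : Fin k, ex μ fun a => (if a ∈ B then 1 else 0) *
        ex (iid μ k) fun ω => G (Function.update ω j a)) =
        ex μ fun a => (if a ∈ B then 1 else 0) *
          ∑ j, ex (iid μ k) fun ω => G (Function.update ω j a) := by
      rw [ex_eq_sum]
      simp only [Finset.mul_sum]
      rw [Finset.sum_comm]
      exact Finset.sum_congr rfl fun j _ => ex_eq_sum _ _
    rw [h2, mul_comm, ← ex_const_mul]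
    refine ex_mono fun a _ => ?_
    by_cases ha : a ∈ B
    · simpa [ha] using hB a ha
    · simp [ha]

end iid

/-- Passes from the iterated form, which the program produces, to the independent family used in the
direct product argument. -/
lemma ex_noiseSum (p : ℝ) (m l : ℕ) (f : (Fin m → ZMod 2) → ℝ≥0∞) :
    ex (noiseSum p m l) f = ex (iid (noise p m) l) fun ω => f (∑ i, ω i) := by
  induction l generalizing f with
  | zero =>
    rw [noiseSum, iterM, ex_pure]
    simp [ex_const]
  | succ l ih =>
    rw [noiseSum_succ, ex_bind, ih, ex_iid_insertNth _ (Fin.last l)]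
    simp only [ex_map]
    simp only [ex_eq_sum, Finset.mul_sum]
    rw [Finset.sum_comm]
    refine Finset.sum_congr rfl fun a _ => Finset.sum_congr rfl fun ω _ => ?_
    rw [Fin.sum_univ_succAbove _ (Fin.last l)]
    simp only [Fin.insertNth_apply_same, Fin.insertNth_apply_succAbove]
    rw [add_comm a]
    ring

end LPN

/-! ### Joining samples into one long instance -/

namespace LPN

/-- The randomness of an instance: matrix, secret, noise. -/
abbrev Sample (n m : ℕ) : Type :=
  Matrix (Fin m) (Fin n) (ZMod 2) × (Fin n → ZMod 2) × (Fin m → ZMod 2)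

variable {n m k : ℕ} {η : ℝ}

/-- The instance with the given randomness. -/
def Sample.inst (a : Sample n m) : Inst n m := (a.1, a.1 *ᵥ a.2.1 + a.2.2)

/-- The distribution of the randomness of an instance. -/
def sample (η : ℝ) (n m : ℕ) : PMF (Sample n m) :=
  (PMF.uniformOfFintype (Fin n → ZMod 2)).bind fun s =>
    (PMF.uniformOfFintype (Matrix (Fin m) (Fin n) (ZMod 2))).bind fun A =>
      (noise η m).map fun e => (A, s, e)

lemma lpn_eq_map (η : ℝ) (n m : ℕ) :
    lpn η n m = (sample η n m).map fun a => (a.inst, a.2.1) := by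
  simp only [lpn, sample, PMF.map_bind, PMF.map_comp]
  rfl

lemma successProb_eq (η : ℝ) (S : Solver n m) :
    successProb η S = (ex (sample η n m) fun a => S a.inst a.2.1).toReal := by
  have : ∑ x : Inst n m × (Fin n → ZMod 2), lpn η n m x * S x.1 x.2 =
      ex (lpn η n m) fun x => S x.1 x.2 := (ex_eq_sum _ _).symm
  rw [successProb, this, lpn_eq_map, ex_map]

lemma ex_sample (η : ℝ) (F : Sample n m → ℝ≥0∞) :
    ex (sample η n m) F = ex (PMF.uniformOfFintype (Fin n → ZMod 2)) fun s =>
      ex (PMF.uniformOfFintype (Matrix (Fin m) (Fin n) (ZMod 2))) fun A =>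
        ex (noise η m) fun e => F (A, s, e) := by
  simp only [sample, ex_bind, ex_map]

lemma uniform_vector_apply (n : ℕ) (s : Fin n → ZMod 2) :
    PMF.uniformOfFintype (Fin n → ZMod 2) s = (2 ^ n)⁻¹ := by
  simp [PMF.uniformOfFintype_apply]

lemma uniform_matrix_apply (n m : ℕ) (A : Matrix (Fin m) (Fin n) (ZMod 2)) :
    PMF.uniformOfFintype (Matrix (Fin m) (Fin n) (ZMod 2)) A = (2 ^ (n * m))⁻¹ := by
  have : Fintype.card (Matrix (Fin m) (Fin n) (ZMod 2)) = 2 ^ (n * m) := by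
    have h : Fintype.card (Fin m → Fin n → ZMod 2) = 2 ^ (n * m) := by simp [pow_mul]
    rw [← h]
    exact Fintype.card_congr (Equiv.refl _)
  rw [PMF.uniformOfFintype_apply, this]
  simp

lemma sample_apply (η : ℝ) (a : Sample n m) :
    sample η n m a = (2 ^ n)⁻¹ * (2 ^ (n * m))⁻¹ * noise η m a.2.2 := by
  classical
  rw [← ex_single (sample η n m) a, ex_sample]
  obtain ⟨A, s, e⟩ := a
  simp only [Prod.mk.injEq]
  rw [ex_eq_sum, Finset.sum_eq_single s]
  · rw [ex_eq_sum, Finset.sum_eq_single A]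
    · simp only [true_and]
      rw [ex_single, uniform_matrix_apply, uniform_vector_apply, mul_assoc]
    · intro B _ hB
      simp [hB, ex_const]
    · simp
  · intro t _ ht
    simp [ht, ex_const]
  · simp

/-- Put vectors together, as the blocks of a long vector. -/
def joinVec (v : Fin k → Fin n → ZMod 2) : Fin (n * k) → ZMod 2 := fun c => v c.modNat c.divNat

/-- Put matrices together, as the blocks of a wide matrix. -/
def joinMatrix (M : Fin k → Matrix (Fin m) (Fin n) (ZMod 2)) :
    Matrix (Fin m) (Fin (n * k)) (ZMod 2) := fun i => joinVec fun j => M j i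

lemma modNat_finProdFinEquiv (l : Fin n) (j : Fin k) : (finProdFinEquiv (l, j)).modNat = j :=
  congrArg Prod.snd (finProdFinEquiv.symm_apply_apply (l, j))

lemma divNat_finProdFinEquiv (l : Fin n) (j : Fin k) : (finProdFinEquiv (l, j)).divNat = l :=
  congrArg Prod.fst (finProdFinEquiv.symm_apply_apply (l, j))

lemma finProdFinEquiv_divNat_modNat (c : Fin (n * k)) :
    finProdFinEquiv (c.divNat, c.modNat) = c := finProdFinEquiv.apply_symm_apply c

lemma block_joinVec (v : Fin k → Fin n → ZMod 2) (j : Fin k) : block j (joinVec v) = v j := by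
  funext l
  simp only [block, joinVec, modNat_finProdFinEquiv, divNat_finProdFinEquiv]

lemma joinVec_block (z : Fin (n * k) → ZMod 2) : joinVec (fun j => block j z) = z := by
  funext c
  simp only [block, joinVec, finProdFinEquiv_divNat_modNat]

/-- A family of samples is a wide matrix, a long secret, and a family of noise vectors. -/
def splitSamples (n m k : ℕ) : (Fin k → Sample n m) ≃
    Matrix (Fin m) (Fin (n * k)) (ZMod 2) × (Fin (n * k) → ZMod 2) ×
      (Fin k → Fin m → ZMod 2) where
  toFun ω := (joinMatrix fun j => (ω j).1, joinVec fun j => (ω j).2.1, fun j => (ω j).2.2)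
  invFun x j := (fun i => block j (x.1 i), block j x.2.1, x.2.2 j)
  left_inv ω := by
    funext j
    refine Prod.ext (funext fun i => ?_) (Prod.ext ?_ rfl)
    · exact block_joinVec (fun j => (ω j).1 i) j
    · exact block_joinVec (fun j => (ω j).2.1) j
  right_inv x := by
    refine Prod.ext (funext fun i => ?_) (Prod.ext ?_ rfl)
    · exact joinVec_block (x.1 i)
    · exact joinVec_block x.2.1

/-- Both sides sum over the same data, rearranged by `splitSamples`, and the uniform weights are the
same powers of `2`. -/
lemma ex_iid_sample (η : ℝ) (F : Matrix (Fin m) (Fin (n * k)) (ZMod 2) →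
    (Fin (n * k) → ZMod 2) → (Fin k → Fin m → ZMod 2) → ℝ≥0∞) :
    (ex (iid (sample η n m) k) fun ω => F (joinMatrix fun j => (ω j).1)
      (joinVec fun j => (ω j).2.1) fun j => (ω j).2.2) =
    ex (PMF.uniformOfFintype (Matrix (Fin m) (Fin (n * k)) (ZMod 2))) fun M =>
      ex (PMF.uniformOfFintype (Fin (n * k) → ZMod 2)) fun S =>
        ex (iid (noise η m) k) fun e => F M S e := by
  have h : ∀ ω : Fin k → Sample n m, iid (sample η n m) k ω =
      (2 ^ (n * k * m))⁻¹ * ((2 ^ (n * k))⁻¹ * iid (noise η m) k fun j => (ω j).2.2) := by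
    intro ω
    have e1 : n * k * m = n * m * k := by ring
    simp only [iid_apply, sample_apply, Finset.prod_mul_distrib, Finset.prod_const,
      Finset.card_univ, Fintype.card_fin]
    rw [e1, pow_mul _ (n * m) k, pow_mul _ n k, ENNReal.inv_pow (n := k), ENNReal.inv_pow (n := k)]
    ring
  simp only [ex_eq_sum, uniform_matrix_apply, uniform_vector_apply, h, Finset.mul_sum]
  simp only [← Fintype.sum_prod_type']
  refine Fintype.sum_equiv (splitSamples n m k) _ _ fun ω => ?_
  simp only [splitSamples, Equiv.coe_fn_mk]
  ring

/-- The probability that the oracle finds all secrets, given the samples. -/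
def joinedSuccess (O : Solver (n * k) m) (ω : Fin k → Sample n m) : ℝ≥0∞ :=
  O (joinMatrix fun j => (ω j).1, (joinMatrix fun j => (ω j).1) *ᵥ (joinVec fun j => (ω j).2.1) +
    ∑ j, (ω j).2.2) (joinVec fun j => (ω j).2.1)

lemma joinedSuccess_le_one (O : Solver (n * k) m) (ω : Fin k → Sample n m) :
    joinedSuccess O ω ≤ 1 := PMF.coe_le_one _ _

lemma ex_joinedSuccess (hη0 : 0 ≤ η) (hη1 : η ≤ 1 / 2) (O : Solver (n * k) m) :
    ex (iid (sample η n m) k) (joinedSuccess O) =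
      ex (sample ((1 - (1 - 2 * η) ^ k) / 2) (n * k) m) fun a => O a.inst a.2.1 := by
  have h1 := ex_iid_sample (n := n) η fun (M : Matrix (Fin m) (Fin (n * k)) (ZMod 2)) S
    (e : Fin k → Fin m → ZMod 2) => O (M, M *ᵥ S + ∑ j, e j) S
  refine (show _ = _ from h1).trans ?_
  rw [ex_sample, ← noiseSum_eq_noise hη0 hη1]
  simp only [ex_noiseSum, Sample.inst]
  simp only [ex_eq_sum, Finset.mul_sum]
  rw [Finset.sum_comm]
  refine Finset.sum_congr rfl fun S _ => Finset.sum_congr rfl fun M _ =>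
    Finset.sum_congr rfl fun e _ => ?_
  ring

lemma joinVec_update (ω : Fin k → Fin n → ZMod 2) (j : Fin k) (v : Fin n → ZMod 2) :
    joinVec (Function.update ω j v) = setBlock j v (joinVec ω) := by
  funext c
  simp only [joinVec, setBlock, Function.update_apply]
  split_ifs <;> rfl

lemma block_setBlock (j : Fin k) (v : Fin n → ZMod 2) (S : Fin (n * k) → ZMod 2) :
    block j (setBlock j v S) = v := by
  funext l
  simp [block, setBlock, modNat_finProdFinEquiv, divNat_finProdFinEquiv]

/-- Isolates the contribution of the unknown `s`, which the reduction has at its disposal only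
through the response. -/
lemma setBlockMatrix_mulVec_setBlock (j : Fin k) (A : Matrix (Fin m) (Fin n) (ZMod 2))
    (M : Matrix (Fin m) (Fin (n * k)) (ZMod 2)) (s : Fin n → ZMod 2)
    (S : Fin (n * k) → ZMod 2) :
    setBlockMatrix j A M *ᵥ setBlock j s S =
      setBlockMatrix j A M *ᵥ setBlock j 0 S + A *ᵥ s := by
  have h : setBlock j s S = setBlock j 0 S + setBlock j s 0 := by
    funext c
    simp only [setBlock, Pi.add_apply]
    split_ifs <;> simp
  rw [h, Matrix.mulVec_add]
  congr 1
  funext i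
  simp only [Matrix.mulVec, dotProduct]
  rw [← finProdFinEquiv.sum_comp, Fintype.sum_prod_type]
  refine Finset.sum_congr rfl fun l _ => ?_
  rw [Finset.sum_eq_single j]
  · simp [setBlockMatrix, setBlock, modNat_finProdFinEquiv, divNat_finProdFinEquiv]
  · intro j' _ hj'
    simp [setBlock, modNat_finProdFinEquiv, hj']
  · simp

/-- The candidates are at least as good as the answers to the ideal queries, up to a factor for
the cut off noise rate. -/
lemma ex_joinedSuccess_update_le {p θ : ℝ} (hθ0 : 0 ≤ θ) (hθ1 : θ ≤ 1) (hη : η ≤ 1)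
    (hp0 : 0 ≤ p) (hpη : p ≤ η) (h : θ * η ≤ p) (O : Solver (n * k) m) (j : Fin k)
    (a : Sample n m) :
    (ENNReal.ofReal θ ^ m) ^ (k - 1) *
      (ex (iid (sample η n m) k) fun ω => joinedSuccess O (Function.update ω j a)) ≤
      candidate O a.inst p j a.2.1 := by
  classical
  obtain ⟨k, rfl⟩ : ∃ l, k = l + 1 := ⟨k - 1, by have := j.2; omega⟩
  obtain ⟨A, s, e⟩ := a
  have h1 := ex_iid_sample (n := n) η fun (M : Matrix (Fin m) (Fin (n * (k + 1))) (ZMod 2)) S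
    (es : Fin (k + 1) → Fin m → ZMod 2) =>
      O (setBlockMatrix j A M, setBlockMatrix j A M *ᵥ setBlock j s S +
        ∑ i, Function.update es j e i) (setBlock j s S)
  have h2 : ∀ ω : Fin (k + 1) → Sample n m,
      joinedSuccess O (Function.update ω j (A, s, e)) =
      O (setBlockMatrix j A (joinMatrix fun j => (ω j).1),
        setBlockMatrix j A (joinMatrix fun j => (ω j).1) *ᵥ
          setBlock j s (joinVec fun j => (ω j).2.1) +
        ∑ i, Function.update (fun j => (ω j).2.2) j e i)
        (setBlock j s (joinVec fun j => (ω j).2.1)) := by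
    intro ω
    have e1 : (fun i => (Function.update ω j (A, s, e) i).1) =
        Function.update (fun j => (ω j).1) j A := by
      funext i
      by_cases hi : i = j
      · subst hi; simp
      · simp [hi]
    have e2 : (fun i => (Function.update ω j (A, s, e) i).2.1) =
        Function.update (fun j => (ω j).2.1) j s := by
      funext i
      by_cases hi : i = j
      · subst hi; simp
      · simp [hi]
    have e3 : (fun i => (Function.update ω j (A, s, e) i).2.2) =
        Function.update (fun j => (ω j).2.2) j e := by
      funext i
      by_cases hi : i = j
      · subst hi; simp
      · simp [hi]
    have e4 : joinMatrix (Function.update (fun j => (ω j).1) j A) =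
        setBlockMatrix j A (joinMatrix fun j => (ω j).1) := by
      funext i
      rw [setBlockMatrix, joinMatrix, joinMatrix, ← joinVec_update]
      congr 1
      funext i'
      by_cases hi : i' = j
      · subst hi; simp
      · simp [hi]
    rw [joinedSuccess, e1, e2, joinVec_update, e4]
    congr 5
  simp only [h2]
  rw [h1]
  rw [← ex_single (candidate O (Sample.inst (A, s, e)) p j), candidate, ex_bind, ← ex_const_mul]
  refine ex_mono fun M _ => ?_
  rw [ex_bind, ← ex_const_mul]
  refine ex_mono fun S _ => ?_
  -- The noise drawn for block `j` is overwritten by `e`, so only the other noise vectors remain;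
  -- these are the ones the reduction draws itself.
  rw [ex_bind, ex_iid_insertNth _ j]
  have h3 : ∀ (b : Fin m → ZMod 2) (es : Fin k → Fin m → ZMod 2),
      ∑ i, Function.update (j.insertNth (α := fun _ => Fin m → ZMod 2) b es) j e i =
        e + ∑ i, es i := by
    intro b es
    rw [Fin.update_insertNth, Fin.sum_univ_succAbove _ j]
    simp
  simp only [h3, ex_const]
  rw [← ex_noiseSum η m k fun v => O (setBlockMatrix j A M,
    setBlockMatrix j A M *ᵥ setBlock j s S + (e + v)) (setBlock j s S)]
  rw [ex_eq_sum, ex_eq_sum, Finset.mul_sum]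
  refine Finset.sum_le_sum fun v _ => ?_
  rw [← mul_assoc, Nat.add_sub_cancel]
  refine mul_le_mul' (noiseSum_mono hθ0 hθ1 hη hp0 hpη h m k v) ?_
  rw [ex_map]
  have h4 : (setBlockMatrix j A M *ᵥ setBlock j 0 S + v + (A *ᵥ s + e)) =
      setBlockMatrix j A M *ᵥ setBlock j s S + (e + v) := by
    rw [setBlockMatrix_mulVec_setBlock j A M s S]
    abel
  simp only [Sample.inst]
  rw [h4, ← ex_single (O _) (setBlock j s S)]
  refine ex_mono fun z _ => ?_
  -- If the oracle finds the entire long secret, then in particular block `j` of its answer is `s`.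
  by_cases hz : z = setBlock j s S
  · simp [hz, block_setBlock]
  · simp [hz]

end LPN

namespace LPN

/-! ### The secret is the strict minimizer of the weight -/

variable {n m : ℕ} {η : ℝ}

/-- The Hamming weight. -/
def ham (v : Fin m → ZMod 2) : ℕ := ∑ i, (v i).val

/-- The generating function of the Hamming weight; both tail bounds below follow from it by Markov's
inequality. -/
lemma ex_noise_pow {p t : ℝ} (hp0 : 0 ≤ p) (hp1 : p ≤ 1) (ht : 0 ≤ t) (m : ℕ) :
    (ex (noise p m) fun v => ENNReal.ofReal (t ^ ham v)) = ENNReal.ofReal ((1 - p + p * t) ^ m) := by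
  classical
  have h1 : ∀ v : Fin m → ZMod 2, noise p m v * ENNReal.ofReal (t ^ ham v) =
      ∏ i, bern p (v i) * ENNReal.ofReal (t ^ (v i).val) := by
    intro v
    rw [noise_apply, ham, Finset.prod_mul_distrib, ← Finset.prod_pow_eq_pow_sum,
      ENNReal.ofReal_prod_of_nonneg fun i _ => by positivity]
  have h2 : ∑ a, bern p a * ENNReal.ofReal (t ^ a.val) = ENNReal.ofReal (1 - p + p * t) := by
    rw [sum_zmod_two, bern_zero p hp0 hp1, bern_one p hp0 hp1, ← ENNReal.ofReal_mul (by linarith),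
      ← ENNReal.ofReal_mul hp0, ← ENNReal.ofReal_add (by simpa using hp1) (by positivity)]
    simp [ZMod.val_one]
  rw [ex_eq_sum]
  simp only [h1]
  have h3 := Finset.prod_univ_sum (fun _ : Fin m => (Finset.univ : Finset (ZMod 2)))
    fun _ a => bern p a * ENNReal.ofReal (t ^ a.val)
  rw [Fintype.piFinset_univ] at h3
  rw [← h3, h2, Finset.prod_const, Finset.card_univ, Fintype.card_fin,
    ENNReal.ofReal_pow (by nlinarith [mul_nonneg hp0 ht])]

/-- Upper tail of the weight of a noise vector. -/
lemma ex_noise_tail (hη0 : 0 ≤ η) (hη1 : η ≤ 1) (m : ℕ) :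
    (ex (noise η m) fun e => if 2 * η * m ≤ ham e then 1 else 0) ≤
      ENNReal.ofReal (Real.exp (-(η * m / 3))) := by
  have h1 : ∀ e : Fin m → ZMod 2, (if 2 * η * m ≤ ham e then 1 else 0 : ℝ≥0∞) ≤
      ENNReal.ofReal ((2 : ℝ) ^ (-(2 * η * m))) * ENNReal.ofReal (2 ^ ham e) := by
    intro e
    split_ifs with h
    · rw [← ENNReal.ofReal_mul (by positivity), ← ENNReal.ofReal_one, ← Real.rpow_natCast,
        ← Real.rpow_add (by norm_num)]
      exact ENNReal.ofReal_le_ofReal (Real.one_le_rpow (by norm_num) (by linarith))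
    · exact zero_le
  refine (ex_mono fun e _ => h1 e).trans ?_
  rw [ex_const_mul, ex_noise_pow hη0 hη1 (by norm_num), ← ENNReal.ofReal_mul (by positivity)]
  refine ENNReal.ofReal_le_ofReal ?_
  have h2 : (1 - η + η * 2) ^ m ≤ Real.exp (η * m) := by
    have := Real.add_one_le_exp η
    calc (1 - η + η * 2) ^ m ≤ Real.exp η ^ m := by
          gcongr
          linarith
      _ = Real.exp (η * m) := by rw [← Real.exp_nat_mul, mul_comm]
  have h3 : (2 : ℝ) ^ (-(2 * η * m)) = Real.exp (-(2 * η * m) * Real.log 2) := by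
    rw [Real.rpow_def_of_pos (by norm_num), mul_comm]
  -- The exponent is `η m (1 - 2 log 2)`, and `1 - 2 log 2 < -1/3`.
  have hlog := Real.log_two_gt_d9
  calc _ ≤ Real.exp (-(2 * η * m) * Real.log 2) * Real.exp (η * m) := by
        rw [h3]
        gcongr
    _ = Real.exp (-(2 * η * m) * Real.log 2 + η * m) := by rw [Real.exp_add]
    _ ≤ _ := by
        apply Real.exp_le_exp.2
        have : 0 ≤ η * m := by positivity
        nlinarith

lemma noise_half (m : ℕ) : noise (1 / 2) m = PMF.uniformOfFintype (Fin m → ZMod 2) := by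
  ext v
  have h : ∀ a, bern (1 / 2) a = 2⁻¹ := by
    intro a
    have e : ENNReal.ofReal (1 / 2) = 2⁻¹ := by
      rw [one_div, ENNReal.ofReal_inv_of_pos (by norm_num)]
      simp
    have : a = 0 ∨ a = 1 := by revert a; decide
    rcases this with rfl | rfl
    · rw [bern_zero _ (by norm_num) (by norm_num), ← e]
      norm_num
    · rw [bern_one _ (by norm_num) (by norm_num), e]
  rw [noise_apply, uniform_vector_apply]
  simp only [h, Finset.prod_const, Finset.card_univ, Fintype.card_fin, ENNReal.inv_pow]

/-- The volume of a Hamming ball. -/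
lemma ex_uniform_ball {ρ : ℝ} (h0 : 0 < ρ) (h1 : ρ ≤ 1 / 2) (m : ℕ) :
    (ex (PMF.uniformOfFintype (Fin m → ZMod 2)) fun v => if (ham v : ℝ) ≤ ρ * m then 1 else 0) ≤
      ENNReal.ofReal (Real.exp (m * (Real.binEntropy ρ - Real.log 2))) := by
  -- The optimal Chernoff parameter, for which the exponent is exactly the entropy. It is at most
  -- `1` because `ρ ≤ 1/2`, as a lower tail requires.
  set t := ρ / (1 - ρ) with ht
  have hρ : 0 < 1 - ρ := by linarith
  have ht0 : 0 < t := by positivity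
  have ht1 : t ≤ 1 := by
    rw [ht, div_le_one hρ]
    linarith
  have hpt : ∀ v : Fin m → ZMod 2, (if (ham v : ℝ) ≤ ρ * m then 1 else 0 : ℝ≥0∞) ≤
      ENNReal.ofReal (t ^ (-(ρ * m))) * ENNReal.ofReal (t ^ ham v) := by
    intro e
    split_ifs with h
    · rw [← ENNReal.ofReal_mul (by positivity), ← ENNReal.ofReal_one, ← Real.rpow_natCast,
        ← Real.rpow_add ht0]
      exact ENNReal.ofReal_le_ofReal
        (Real.one_le_rpow_of_pos_of_le_one_of_nonpos ht0 ht1 (by linarith))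
    · exact zero_le
  refine (ex_mono fun e _ => hpt e).trans ?_
  rw [ex_const_mul, ← noise_half, ex_noise_pow (by norm_num) (by norm_num) ht0.le,
    ← ENNReal.ofReal_mul (by positivity)]
  refine ENNReal.ofReal_le_ofReal (le_of_eq ?_)
  have e1 : (1 : ℝ) - 1 / 2 + 1 / 2 * t = 1 / (2 * (1 - ρ)) := by
    rw [ht]
    field_simp
    ring
  rw [e1, Real.rpow_def_of_pos ht0, ← Real.exp_log (show (0 : ℝ) < 1 / (2 * (1 - ρ)) by positivity),
    ← Real.exp_nat_mul, ← Real.exp_add]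
  congr 1
  rw [ht, Real.log_div h0.ne' hρ.ne', one_div, Real.log_inv, Real.log_mul (by norm_num) hρ.ne',
    Real.binEntropy, Real.log_inv, Real.log_inv]
  ring

lemma ex_uniform_equiv {α : Type*} [Fintype α] [Nonempty α] (σ : α ≃ α) (f : α → ℝ≥0∞) :
    (ex (PMF.uniformOfFintype α) fun a => f (σ a)) = ex (PMF.uniformOfFintype α) f := by
  simp only [ex_eq_sum, PMF.uniformOfFintype_apply]
  exact σ.sum_comp fun a => _ * f a

/-- The image of a nonzero vector under a uniform matrix is uniform. -/
lemma ex_uniform_mulVec {d : Fin n → ZMod 2} (hd : d ≠ 0) (f : (Fin m → ZMod 2) → ℝ≥0∞) :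
    (ex (PMF.uniformOfFintype (Matrix (Fin m) (Fin n) (ZMod 2))) fun A => f (A *ᵥ d)) =
      ex (PMF.uniformOfFintype (Fin m → ZMod 2)) f := by
  obtain ⟨l, hl⟩ := Function.ne_iff.1 hd
  have hl1 : d l = 1 := by
    have := hl
    simp only [Pi.zero_apply] at this
    generalize d l = a at this
    revert a
    decide
  -- Adding `v` to column `l` of `A` preserves the uniform distribution and shifts `A *ᵥ d` by `v`,
  -- since `d l = 1`. Averaging over `v` then gives a uniform image.
  have hshift : ∀ v : Fin m → ZMod 2,
      (ex (PMF.uniformOfFintype (Matrix (Fin m) (Fin n) (ZMod 2))) fun A => f (A *ᵥ d)) =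
      ex (PMF.uniformOfFintype (Matrix (Fin m) (Fin n) (ZMod 2))) fun A => f (A *ᵥ d + v) := by
    intro v
    rw [← ex_uniform_equiv (Equiv.addRight (Matrix.of fun i l' => if l' = l then v i else 0))
      fun A : Matrix (Fin m) (Fin n) (ZMod 2) => f (A *ᵥ d)]
    congr 1
    funext A
    congr 1
    rw [Equiv.coe_addRight, Matrix.add_mulVec]
    congr 1
    funext i
    simp [Matrix.mulVec, dotProduct, hl1]
  calc _ = ex (PMF.uniformOfFintype (Fin m → ZMod 2)) fun v =>
        ex (PMF.uniformOfFintype (Matrix (Fin m) (Fin n) (ZMod 2))) fun A => f (A *ᵥ d + v) := by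
        simp only [← hshift, ex_const]
    _ = ex (PMF.uniformOfFintype (Matrix (Fin m) (Fin n) (ZMod 2))) fun A =>
        ex (PMF.uniformOfFintype (Fin m → ZMod 2)) fun v => f (A *ᵥ d + v) := by
        simp only [ex_eq_sum, Finset.mul_sum]
        rw [Finset.sum_comm]
        exact Finset.sum_congr rfl fun _ _ => Finset.sum_congr rfl fun _ _ => by ring
    _ = _ := by
        have : ∀ A : Matrix (Fin m) (Fin n) (ZMod 2),
            (ex (PMF.uniformOfFintype (Fin m → ZMod 2)) fun v => f (A *ᵥ d + v)) =
            ex (PMF.uniformOfFintype (Fin m → ZMod 2)) f :=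
          fun A => ex_uniform_equiv (Equiv.addLeft (A *ᵥ d)) f
        simp only [this, ex_const]

/-- The secret violates fewer samples than any other candidate. -/
def Sample.Decodable (a : Sample n m) : Prop :=
  ∀ y, y ≠ a.2.1 → weight a.inst a.2.1 < weight a.inst y

lemma weight_inst (a : Sample n m) (y : Fin n → ZMod 2) :
    weight a.inst y = ham (a.1 *ᵥ (y - a.2.1) + a.2.2) := by
  have h : a.1 *ᵥ y + (a.1 *ᵥ a.2.1 + a.2.2) = a.1 *ᵥ (y - a.2.1) + a.2.2 := by
    have : ∀ v : Fin n → ZMod 2, y - v = y + v := fun v => funext fun i => CharTwo.sub_eq_add _ _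
    rw [this, Matrix.mulVec_add, add_assoc]
  rw [weight, ham, Sample.inst, h]

instance : DecidablePred (Sample.Decodable (n := n) (m := m)) := Classical.decPred _

/-- A rival of the secret forces either heavy noise or a nonzero `d` with `A d + e` in a ball of
radius `4ηm`. By `hm` the latter has probability at most `2^(-2n)` for each `d`, which leaves
`2^(-n)` after the union bound over all `d`. -/
lemma ex_not_decodable_le (hη0 : 0 < η) (hη1 : η ≤ 1 / 8)
    (hm : 2 * n * Real.log 2 ≤ m * (Real.log 2 - Real.binEntropy (4 * η))) :
    (ex (sample η n m) fun a => if a.Decodable then 0 else 1) ≤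
      ENNReal.ofReal (((2 : ℝ) ^ n)⁻¹ + Real.exp (-(η * m / 3))) := by
  have hpt : ∀ a : Sample n m, (if a.Decodable then 0 else 1 : ℝ≥0∞) ≤
      (if 2 * η * m ≤ ham a.2.2 then 1 else 0) +
      ∑ d : Fin n → ZMod 2, if d ≠ 0 ∧ (ham (a.1 *ᵥ d + a.2.2) : ℝ) ≤ 4 * η * m then 1 else 0 := by
    intro a
    by_cases h1 : a.Decodable
    · simp [h1]
    by_cases h2 : 2 * η * m ≤ ham a.2.2
    · simp [h1, h2]
    · rw [if_neg h1, if_neg h2, zero_add]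
      unfold Sample.Decodable at h1
      push Not at h1
      obtain ⟨y, hy, hle⟩ := h1
      rw [weight_inst, weight_inst, sub_self, Matrix.mulVec_zero, zero_add] at hle
      have h3 : (ham (a.1 *ᵥ (y - a.2.1) + a.2.2) : ℝ) ≤ ham a.2.2 := by exact_mod_cast hle
      have h4 : 0 ≤ η * m := by positivity
      push Not at h2
      refine le_trans ?_ (Finset.single_le_sum (f := fun d : Fin n → ZMod 2 =>
        if d ≠ 0 ∧ (ham (a.1 *ᵥ d + a.2.2) : ℝ) ≤ 4 * η * m then (1 : ℝ≥0∞) else 0)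
        (fun _ _ => zero_le) (Finset.mem_univ (y - a.2.1)))
      rw [if_pos ⟨sub_ne_zero.2 hy, by linarith⟩]
  refine (ex_mono fun a _ => hpt a).trans ?_
  rw [ex_add, add_comm, ENNReal.ofReal_add (by positivity) (by positivity)]
  refine add_le_add ?_ ?_
  · have h1 : (ex (sample η n m) fun a => ∑ d : Fin n → ZMod 2,
        if d ≠ 0 ∧ (ham (a.1 *ᵥ d + a.2.2) : ℝ) ≤ 4 * η * m then (1 : ℝ≥0∞) else 0) =
        ∑ d : Fin n → ZMod 2, ex (sample η n m) fun a =>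
          if d ≠ 0 ∧ (ham (a.1 *ᵥ d + a.2.2) : ℝ) ≤ 4 * η * m then 1 else 0 := by
      simp only [ex_eq_sum, Finset.mul_sum]
      exact Finset.sum_comm
    have h2 : ∀ d : Fin n → ZMod 2, (ex (sample η n m) fun a =>
        if d ≠ 0 ∧ (ham (a.1 *ᵥ d + a.2.2) : ℝ) ≤ 4 * η * m then 1 else 0) ≤
        ENNReal.ofReal (((2 : ℝ) ^ n)⁻¹ * ((2 : ℝ) ^ n)⁻¹) := by
      intro d
      by_cases hd : d = 0
      · simp [hd, ex_const]
      · have h3 : ∀ e : Fin m → ZMod 2,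
            (ex (PMF.uniformOfFintype (Matrix (Fin m) (Fin n) (ZMod 2))) fun A =>
              if d ≠ 0 ∧ (ham (A *ᵥ d + e) : ℝ) ≤ 4 * η * m then (1 : ℝ≥0∞) else 0) ≤
            ENNReal.ofReal (((2 : ℝ) ^ n)⁻¹ * ((2 : ℝ) ^ n)⁻¹) := by
          intro e
          simp only [ne_eq, hd, not_false_eq_true, true_and]
          rw [ex_uniform_mulVec hd fun v => if (ham (v + e) : ℝ) ≤ 4 * η * m then (1 : ℝ≥0∞) else 0]
          refine (ex_uniform_equiv (Equiv.addRight e) fun v =>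
              if (ham v : ℝ) ≤ 4 * η * m then (1 : ℝ≥0∞) else 0).le.trans ?_
          refine (ex_uniform_ball (by linarith) (by linarith) m).trans
            (ENNReal.ofReal_le_ofReal ?_)
          have e1 : ((2 : ℝ) ^ n)⁻¹ * ((2 : ℝ) ^ n)⁻¹ = Real.exp (-(2 * n * Real.log 2)) := by
            rw [← mul_inv, ← pow_add, Real.exp_neg,
              show (2 * n * Real.log 2 : ℝ) = ((n + n : ℕ) : ℝ) * Real.log 2 by push_cast; ring,
              Real.exp_nat_mul, Real.exp_log (by norm_num)]
          rw [e1]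
          apply Real.exp_le_exp.2
          linarith
        rw [ex_sample]
        have h4 : ∀ s : Fin n → ZMod 2,
            (ex (PMF.uniformOfFintype (Matrix (Fin m) (Fin n) (ZMod 2))) fun A =>
              ex (noise η m) fun e =>
              if d ≠ 0 ∧ (ham (A *ᵥ d + e) : ℝ) ≤ 4 * η * m then (1 : ℝ≥0∞) else 0) =
            ex (noise η m) fun e =>
              ex (PMF.uniformOfFintype (Matrix (Fin m) (Fin n) (ZMod 2))) fun A =>
              if d ≠ 0 ∧ (ham (A *ᵥ d + e) : ℝ) ≤ 4 * η * m then (1 : ℝ≥0∞) else 0 := by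
          intro s
          simp only [ex_eq_sum, Finset.mul_sum]
          rw [Finset.sum_comm]
          exact Finset.sum_congr rfl fun _ _ => Finset.sum_congr rfl fun _ _ => by ring
        refine (ex_mono fun s _ => (h4 s).le.trans (ex_mono fun e _ => h3 e)).trans ?_
        rw [ex_const, ex_const]
    rw [h1]
    refine (Finset.sum_le_sum fun d _ => h2 d).trans (le_of_eq ?_)
    rw [Finset.sum_const, Finset.card_univ, nsmul_eq_mul]
    have e2 : ((Fintype.card (Fin n → ZMod 2) : ℕ) : ℝ≥0∞) = ENNReal.ofReal (2 ^ n) := by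
      rw [ENNReal.ofReal_pow (by norm_num)]
      simp
    rw [e2, ← ENNReal.ofReal_mul (by positivity)]
    congr 1
    field_simp
  · rw [ex_sample]
    refine (ex_mono fun s _ => ex_mono fun A _ => ex_noise_tail hη0.le (by linarith) m).trans ?_
    rw [ex_const, ex_const]

end LPN

namespace LPN

/-! ### Success probability -/

section Success

variable {n m k : ℕ} {ε δ η : ℝ}

lemma truncate_nonneg (T : ℕ) (η : ℝ) : 0 ≤ truncate T η := by
  unfold truncate
  positivity

lemma truncate_le (T : ℕ) (hη : 0 ≤ η) : truncate T η ≤ η := by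
  rw [truncate, div_le_iff₀ (by positivity), mul_comm]
  exact Nat.floor_le (by positivity)

lemma sub_le_truncate (T : ℕ) (η : ℝ) : η - (2 ^ T)⁻¹ ≤ truncate T η := by
  rw [truncate, le_div_iff₀ (by positivity)]
  have h := Nat.sub_one_lt_floor ((2 : ℝ) ^ T * η)
  have : (η - (2 ^ T)⁻¹) * 2 ^ T = 2 ^ T * η - 1 := by
    field_simp
  linarith

/-- Cutting off the noise rate costs at most a factor `2`. -/
lemma half_ex_joinedSuccess_le (hm : 0 < m) (hk : (k : ℝ) ≤ 2 ^ m) (hη : 6 ≤ η * m) (hη1 : η ≤ 1)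
    (O : Solver (n * k) m) (j : Fin k) (a : Sample n m) :
    ENNReal.ofReal (1 / 2) *
      (ex (iid (sample η n m) k) fun ω => joinedSuccess O (Function.update ω j a)) ≤
      candidate O a.inst (truncate (4 * m) η) j a.2.1 := by
  have hm' : (0 : ℝ) < m := by exact_mod_cast hm
  have hη0 : 0 < η := by
    by_contra h
    nlinarith
  -- Chosen so that `θ * η = η - 2^(-4m)`, which the truncated rate is at least.
  set θ := 1 - (2 ^ (4 * m))⁻¹ / η with hθ
  have h2m : (m : ℝ) ≤ 2 ^ m := by exact_mod_cast Nat.lt_two_pow_self.le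
  have h1 : (1 : ℝ) ≤ 2 ^ m := one_le_pow₀ (by norm_num)
  have hpow : (2 : ℝ) ^ (4 * m) = 2 ^ m * 2 ^ m * 2 ^ m * 2 ^ m := by ring
  -- Two of the four factors `2 ^ m` absorb `m` and `k`; the other two, times `η`, are at least `6`.
  have hsmall : m * k * ((2 ^ (4 * m))⁻¹ / η) ≤ 1 / 2 := by
    rw [div_eq_mul_inv, ← mul_inv, ← div_eq_mul_inv, div_le_iff₀ (by positivity), hpow]
    have e1 : (m : ℝ) * k ≤ 2 ^ m * 2 ^ m := mul_le_mul h2m hk (by positivity) (by positivity)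
    have e2 : 6 ≤ 2 ^ m * 2 ^ m * η := by nlinarith
    have e3 : (2 : ℝ) ^ m * 2 ^ m * 6 ≤ 2 ^ m * 2 ^ m * (2 ^ m * 2 ^ m * η) := by gcongr
    nlinarith [mul_pos (show (0 : ℝ) < 2 ^ m by positivity) (show (0 : ℝ) < 2 ^ m by positivity)]
  have hj : (1 : ℝ) ≤ k := by
    have := j.2
    exact_mod_cast (by omega : 1 ≤ k)
  have hq0 : 0 ≤ (2 ^ (4 * m))⁻¹ / η := by positivity
  have hm1 : (1 : ℝ) ≤ m := by exact_mod_cast hm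
  have hq1 : (2 ^ (4 * m))⁻¹ / η ≤ 1 / 2 := by
    refine le_trans ?_ hsmall
    have : (1 : ℝ) ≤ m * k := by nlinarith
    nlinarith
  have hθ0 : 0 ≤ θ := by linarith
  have hθ1 : θ ≤ 1 := by linarith
  have hθη : θ * η ≤ truncate (4 * m) η := by
    refine le_trans (le_of_eq ?_) (sub_le_truncate _ _)
    rw [hθ]
    field_simp
  refine le_trans ?_ (ex_joinedSuccess_update_le hθ0 hθ1 hη1 (truncate_nonneg _ _)
    (truncate_le _ hη0.le) hθη O j a)
  refine mul_le_mul' ?_ le_rfl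
  rw [← pow_mul, ← ENNReal.ofReal_pow hθ0]
  refine ENNReal.ofReal_le_ofReal ?_
  have hb := one_add_mul_le_pow (a := -((2 ^ (4 * m))⁻¹ / η)) (by linarith) (m * (k - 1))
  have hle : ((m * (k - 1) : ℕ) : ℝ) ≤ m * k := by
    exact_mod_cast Nat.mul_le_mul_left m (Nat.sub_le k 1)
  rw [← sub_eq_add_neg, ← hθ] at hb
  refine le_trans ?_ hb
  have := mul_le_mul_of_nonneg_right hle hq0
  linarith

/-- By `1 - x ≤ exp (-x)`, a bound on the sum of the success probabilities suffices; no single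
position has to be good. -/
lemma prod_one_sub_le {ι : Type*} [Fintype ι] (p q : ι → ℝ≥0∞) (hp : ∀ j, p j ≤ 1)
    (hpq : ∀ j, ENNReal.ofReal (1 / 2) * p j ≤ q j) {τ : ℝ} (hτ : ENNReal.ofReal τ ≤ ∑ j, p j) :
    ∏ j, (1 - q j) ≤ ENNReal.ofReal (Real.exp (-(τ / 2))) := by
  have hfin : ∀ j, p j ≠ ∞ := fun j => ne_top_of_le_ne_top ENNReal.one_ne_top (hp j)
  have h1 : ∀ j, 1 - q j ≤ ENNReal.ofReal (Real.exp (-((p j).toReal / 2))) := by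
    intro j
    refine (tsub_le_tsub_left (hpq j) 1).trans ?_
    have e : ENNReal.ofReal (1 / 2) * p j = ENNReal.ofReal ((p j).toReal / 2) := by
      conv_lhs => rw [← ENNReal.ofReal_toReal (hfin j)]
      rw [← ENNReal.ofReal_mul (by norm_num)]
      congr 1
      ring
    rw [e, ← ENNReal.ofReal_one, ← ENNReal.ofReal_sub _ (by positivity)]
    refine ENNReal.ofReal_le_ofReal ?_
    have := Real.add_one_le_exp (-((p j).toReal / 2))
    linarith
  refine (Finset.prod_le_prod' fun j _ => h1 j).trans ?_
  rw [← ENNReal.ofReal_prod_of_nonneg fun j _ => (Real.exp_pos _).le, ← Real.exp_sum]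
  refine ENNReal.ofReal_le_ofReal (Real.exp_le_exp.2 ?_)
  have h2 : τ ≤ ∑ j, (p j).toReal := by
    rw [← ENNReal.toReal_sum fun j _ => hfin j]
    exact (ENNReal.ofReal_le_iff_le_toReal (ENNReal.sum_ne_top.2 fun j _ => hfin j)).1 hτ
  rw [Finset.sum_neg_distrib, ← Finset.sum_div]
  linarith

lemma ex_le_one {α : Type*} {ν : PMF α} {f : α → ℝ≥0∞} (hf : ∀ a, f a ≤ 1) : ex ν f ≤ 1 :=
  (ex_mono fun a _ => hf a).trans (ex_const ν 1).le

/-- The samples for which the oracle is of little use are rare. -/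
lemma exceptional_lt {Ω : Type*} [Fintype Ω] (μ : PMF Ω) (G : (Fin k → Ω) → ℝ≥0∞)
    (hG : ∀ ω, G ω ≤ 1) (hε : 0 < ε) (hδ : 0 < δ) (hk : 192 / δ * Real.log (8 / ε) < k)
    (hGε : ENNReal.ofReal ε ≤ ex (iid μ k) G) (B : Set Ω) [DecidablePred (· ∈ B)]
    (hB : ∀ a ∈ B, ∑ j, ex (iid μ k) (fun ω => G (Function.update ω j a)) ≤
      ENNReal.ofReal (ε / 2)) :
    (ex μ fun a => if a ∈ B then 1 else 0) < ENNReal.ofReal (δ / 2) := by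
  have hε1 : ε ≤ 1 := ENNReal.ofReal_le_one.1 (hGε.trans (ex_le_one hG))
  by_contra hcon
  push Not at hcon
  set β := ex μ fun a => if a ∈ B then 1 else 0 with hβ
  have hβ1 : β ≤ 1 := ex_le_one fun a => by split_ifs <;> simp
  have hβt : β ≠ ∞ := ne_top_of_le_ne_top ENNReal.one_ne_top hβ1
  have hsum : (ex μ fun a => if a ∈ B then 0 else 1) + β = 1 := by
    rw [hβ, ← ex_add]
    refine Eq.trans ?_ (ex_const μ 1)
    congr 1
    funext a
    split_ifs <;> simp
  obtain ⟨b, hb0, hbβ⟩ : ∃ b : ℝ, 0 ≤ b ∧ β = ENNReal.ofReal b :=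
    ⟨β.toReal, ENNReal.toReal_nonneg, (ENNReal.ofReal_toReal hβt).symm⟩
  have hb1 : b ≤ 1 := by
    rw [hbβ] at hβ1
    exact ENNReal.ofReal_le_one.1 hβ1
  have hcompl : (ex μ fun a => if a ∈ B then 0 else 1) = ENNReal.ofReal (1 - b) := by
    rw [ENNReal.eq_sub_of_add_eq hβt hsum, hbβ, ENNReal.ofReal_sub _ hb0, ENNReal.ofReal_one]
  have hmain := hGε.trans (ex_iid_le μ G hG B _ hB)
  rw [← hβ, hcompl, hbβ, ← ENNReal.ofReal_pow (by linarith), ← ENNReal.ofReal_mul hb0,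
    ← ENNReal.ofReal_add (by have : 0 ≤ 1 - b := by linarith
                             positivity) (by positivity)] at hmain
  rw [hbβ] at hcon
  have hδb : δ / 2 ≤ b := (ENNReal.ofReal_le_ofReal_iff hb0).1 hcon
  have h2b : 0 ≤ 1 - b := by linarith
  have hmain' : ε ≤ (1 - b) ^ k + b * (ε / 2) :=
    (ENNReal.ofReal_le_ofReal_iff (by positivity)).1 hmain
  have hlog : 0 ≤ Real.log (8 / ε) := Real.log_nonneg (by rw [le_div_iff₀ hε]; linarith)
  have hexp : (1 - b) ^ k ≤ ε / 8 := by
    calc (1 - b) ^ k ≤ Real.exp (-b) ^ k := by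
          gcongr
          have := Real.add_one_le_exp (-b)
          linarith
      _ = Real.exp (-(k * b)) := by rw [← Real.exp_nat_mul]; ring_nf
      _ ≤ Real.exp (-Real.log (8 / ε)) := by
          apply Real.exp_le_exp.2
          have h3 : 192 / δ * Real.log (8 / ε) * (δ / 2) ≤ k * b :=
            mul_le_mul hk.le hδb (by positivity) (by positivity)
          have h4 : 192 / δ * Real.log (8 / ε) * (δ / 2) = 96 * Real.log (8 / ε) := by
            field_simp
            ring
          linarith
      _ = ε / 8 := by
          rw [Real.exp_neg, Real.exp_log (by positivity), inv_div]
  -- With `hexp` and `b ≤ 1`, `hmain'` would give `ε ≤ ε/8 + ε/2`.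
  nlinarith

/-- The failure budget is `δ/2` for exceptional samples, `δ/4` for an unlucky search, and `δ/8` for
each of the two terms in the decoding bound. -/
theorem le_successProb_reduction (hm : 0 < m) (hk : 0 < k) (hε : 0 < ε) (hδ : 0 < δ)
    (hη0 : 0 < η) (hη1 : η < 1 / 8)
    (hmn : 2 / (1 - entropyTwo (4 * η)) * (n : ℝ) < m)
    (hk1 : 192 / δ * Real.log (8 / ε) < k)
    (hk2 : (k : ℝ) < ε / 8 * min ((2 : ℝ) ^ n) (Real.exp (η * m / 3)))
    (O : Solver (n * k) m) (hO : ε ≤ successProb ((1 - (1 - 2 * η) ^ k) / 2) O) :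
    1 - δ ≤ successProb η (reduction solve n m k ε δ η O) := by
  have hG : ENNReal.ofReal ε ≤ ex (iid (sample η n m) k) (joinedSuccess O) := by
    rw [successProb_eq] at hO
    rw [ex_joinedSuccess hη0.le (by linarith)]
    exact (ENNReal.ofReal_le_iff_le_toReal (ne_top_of_le_ne_top ENNReal.one_ne_top
      (ex_le_one fun a => PMF.coe_le_one _ _))).2 hO
  have hε1 : ε ≤ 1 :=
    ENNReal.ofReal_le_one.1 (hG.trans (ex_le_one (joinedSuccess_le_one O)))
  have hm' : (0 : ℝ) < m := by exact_mod_cast hm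
  have hkr : (1 : ℝ) ≤ k := by exact_mod_cast hk
  have hlog8 : 1 ≤ Real.log (8 / ε) := by
    rw [Real.le_log_iff_exp_le (by positivity), le_div_iff₀ hε]
    have := Real.exp_one_lt_d9
    nlinarith
  have hkδ : 192 < k * δ := by
    have : 192 / δ * 1 ≤ 192 / δ * Real.log (8 / ε) := by gcongr
    rw [mul_one] at this
    exact (div_lt_iff₀ hδ).1 (this.trans_lt hk1)
  have hk2n : (k : ℝ) < ε / 8 * 2 ^ n :=
    hk2.trans_le (by gcongr; exact min_le_left _ _)
  have hk2e : (k : ℝ) < ε / 8 * Real.exp (η * m / 3) :=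
    hk2.trans_le (by gcongr; exact min_le_right _ _)
  have hexp : 8 * (k : ℝ) < Real.exp (η * m / 3) := by
    have := Real.exp_pos (η * m / 3)
    nlinarith
  have hpow : 8 * (k : ℝ) < 2 ^ n := by
    have : (0 : ℝ) < 2 ^ n := by positivity
    nlinarith
  -- Since `k ≥ 1`, `hexp` gives `exp(ηm/3) > 8 > exp 2`.
  have hηm : 6 ≤ η * m := by
    have h1 : Real.exp 2 < Real.exp (η * m / 3) := by
      have h2 : Real.exp 2 = Real.exp 1 * Real.exp 1 := by rw [← Real.exp_add]; norm_num
      have h3 := Real.exp_one_lt_d9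
      have h4 := Real.exp_pos 1
      nlinarith
    have := Real.exp_lt_exp.1 h1
    linarith
  have hkm : (k : ℝ) ≤ 2 ^ m := by
    have h1 : Real.exp (η * m / 3) ≤ 2 ^ m := by
      have h2 : (2 : ℝ) ^ m = Real.exp (m * Real.log 2) := by
        rw [Real.exp_nat_mul, Real.exp_log (by norm_num)]
      rw [h2]
      apply Real.exp_le_exp.2
      have := Real.log_two_gt_d9
      nlinarith
    linarith
  -- The sample size condition in nats. Clearing the denominator needs `H₂(4η) < 1`, which holds
  -- because `4η < 1/2`.
  have hent : 2 * n * Real.log 2 ≤ m * (Real.log 2 - Real.binEntropy (4 * η)) := by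
    have hlt : Real.binEntropy (4 * η) < Real.log 2 :=
      Real.binEntropy_lt_log_two.2 (by norm_num; linarith)
    have hl2 : 0 < Real.log 2 := Real.log_pos (by norm_num)
    have h1 : 0 < 1 - entropyTwo (4 * η) := by
      rw [entropyTwo, sub_pos, div_lt_one hl2]
      exact hlt
    rw [div_mul_eq_mul_div, div_lt_iff₀ h1] at hmn
    have h2 : (1 - entropyTwo (4 * η)) * Real.log 2 = Real.log 2 - Real.binEntropy (4 * η) := by
      rw [entropyTwo]
      field_simp
    rw [← h2, ← mul_assoc]
    gcongr
  classical
  set μ := sample η n m with hμ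
  set B : Set (Sample n m) := {a | ∑ j, ex (iid μ k) (fun ω =>
    joinedSuccess O (Function.update ω j a)) ≤ ENNReal.ofReal (ε / 2)} with hB
  have hexc := exceptional_lt μ (joinedSuccess O) (joinedSuccess_le_one O) hε hδ hk1 hG B
    fun a ha => ha
  have hdec := ex_not_decodable_le hη0 hη1.le hent
  have hgood : ∀ a, a ∉ B → a.Decodable → 1 ≤
      reduction solve n m k ε δ η O a.inst a.2.1 + ENNReal.ofReal (δ / 4) := by
    intro a ha hd
    rw [← tsub_le_iff_right]
    refine le_trans (tsub_le_tsub_left ?_ 1) (one_sub_le_reduction hη0.le (by linarith) ε δ hd)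
    have hprod := prod_one_sub_le (fun j => ex (iid μ k) (fun ω =>
      joinedSuccess O (Function.update ω j a)))
      (fun j => candidate O a.inst (truncate (4 * m) η) j a.2.1)
      (fun j => ex_le_one fun ω => joinedSuccess_le_one O _)
      (fun j => half_ex_joinedSuccess_le hm hkm hηm (by linarith) O j a)
      (τ := ε / 2) (le_of_lt (not_le.1 ha))
    refine (pow_le_pow_left' (pow_le_pow_left' hprod k) _).trans ?_
    rw [← ENNReal.ofReal_pow (by positivity), ← ENNReal.ofReal_pow (by positivity),
      ← Real.exp_nat_mul, ← Real.exp_nat_mul]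
    refine ENNReal.ofReal_le_ofReal ?_
    have hE : 1 ≤ (⌈1 / ε⌉₊ : ℝ) * ε := by
      have := Nat.le_ceil (1 / ε)
      rwa [div_le_iff₀ hε] at this
    -- The `k⌈1/ε⌉` sweeps cancel `ε` and leave `exp(-k/4) ≤ 4/k`, which `192 < k * δ` makes smaller
    -- than `δ/4`.
    have h1 : ((⌈1 / ε⌉₊ : ℝ) * (k * -(ε / 2 / 2))) ≤ -(k / 4) := by nlinarith
    have h2 : Real.exp (-((k : ℝ) / 4)) ≤ ((k : ℝ) / 4)⁻¹ := by
      rw [Real.exp_neg]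
      refine inv_anti₀ (by positivity) ?_
      have := Real.add_one_le_exp ((k : ℝ) / 4)
      linarith
    refine (Real.exp_le_exp.2 h1).trans (h2.trans ?_)
    rw [inv_le_iff_one_le_mul₀ (by positivity)]
    nlinarith
  have hpt : ∀ a, (1 : ℝ≥0∞) ≤ reduction solve n m k ε δ η O a.inst a.2.1 +
      ENNReal.ofReal (δ / 4) + ((if a ∈ B then 1 else 0) + if a.Decodable then 0 else 1) := by
    intro a
    by_cases ha : a ∈ B
    · rw [if_pos ha]
      exact le_trans le_self_add le_add_self
    by_cases hd : a.Decodable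
    · exact (hgood a ha hd).trans le_self_add
    · rw [if_neg hd]
      exact le_trans le_add_self le_add_self
  have htotal := (ex_const μ 1).symm.le.trans (ex_mono fun a _ => hpt a)
  rw [ex_add, ex_add, ex_add, ex_const] at htotal
  have hS : (ex μ fun a => reduction solve n m k ε δ η O a.inst a.2.1) =
      ENNReal.ofReal (successProb η (reduction solve n m k ε δ η O)) := by
    rw [successProb_eq, ENNReal.ofReal_toReal (ne_top_of_le_ne_top ENNReal.one_ne_top
      (ex_le_one fun a => PMF.coe_le_one _ _))]
  have hS0 : 0 ≤ successProb η (reduction solve n m k ε δ η O) := by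
    rw [successProb_eq]
    exact ENNReal.toReal_nonneg
  have hfinal := htotal.trans (add_le_add le_rfl (add_le_add hexc.le hdec))
  rw [hS, ← ENNReal.ofReal_add hS0 (by positivity), ← ENNReal.ofReal_add (by positivity)
    (by positivity), ← ENNReal.ofReal_add (by positivity) (by positivity),
    ENNReal.one_le_ofReal] at hfinal
  have hsmall : ∀ y : ℝ, 8 * k < y → y⁻¹ ≤ δ / 8 := by
    intro y hy
    have hy0 : 0 < y := by linarith
    rw [inv_le_iff_one_le_mul₀ hy0]
    nlinarith
  have h1 := hsmall _ hpow
  have h2 := hsmall _ hexp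
  rw [← Real.exp_neg] at h2
  linarith

end Success

/-! ### Running time -/

section Time

variable {n m k : ℕ} {ε δ η : ℝ}

/-- The only `query` sits below the three outer loops, none of which runs up to `m`; hence the query
bound is free of `m`. -/
lemma search_queryCost (ρ : ℕ → ℕ) : search.queryCost ρ = ρ 3 * (ρ 2 * (ρ 2 * 1)) := by
  simp [search, attempt, sampleMatrix, sampleSecret, copyVector, addNoise, sampleBit, embed,
    multiply, extract, weigh, keepBest, Prog.count, Prog.queryCost]

lemma setup_fixedCounters : setup.fixedCounters 5 := by
  simp [setup, Prog.fixedCounters]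

lemma search_fixedCounters : search.fixedCounters 10 := by
  simp [search, attempt, sampleMatrix, sampleSecret, copyVector, addNoise, sampleBit, embed,
    multiply, extract, weigh, keepBest, Prog.count, Prog.fixedCounters]

/-- The two halves are treated separately, because `setup` writes registers that serve as counters
in `search`. The bound `4 * Y ^ 2` covers the counters `4 * m` and `n * k`. -/
lemma solve_bounds (O : Solver (n * k) m) (x : Inst n m) (hn : 0 < n) :
    ∀ s ∈ (finalState solve n m k ε δ η O x).support,
      s.time ≤ solve.size * (4 * (n + m + k + ⌈1 / ε⌉₊ + ⌈1 / δ⌉₊) ^ 2) ^ solve.depth ∧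
      s.queries ≤ ⌈1 / ε⌉₊ * (k * k) := by
  set s₀ := initState n m k ε δ η x with hs₀
  set Y := n + m + k + ⌈1 / ε⌉₊ + ⌈1 / δ⌉₊ with hY
  have hY1 : 1 ≤ Y := by omega
  have hX : 1 ≤ 4 * Y ^ 2 := by nlinarith
  have hYX : Y ≤ 4 * Y ^ 2 := by nlinarith
  have h0 : ∀ r < 5, s₀.reg r ≤ 4 * Y ^ 2 := by
    intro r hr
    refine le_trans ?_ hYX
    interval_cases r
    · change n ≤ Y
      omega
    · change m ≤ Y
      omega
    · change k ≤ Y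
      omega
    · change ⌈1 / ε⌉₊ ≤ Y
      omega
    · change ⌈1 / δ⌉₊ ≤ Y
      omega
  have hsetup : Alw (setup.run O s₀) fun t => (∀ r < 10, t.reg r ≤ 4 * Y ^ 2) ∧ t.reg 2 = k ∧
      t.reg 3 = ⌈1 / ε⌉₊ := by
    have h1 := (alw_setup (O := O) (η := η) (x := x) ε δ).and
      (alw_frame O setup (initState n m k ε δ η x).mem)
    rw [← map_mem_run, alw_map] at h1
    refine h1.mono ?_
    rintro t ⟨⟨hb, -⟩, hF⟩
    have h4 : t.reg 4 = ⌈1 / δ⌉₊ := hF.1 4 rfl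
    refine ⟨fun r hr => ?_, hb.r2, hb.r3⟩
    have q0 : t.reg 0 = n := hb.r0
    have q1 : t.reg 1 = m := hb.r1
    have q2 : t.reg 2 = k := hb.r2
    have q3 : t.reg 3 = ⌈1 / ε⌉₊ := hb.r3
    have q5 : t.reg 5 = 4 * m := hb.r5
    have q6 : t.reg 6 = 1 := hb.r6
    have q7 : t.reg 7 = 0 := hb.r7
    have q8 : t.reg 8 = n * k := hb.r8
    have q9 : t.reg 9 = k - 1 := hb.r9
    interval_cases r
    · omega
    · omega
    · omega
    · omega
    · omega
    · have : m ≤ Y := by omega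
      nlinarith
    · omega
    · omega
    · have e1 : n ≤ Y := by omega
      have e2 : k ≤ Y := by omega
      have := Nat.mul_le_mul e1 e2
      nlinarith
    · omega
  have hrun : Alw (solve.run O s₀) fun t =>
      t.time ≤ solve.size * (4 * Y ^ 2) ^ solve.depth ∧ t.queries ≤ ⌈1 / ε⌉₊ * (k * k) := by
    change Alw ((setup.run O s₀).bind fun t => search.run O t) _
    refine (hsetup.and (Prog.run_bounds O s₀.reg setup setup_fixedCounters s₀
      fun _ _ => rfl)).bind ?_
    rintro t ⟨⟨ht, t2, t3⟩, -, htime, hq⟩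
    refine (Prog.run_bounds O t.reg search search_fixedCounters t fun _ _ => rfl).mono ?_
    rintro u ⟨-, hu1, hu2⟩
    constructor
    · have c1 := Prog.cost_le hX h0 setup setup_fixedCounters
      have c2 := Prog.cost_le hX ht search search_fixedCounters
      have d1 : (4 * Y ^ 2) ^ setup.depth ≤ (4 * Y ^ 2) ^ solve.depth :=
        Nat.pow_le_pow_right hX (le_max_left _ _)
      have d2 : (4 * Y ^ 2) ^ search.depth ≤ (4 * Y ^ 2) ^ solve.depth :=
        Nat.pow_le_pow_right hX (le_max_right _ _)
      have e1 := c1.trans (Nat.mul_le_mul_left setup.size d1)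
      have e2 := c2.trans (Nat.mul_le_mul_left search.size d2)
      have e3 : s₀.time = 0 := rfl
      have e4 : solve.size = setup.size + search.size := rfl
      rw [e4, add_mul]
      omega
    · have e1 : setup.queryCost s₀.reg = 0 := by simp [setup, Prog.queryCost]
      have e2 : s₀.queries = 0 := rfl
      rw [search_queryCost, t2, t3, mul_one] at hu2
      omega
  exact hrun

/-- Rounding up `1/ε` and `1/δ` adds at most `2`, so the sum is at most `3 * Z` as `Z ≥ 1`, and `36
= 4 * 3 ^ 2`. The extra `2` and `3` in the constants accommodate the query bound `2 * Z ^ 3`. -/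
lemma solve_polynomial (O : Solver (n * k) m) (x : Inst n m) (hn : 0 < n) (hε : 0 < ε)
    (hδ : 0 < δ) : ∀ s ∈ (finalState solve n m k ε δ η O x).support,
      (s.time : ℝ) ≤ (solve.size * 36 ^ solve.depth + 2 : ℕ) *
        (n + m + k + 1 / δ + 1 / ε) ^ (2 * solve.depth + 3) ∧
      (s.queries : ℝ) ≤ (solve.size * 36 ^ solve.depth + 2 : ℕ) *
        (n + k + 1 / δ + 1 / ε) ^ (2 * solve.depth + 3) := by
  intro s hs
  obtain ⟨h1, h2⟩ := solve_bounds O x hn s hs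
  have hn' : (1 : ℝ) ≤ n := by exact_mod_cast hn
  have hδ' : 0 < 1 / δ := by positivity
  have hε' : 0 < 1 / ε := by positivity
  have hE := (Nat.ceil_lt_add_one hε'.le).le
  have hD := (Nat.ceil_lt_add_one hδ'.le).le
  have hk0 : (0 : ℝ) ≤ k := Nat.cast_nonneg k
  have hm0 : (0 : ℝ) ≤ m := Nat.cast_nonneg m
  push_cast
  constructor
  · set Z : ℝ := n + m + k + 1 / δ + 1 / ε with hZ
    have hZ1 : 1 ≤ Z := by linarith
    have h3 : (s.time : ℝ) ≤
        solve.size * (4 * (n + m + k + ⌈1 / ε⌉₊ + ⌈1 / δ⌉₊ : ℝ) ^ 2) ^ solve.depth := by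
      exact_mod_cast h1
    calc (s.time : ℝ) ≤ solve.size * (4 * (3 * Z) ^ 2) ^ solve.depth := by
          refine h3.trans ?_
          gcongr
          linarith
      _ = solve.size * 36 ^ solve.depth * Z ^ (2 * solve.depth) := by
          rw [show 4 * (3 * Z) ^ 2 = 36 * Z ^ 2 by ring, mul_pow, ← pow_mul, mul_assoc]
      _ ≤ (solve.size * 36 ^ solve.depth + 2) * Z ^ (2 * solve.depth + 3) := by
          gcongr
          · linarith
          · omega
  · set Z : ℝ := n + k + 1 / δ + 1 / ε with hZ
    have hZ1 : 1 ≤ Z := by linarith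
    have h3 : (s.queries : ℝ) ≤ ⌈1 / ε⌉₊ * (k * k) := by exact_mod_cast h2
    calc (s.queries : ℝ) ≤ (2 * Z) * (Z * Z) := by
          refine h3.trans ?_
          gcongr <;> linarith
      _ = 2 * Z ^ 3 := by ring
      _ ≤ (solve.size * 36 ^ solve.depth + 2) * Z ^ (2 * solve.depth + 3) := by
          gcongr
          · have : (0 : ℝ) ≤ solve.size * 36 ^ solve.depth := by positivity
            linarith
          · omega

end Time

end LPN

end

theorem mainTheorem2 :
    ∃ (R : LPN.Prog) (C d : ℕ),
      ∀ (n m k : ℕ) (ε δ η : ℝ),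
        0 < n → 0 < m → 0 < k →
        0 < ε → 0 < δ → 0 < η → η < 1 / 8 →
        2 / (1 - LPN.entropyTwo (4 * η)) * (n : ℝ) < (m : ℝ) →
        192 / δ * Real.log (8 / ε) < (k : ℝ) →
        (k : ℝ) < ε / 8 * min ((2 : ℝ) ^ n) (Real.exp (η * m / 3)) →
        (∀ O : LPN.Solver (n * k) m,
          ε ≤ LPN.successProb ((1 - (1 - 2 * η) ^ k) / 2) O →
          1 - δ ≤ LPN.successProb η (LPN.reduction R n m k ε δ η O)) ∧
        (∀ (O : LPN.Solver (n * k) m) (x : LPN.Inst n m),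
          ∀ s ∈ (LPN.finalState R n m k ε δ η O x).support,
            (s.time : ℝ) ≤ C * (n + m + k + 1 / δ + 1 / ε) ^ d ∧
            (s.queries : ℝ) ≤ C * (n + k + 1 / δ + 1 / ε) ^ d) := by
  refine ⟨LPN.solve, LPN.solve.size * 36 ^ LPN.solve.depth + 2, 2 * LPN.solve.depth + 3, ?_⟩
  intro n m k ε δ η hn hm hk hε hδ hη0 hη1 hmn hk1 hk2
  exact ⟨fun O hO => LPN.le_successProb_reduction hm hk hε hδ hη0 hη1 hmn hk1 hk2 O hO,
    fun O x => LPN.solve_polynomial O x hn hε hδ⟩
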